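/- Let $\mathbf{k}$ be a field, $M=\mathbb{Z}^3$ with standard basis $e_1,e_2,e_3$, $M_{\mathbb R}=\mathbb{R}^3$, and $e_4=-e_1-e_2-e_3$, so that $e_1,\dots,e_4$ generate the rays of the fan of $\mathbb{P}^3$. Let $\ell_1,\ell_2$ be disjoint lines contained in the toric divisors $D_1,D_2\subset\mathbb{P}^3$ of the rays $\mathbb{R}_{\ge0}e_1$, $\mathbb{R}_{\ge0}e_2$. Put $P=M\oplus\mathbb{N}^2$, let $t_1,t_2$ be the monomials of the generators of $\mathbb{N}^2$, write $x=z^{e_1}$, $y=z^{e_2}$, and let $\widehat{\mathbf{k}[P]}$ be the completion of $\mathbf{k}[P]$ at the ideal $\mathfrak{m}$ generated by the non-invertible monomials. For $p\in P$ let $\bar p\in M$ be its $M$-component. A wall is a pair $(\mathfrak d,f_{\mathfrak d})$ of a two-dimensional rational polyhedron $\mathfrak d\subset M_{\mathbb R}$ and a function $f_{\mathfrak d}=\sum c_pz^p\in\widehat{\mathbf{k}[P]}$, $f_{\mathfrak d}\equiv1$ modulo $\mathfrak m$, such that $\bar p$ is tangent to $\mathfrak d$ whenever $c_p\ne0$.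 It has direction $v\in M\setminus\{0\}$, where $v$ is tangent to $\mathfrak d$, if every $p\neq0$ with $c_p\ne 0$ has $\bar p=-kv$ for an integer $k\ge1$; a wall with direction $v$ is incoming if $\mathfrak d=\mathfrak d-\mathbb{R}_{\ge0}v$. A wall structure is a set of walls of which, for each $n$, only finitely many are non-trivial modulo $\mathfrak m^n$. Crossing a wall $\mathfrak d$ acts by $z^p\mapsto f_{\mathfrak d}^{\langle n_{\mathfrak d},\bar p\rangle}z^p$, where $n_{\mathfrak d}$ is the primitive integral conormal of $\mathfrak d$ that is positive on the side from which the wall is crossed; the path-ordered product along a path that avoids the boundaries of walls and the intersections of walls of codimension at least two, and is transversal to all walls, is the composition of the wall crossings in the order traversed (all of this modulo $\mathfrak m^n$, for every $n$). A wall structure is consistent if all path-ordered products along sufficiently small loops around joints (the codimension two strata of its singular locus) are the identity, and two wall structures are equivalent if they induce the same path-ordered products. Let $\mathfrak D_{\mathrm{in}}$ consist of the walls $$(\langle e_1,e_j\rangle,\,1+t_1x)\ \ (j=2,3,4),\qquad(\langle e_2,e_j\rangle,\,1+t_2y)\ \ (j=1,3,4),$$ where $\langle u,v\rangle$ is the cone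 generated by $u$ and $v$. (The exponents, namely the intersection numbers of $\ell_i$ with the toric lines in $D_i\cong\mathbb{P}^2$, are all $1$.) Then there is a consistent wall structure $\mathfrak D_{(\mathbb{P}^3,\ell_1\cup\ell_2)}\supseteq\mathfrak D_{\mathrm{in}}$ all of whose walls outside $\mathfrak D_{\mathrm{in}}$ have a direction and are not incoming, and every such wall structure is equivalent to the consistent wall structure given by the following finite list: - $\langle e_1,e_2\rangle,\ \langle e_1,e_3\rangle,\ \langle e_1,e_4\rangle$, with function $1+t_1x$; - $\langle e_2,e_1\rangle,\ \langle e_2,e_3\rangle,\ \langle e_2,e_4\rangle$, with function $1+t_2y$; - $\langle e_3,-e_1\rangle,\ \langle e_4,-e_1\rangle$, with function $1+t_1x$; - $\langle e_3,-e_2\rangle,\ \langle e_4,-e_2\rangle$, with function $1+t_2y$; - $\langle -e_2,-e_1-e_2\rangle,\ \langle -e_1,-e_1-e_2\rangle,\ \langle e_3,-e_1-e_2\rangle,\ \langle e_4,-e_1-e_2\rangle$, with function $1+t_1t_2xy$; - $\langle e_1,-e_2\rangle$, with function $1+t_2y+t_1t_2xy$; - $\langle e_2,-e_1\rangle$, with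 function $1+t_1x+t_1t_2xy$. -/

import Mathlib

namespace WallStructures

/-! ### Lattices, monoid rings and their completion -/

/-- The cocharacter lattice `M = ℤ³`. Covectors, i.e. elements of `Hom(M, ℤ)`, are also written as
integral vectors and paired with `M` by the dot product. -/
abbrev M : Type := Fin 3 → ℤ

/-- The real vector space `M_ℝ = ℝ³`. -/
abbrev MR : Type := Fin 3 → ℝ

/-- The monoid `P = M ⊕ ℕ ⊕ ℕ`, one copy of `ℕ` for each of the two (connected) centres. -/
abbrev P : Type := M × (Fin 2 → ℕ)

/-- The inclusion `M ⊆ M_ℝ`; also used for covectors. -/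
def toReal (m : M) : MR := fun i => (m i : ℝ)

section Rings

variable (K : Type*) [Field K]

/-- The monoid ring `K[P]`. -/
abbrev KP : Type _ := AddMonoidAlgebra K P

/-- The ideal of `K[P]` generated by the monomials `z^p`, `p ∈ P` not invertible. -/
noncomputable def mP : Ideal (KP K) :=
  Ideal.span {g | ∃ p : P, ¬ IsAddUnit p ∧ g = AddMonoidAlgebra.single p 1}

/-- The completion of `K[P]` with respect to `mP`. -/
abbrev KPhat : Type _ := AdicCompletion (mP K) (KP K)

/-- The ring `K[P] / mP ^ n`. -/
abbrev KPmod (n : ℕ) : Type _ := KP K ⧸ (mP K) ^ n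

end Rings

variable {K : Type*} [Field K]

/-- Reduction of an element of the completion modulo the `n`-th power of the ideal. -/
noncomputable def trunc (n : ℕ) (f : KPhat K) : KPmod K n := AdicCompletion.evalₐ (mP K) n f

/-- `f` is a (possibly infinite) sum `∑ c_p z^p` over exponents `p ∈ S`: modulo each power of the
ideal it is a finite such sum. -/
def SupportedOn (f : KPhat K) (S : Set P) : Prop :=
  ∀ n : ℕ, ∃ g : KP K, (∀ p ∈ g.coeff.support, p ∈ S) ∧
    trunc n f = Ideal.Quotient.mk ((mP K) ^ n) g

/-! ### Walls and wall structures on `M_ℝ` -/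

/-- A finite intersection of rational closed affine half spaces. -/
def IsRationalPolyhedron (s : Set MR) : Prop :=
  ∃ H : Finset (M × ℤ), s = {x | ∀ h ∈ H, (h.2 : ℝ) ≤ toReal h.1 ⬝ᵥ x}

/-- The dimension of (the affine span of) a convex set. -/
noncomputable def dim (s : Set MR) : ℕ := Module.finrank ℝ (affineSpan ℝ s).direction

/-- The lattice `Λ_s` of integral vectors tangent to `s`. -/
def tangentLattice (s : Set MR) : Set M := {m | toReal m ∈ (affineSpan ℝ s).direction}

variable (K) in
/-- The data of a wall: its support and the attached function. -/
@[ext]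
structure Wall where
  carrier : Set MR
  func : KPhat K

/-- Walls on `M_ℝ` over `P`: rational polyhedra of codimension one, with a function that only
involves exponents tangent to the wall and that is `1` modulo the ideal. -/
structure IsWall (d : Wall K) : Prop where
  polyhedron : IsRationalPolyhedron d.carrier
  codim_one : dim d.carrier = 2
  tangent : SupportedOn d.func {p | p.1 ∈ tangentLattice d.carrier}
  func_one : trunc 1 d.func = 1

/-- The wall has direction `v`: every exponent `p ≠ 0` of the attached function has `M`-component
a negative multiple of the nonzero vector `v`, which is tangent to the wall. -/
def HasDirection (d : Wall K) (v : M) : Prop :=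
  v ≠ 0 ∧ v ∈ tangentLattice d.carrier ∧
    SupportedOn d.func {p | p = 0 ∨ ∃ k : ℕ, 0 < k ∧ p.1 = -(k • v)}

/-- The support `𝔡` satisfies `𝔡 = 𝔡 - ℝ_{≥0} v`. -/
def IsIncoming (d : Wall K) (v : M) : Prop :=
  d.carrier = {y | ∃ x ∈ d.carrier, ∃ s : ℝ, 0 ≤ s ∧ y = x - s • toReal v}

/-- A wall that has a direction and is not incoming. -/
def IsNonIncoming (d : Wall K) : Prop :=
  ∃ v : M, HasDirection d v ∧ ¬ IsIncoming d v

/-- The walls whose function is nontrivial modulo the `n`-th power of the ideal. -/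
def atOrder (D : Set (Wall K)) (n : ℕ) : Set (Wall K) := {d ∈ D | trunc n d.func ≠ 1}

/-- A wall structure over the completed ring: a set of walls that is finite to every order. -/
def IsWallStructure (D : Set (Wall K)) : Prop :=
  (∀ d ∈ D, IsWall d) ∧ ∀ n : ℕ, (atOrder D n).Finite

/-- The singular locus: boundaries of walls and intersections of pairs of walls of codimension at
least two. -/
def Sing (D : Set (Wall K)) : Set MR :=
  {x | ∃ d ∈ D, x ∈ intrinsicFrontier ℝ d.carrier} ∪
  {x | ∃ d ∈ D, ∃ d' ∈ D, dim (d.carrier ∩ d'.carrier) ≤ 1 ∧ x ∈ d.carrier ∩ d'.carrier}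

/-! ### Wall crossing and path-ordered products -/

/-- The reduction of the wall function as a unit of `K[P] / mP ^ n` (it is one, being `1` modulo the
nilpotent ideal; the value for a non-unit is irrelevant). -/
noncomputable def truncUnit (n : ℕ) (f : KPhat K) : (KPmod K n)ˣ :=
  open Classical in if h : IsUnit (trunc n f) then h.unit else 1

/-- The homomorphism of monoids `p ↦ u ^ ⟨ν, p̄⟩ z^p`. -/
noncomputable def crossingMonoidHom (n : ℕ) (u : (KPmod K n)ˣ) (ν : M) :
    Multiplicative P →* KPmod K n where
  toFun p := ((u ^ (ν ⬝ᵥ p.toAdd.1) : (KPmod K n)ˣ) : KPmod K n) *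
    Ideal.Quotient.mk ((mP K) ^ n) (AddMonoidAlgebra.single p.toAdd 1)
  map_one' := by
    simp [← AddMonoidAlgebra.one_def]
  map_mul' p q := by
    have h : (AddMonoidAlgebra.single (p.toAdd + q.toAdd) 1 : KP K) =
        AddMonoidAlgebra.single p.toAdd 1 * AddMonoidAlgebra.single q.toAdd 1 := by
      rw [AddMonoidAlgebra.single_mul_single, one_mul]
    rw [toAdd_mul, h, map_mul, Prod.fst_add, dotProduct_add, zpow_add, Units.val_mul]
    ring

lemma crossing_kills (n : ℕ) (u : (KPmod K n)ˣ) (ν : M) (g : KP K) (hg : g ∈ (mP K) ^ n) :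
    AddMonoidAlgebra.lift K (KPmod K n) P (crossingMonoidHom n u ν) g = 0 := by
  set φ := AddMonoidAlgebra.lift K (KPmod K n) P (crossingMonoidHom n u ν) with hφ
  have h1 : Ideal.map φ (mP K) ≤ Ideal.map (Ideal.Quotient.mk ((mP K) ^ n)) (mP K) := by
    rw [Ideal.map_le_iff_le_comap]
    refine Ideal.span_le.2 ?_
    rintro _ ⟨p, hp, rfl⟩
    have : φ (AddMonoidAlgebra.single p 1) = crossingMonoidHom n u ν (Multiplicative.ofAdd p) := by
      rw [hφ, AddMonoidAlgebra.lift_single, one_smul]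
    rw [SetLike.mem_coe, Ideal.mem_comap, this]
    exact Ideal.mul_mem_left _ _ (Ideal.mem_map_of_mem _ (Ideal.subset_span ⟨p, hp, rfl⟩))
  have h2 : φ g ∈ Ideal.map φ ((mP K) ^ n) := Ideal.mem_map_of_mem _ hg
  rw [Ideal.map_pow] at h2
  have h3 := Ideal.pow_right_mono h1 n h2
  rwa [← Ideal.map_pow, Ideal.map_quotient_self, Ideal.mem_bot] at h3

/-- The endomorphism `z^p ↦ f ^ ⟨ν, p̄⟩ z^p` of `K[P] / mP ^ n`. -/
noncomputable def wallCrossing (n : ℕ) (f : KPhat K) (ν : M) : KPmod K n →ₐ[K] KPmod K n :=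
  Ideal.Quotient.liftₐ ((mP K) ^ n)
    (AddMonoidAlgebra.lift K (KPmod K n) P (crossingMonoidHom n (truncUnit n f) ν))
    (crossing_kills n (truncUnit n f) ν)

/-- `ν` generates the group `Λ_s^⊥` of integral covectors vanishing on `Λ_s`. -/
def IsNormal (s : Set MR) (ν : M) : Prop :=
  ∀ μ : M, (∀ m ∈ tangentLattice s, μ ⬝ᵥ m = 0) ↔ ∃ c : ℤ, μ = c • ν

/-- The path `γ : [0,1] → M_ℝ` meets the wall at time `t`, passing from one side to the other, and
`ν` is the generator of `Λ_𝔡^⊥` that is positive on the side of `γ` just before `t`. -/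
def CrossesAt (γ : ℝ → MR) (d : Wall K) (t : ℝ) (ν : M) : Prop :=
  γ t ∈ d.carrier ∧ IsNormal d.carrier ν ∧
    ∃ ε : ℝ, 0 < ε ∧ 0 ≤ t - ε ∧ t + ε ≤ 1 ∧
      (∀ s ∈ Set.Ioo (t - ε) t, toReal ν ⬝ᵥ γ t < toReal ν ⬝ᵥ γ s) ∧
      (∀ s ∈ Set.Ioo t (t + ε), toReal ν ⬝ᵥ γ s < toReal ν ⬝ᵥ γ t)

/-- A continuous path on `[0,1]` that is smooth on every closed subinterval without a break point
in its interior, for a finite set of break points. -/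
def IsPiecewiseSmooth (γ : ℝ → MR) : Prop :=
  ContinuousOn γ (Set.Icc 0 1) ∧
    ∃ S : Finset ℝ, ∀ a b : ℝ, 0 ≤ a → a < b → b ≤ 1 → (∀ s ∈ S, s ∉ Set.Ioo a b) →
      ContDiffOn ℝ (⊤ : ℕ∞) γ (Set.Icc a b)

/-- A piecewise smooth path that avoids the singular locus and is transversal to all walls. -/
structure IsAdmissible (D : Set (Wall K)) (γ : ℝ → MR) : Prop where
  smooth : IsPiecewiseSmooth γ
  avoids : ∀ t ∈ Set.Icc (0 : ℝ) 1, γ t ∉ Sing D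
  transversal : ∀ t ∈ Set.Icc (0 : ℝ) 1, ∀ d ∈ D, γ t ∈ d.carrier → ∃ ν, CrossesAt γ d t ν

/-- `θ` is a path-ordered product along `γ` modulo the `n`-th power of the ideal: there is a complete
list of the crossings (time, wall, normal covector) of `γ` with the walls of `D`, in the order of the
times, and `θ` is the composition of the wall crossings, with the first crossing applied first.
(Walls crossed at the same time span the same plane, and their wall crossings commute.) -/
def IsPathOrderedProduct (D : Set (Wall K)) (n : ℕ) (γ : ℝ → MR)
    (θ : KPmod K n →ₐ[K] KPmod K n) : Prop :=
  ∃ L : List (ℝ × Wall K × M),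
    L.Nodup ∧ L.Pairwise (fun a b => a.1 ≤ b.1) ∧
    (∀ c : ℝ × Wall K × M,
      c ∈ L ↔ c.1 ∈ Set.Icc (0 : ℝ) 1 ∧ c.2.1 ∈ D ∧ CrossesAt γ c.2.1 c.1 c.2.2) ∧
    θ = L.foldl (fun acc c => (wallCrossing n c.2.1.func c.2.2).comp acc)
      (AlgHom.id K (KPmod K n))

/-! ### Consistency and equivalence -/

/-- A codimension two polyhedral subset of the singular locus such that the same walls pass through
all points of its interior. Joints are the maximal ones; since consistency is a condition at the
interior points of joints, maximality plays no role in it. -/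
structure IsJointCell (D : Set (Wall K)) (j : Set MR) : Prop where
  polyhedron : IsRationalPolyhedron j
  codim_two : dim j = 1
  subset_sing : j ⊆ Sing D
  walls_const : ∀ x ∈ intrinsicInterior ℝ j, ∀ y ∈ intrinsicInterior ℝ j,
    ∀ d ∈ D, x ∈ d.carrier ↔ y ∈ d.carrier

/-- Consistency: to every order, the path-ordered product along every sufficiently small loop around
(any interior point of) a joint is the identity. -/
def IsConsistent (D : Set (Wall K)) : Prop :=
  ∀ n : ℕ, ∀ j : Set MR, IsJointCell (atOrder D n) j → ∀ x ∈ intrinsicInterior ℝ j,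
    ∃ U ∈ nhds x, ∀ γ : ℝ → MR, IsAdmissible (atOrder D n) γ → γ 0 = γ 1 →
      (∀ t ∈ Set.Icc (0 : ℝ) 1, γ t ∈ U) →
      ∀ θ, IsPathOrderedProduct (atOrder D n) n γ θ → θ = AlgHom.id K (KPmod K n)

/-- Equivalence: to every order, the two wall structures induce the same path-ordered products along
all paths for which both are defined. -/
def Equivalent (D D' : Set (Wall K)) : Prop :=
  ∀ n : ℕ, ∀ γ : ℝ → MR, IsAdmissible (atOrder D n) γ → IsAdmissible (atOrder D' n) γ →
    ∀ θ θ', IsPathOrderedProduct (atOrder D n) n γ θ →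
      IsPathOrderedProduct (atOrder D' n) n γ θ' → θ = θ'

/-- `D` is a consistent wall structure containing `Din` such that all walls of `D` outside `Din` are
non-incoming. -/
structure IsConsistentCompletion (Din D : Set (Wall K)) : Prop where
  wallStructure : IsWallStructure D
  contains : Din ⊆ D
  nonIncoming : ∀ d ∈ D \ Din, IsNonIncoming d
  consistent : IsConsistent D

/-! ### `ℙ³` and two lines -/

/-- The cone `⟨u, v⟩` generated by two vectors. -/
def cone (u v : M) : Set MR :=
  {x | ∃ a b : ℝ, 0 ≤ a ∧ 0 ≤ b ∧ x = a • toReal u + b • toReal v}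

/-- The variable `t_i`. -/
noncomputable def t (i : Fin 2) : KP K := AddMonoidAlgebra.single (0, Pi.single i 1) 1

/-- The monomial `z^m`. -/
noncomputable def z (m : M) : KP K := AddMonoidAlgebra.single (m, 0) 1

/-- The wall with support `⟨u, v⟩` and function `g ∈ K[P]`. -/
noncomputable def coneWall (u v : M) (g : KP K) : Wall K :=
  ⟨cone u v, algebraMap (KP K) (KPhat K) g⟩

/-- The primitive generators `e₁, e₂, e₃, e₄ = -e₁-e₂-e₃` of the rays of the fan of `ℙ³`
(indexed from `0`). The two-dimensional cones are those generated by two distinct rays. -/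
def ray : Fin 4 → M := ![![1, 0, 0], ![0, 1, 0], ![0, 0, 1], ![-1, -1, -1]]

/-- The widget of a connected hypersurface `H` of degree `deg` in the toric divisor `D_i ≅ ℙ²` of the
ray `i`, with variable `t_a`: over all two-dimensional cones `ρ` of the fan containing the ray, the
walls `(ρ, (1 + t_a z^{m_i}) ^ (D_ρ · H))`. As `D_ρ` is a line in `D_i`, the intersection number
`D_ρ · H` is `deg`. -/
def widget (i : Fin 4) (a : Fin 2) (deg : ℕ) : Set (Wall K) :=
  {d | ∃ j : Fin 4, j ≠ i ∧ d = coneWall (ray i) (ray j) ((1 + t a * z (ray i)) ^ deg)}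

variable (K) in
/-- The initial wall structure of `ℙ³` and two lines in the toric divisors of the rays `e₁`, `e₂`. -/
def initialWalls : Set (Wall K) := widget 0 0 1 ∪ widget 1 1 1

variable (K) in
/-- The list of walls of the final wall structure; here `tx = t₁x` and `ty = t₂y`. -/
def finalWalls : Set (Wall K) :=
  let e₁ : M := ray 0
  let e₂ : M := ray 1
  let e₃ : M := ray 2
  let e₄ : M := ray 3
  let tx : KP K := t 0 * z e₁
  let ty : KP K := t 1 * z e₂
  {coneWall e₁ e₂ (1 + tx), coneWall e₁ e₃ (1 + tx), coneWall e₁ e₄ (1 + tx),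
   coneWall e₂ e₁ (1 + ty), coneWall e₂ e₃ (1 + ty), coneWall e₂ e₄ (1 + ty),
   coneWall e₃ (-e₁) (1 + tx), coneWall e₄ (-e₁) (1 + tx),
   coneWall e₃ (-e₂) (1 + ty), coneWall e₄ (-e₂) (1 + ty),
   coneWall (-e₂) (-e₁ - e₂) (1 + tx * ty), coneWall (-e₁) (-e₁ - e₂) (1 + tx * ty),
   coneWall e₃ (-e₁ - e₂) (1 + tx * ty), coneWall e₄ (-e₁ - e₂) (1 + tx * ty),
   coneWall e₁ (-e₂) (1 + ty + tx * ty),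
   coneWall e₂ (-e₁) (1 + tx + tx * ty)}

end WallStructures

/-! Two mechanisms carry the proof: a potential for the wall crossings gives consistency, and
first-order differences that propagate along lines give uniqueness.

Consistency. The listed walls are supported on the fifteen two-dimensional cones of a complete fan.
Its ten maximal cones are generated by two neighbours among e₁, e₂, -e₁, -e₁-e₂, -e₂ and one of e₃,
e₄. Each maximal cone receives a diagonal map z^p ↦ u^p̄ z^p such that the values on adjacent cones
differ by the crossing of their common wall; this amounts to fifteen families of identities in t₁x
and t₂y (`chamberUnits_crossing`). Around any admissible loop, small or not, the crossings carry the
potential at the start to the potential at the end. As the potential is surjective at the base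
point, the path-ordered product is the identity (`eq_id_of_potential`, `isConsistent_of_isModel`).

Existence. The functions 1+t₁x+t₁t₂xy and 1+t₂y+t₁t₂xy involve non-proportional exponents and so
have no direction; the final list itself is not a completion of the required kind. Each of the two
is written as an infinite product of factors 1+c_p z^p (`partialProd_spec`), and every factor
becomes a wall of its own. All exponents involve t₁x, respectively t₂y, and therefore point out of
the supporting cone, so these walls have a direction and are not incoming. The product over each
cone is unchanged, and the same potential applies (`isConsistentCompletion_split`).

Uniqueness. Let two completions be given and fix an order N. By induction on k, the products of wall
functions of the two, taken separately over the walls with exponents along each primitive vector r,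
agree at generic points up to terms of degree at least k. For the coefficient at an exponent q of
degree k with q̄ a positive multiple of r, a small ellipse is drawn around a point of a line
parallel to r. Both path-ordered products along it are trivial, and their difference in degree k is
the sum, over the crossings, of the differences of wall functions weighted by normals
(`compose_sub_compose`). Only the two crossings on the line can contribute at q, with opposite
signs, so the coefficient is the same on both sides of the point (`coeff_eq_across`). It is thus
constant along the line. Far out in the direction r no non-incoming wall along r is met, and the
initial walls belong to both structures, so the coefficient vanishes (`prodAt_eq_of_loopTrivial`).

Equivalence. Path-ordered products depend only on the products of wall functions at generic points
(`crossAt_eq_crossAt`), and the split and the final structures have the same products everywhere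
(`IsModel.prodAt_eq`). -/

namespace WallStructures

open Filter Topology
open scoped Matrix

variable {K : Type*} [Field K]

/-! ### The grading of `K[P]` by the total degree in the variables `t_i` -/

/-- The total degree of an exponent in the variables `t_i`. -/
def deg (p : P) : ℕ := p.2 0 + p.2 1

@[simp] lemma deg_add (p q : P) : deg (p + q) = deg p + deg q := by
  simp [deg]; ring

@[simp] lemma deg_zero : deg 0 = 0 := rfl

/-- The summand M is a group and ℕ² has no units besides 0, so the non-invertible monomials are
those divisible by some t_i. -/
lemma isAddUnit_iff_deg (p : P) : IsAddUnit p ↔ deg p = 0 := by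
  constructor
  · rintro ⟨u, rfl⟩
    have h : deg ((u : P) + ((-u : AddUnits P) : P)) = 0 := by rw [AddUnits.add_neg]; rfl
    rw [deg_add] at h
    omega
  · intro h
    have h0 : p.2 = 0 := by
      funext i
      simp only [deg] at h
      fin_cases i
      · simp; omega
      · simp; omega
    refine ⟨⟨p, (-p.1, 0), ?_, ?_⟩, rfl⟩ <;> ext i <;> simp [h0]

variable (K) in
/-- The ideal of elements all of whose exponents have degree at least `n`. -/
def degIdeal (n : ℕ) : Ideal (KP K) where
  carrier := {g | ∀ p, g.coeff p ≠ 0 → n ≤ deg p}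
  zero_mem' := by simp
  add_mem' := by
    intro a b ha hb p hp
    rw [AddMonoidAlgebra.coeff_add, Finsupp.add_apply] at hp
    by_cases h : a.coeff p = 0
    · exact hb p (by simpa [h] using hp)
    · exact ha p h
  smul_mem' := by
    classical
    intro c a ha p hp
    have h := AddMonoidAlgebra.support_coeff_mul_subset c a (Finsupp.mem_support_iff.2 hp)
    obtain ⟨q, -, r, hr, rfl⟩ := Finset.mem_add.1 h
    have := ha r (Finsupp.mem_support_iff.1 hr)
    rw [deg_add]; omega

lemma mem_degIdeal {n : ℕ} {g : KP K} :
    g ∈ degIdeal K n ↔ ∀ p, g.coeff p ≠ 0 → n ≤ deg p := Iff.rfl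

lemma single_mem_degIdeal {n : ℕ} {p : P} (c : K) (h : n ≤ deg p) :
    AddMonoidAlgebra.single p c ∈ degIdeal K n := by
  intro q hq
  rw [AddMonoidAlgebra.coeff_single, Finsupp.single_apply] at hq
  by_cases hpq : p = q
  · exact hpq ▸ h
  · simp [hpq] at hq

lemma degIdeal_mul_le (a b : ℕ) : degIdeal K a * degIdeal K b ≤ degIdeal K (a + b) := by
  classical
  rw [Ideal.mul_le]
  intro f hf g hg p hp
  have h := AddMonoidAlgebra.support_coeff_mul_subset f g (Finsupp.mem_support_iff.2 hp)
  obtain ⟨q, hq, r, hr, rfl⟩ := Finset.mem_add.1 h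
  have h1 := hg r (Finsupp.mem_support_iff.1 hr)
  have h2 := hf q (Finsupp.mem_support_iff.1 hq)
  rw [deg_add]; omega

lemma single_mem_mP_pow (n : ℕ) (p : P) (h : n ≤ deg p) :
    (AddMonoidAlgebra.single p 1 : KP K) ∈ mP K ^ n := by
  induction n generalizing p with
  | zero => simp
  | succ n ih =>
    obtain ⟨q, r, rfl, hq, hr⟩ : ∃ q r : P, p = q + r ∧ n ≤ deg q ∧ deg r = 1 := by
      by_cases h0 : p.2 0 = 0
      · refine ⟨(p.1, p.2 - Pi.single 1 1), (0, Pi.single 1 1), ?_, ?_, ?_⟩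
        · refine Prod.ext (by simp) ?_
          funext i
          simp only [deg] at h
          fin_cases i <;> simp; omega
        · simp only [deg] at h ⊢
          simp; omega
        · simp [deg]
      · refine ⟨(p.1, p.2 - Pi.single 0 1), (0, Pi.single 0 1), ?_, ?_, ?_⟩
        · refine Prod.ext (by simp) ?_
          funext i
          fin_cases i <;> simp; omega
        · simp only [deg] at h ⊢
          simp; omega
        · simp [deg]
    have : (AddMonoidAlgebra.single (q + r) 1 : KP K) =
        AddMonoidAlgebra.single q 1 * AddMonoidAlgebra.single r 1 := by
      rw [AddMonoidAlgebra.single_mul_single, one_mul]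
    rw [this, pow_succ]
    refine Ideal.mul_mem_mul (ih q hq) (Ideal.subset_span ⟨r, ?_, rfl⟩)
    rw [isAddUnit_iff_deg]; omega

lemma eq_sum_single (g : KP K) :
    g = ∑ p ∈ g.coeff.support, g.coeff p • AddMonoidAlgebra.single p 1 := by
  ext q
  simp only [AddMonoidAlgebra.coeff_sum, AddMonoidAlgebra.coeff_smul,
    AddMonoidAlgebra.coeff_single, Finsupp.finsetSum_apply, Finsupp.smul_apply, smul_eq_mul]
  rw [Finset.sum_eq_single q]
  · simp
  · intro b _ hb; simp [hb]
  · intro h; simp [Finsupp.notMem_support_iff.1 h]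

lemma smul_mem_ideal (I : Ideal (KP K)) (c : K) {g : KP K} (hg : g ∈ I) : c • g ∈ I := by
  rw [Algebra.smul_def]; exact I.mul_mem_left _ hg

/-- Both sides are monomial ideals, and a monomial of degree n is a product of n non-invertible
ones. Consequently the coefficients in degree below n make sense on the quotient, which turns
congruences into statements about coefficients. -/
lemma mP_pow_eq (n : ℕ) : mP K ^ n = degIdeal K n := by
  apply le_antisymm
  · induction n with
    | zero => intro g _ p _; omega
    | succ n ih =>
      rw [pow_succ]
      refine le_trans (Ideal.mul_mono ih ?_) (degIdeal_mul_le n 1)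
      refine Ideal.span_le.2 ?_
      rintro _ ⟨p, hp, rfl⟩
      rw [isAddUnit_iff_deg] at hp
      exact single_mem_degIdeal 1 (by omega)
  · intro g hg
    rw [eq_sum_single g]
    refine Ideal.sum_mem _ fun p hp => smul_mem_ideal _ _ (single_mem_mP_pow n p ?_)
    exact hg p (Finsupp.mem_support_iff.1 hp)

/-! ### The truncated rings -/

variable (K) in
/-- The quotient map `K[P] → K[P] / mP ^ n`. -/
noncomputable abbrev toMod (n : ℕ) : KP K →+* KPmod K n := Ideal.Quotient.mk (mP K ^ n)

variable (K) in
/-- The class of the monomial `z^p`. -/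
noncomputable def mono (n : ℕ) (p : P) : KPmod K n := toMod K n (AddMonoidAlgebra.single p 1)

lemma mono_add (n : ℕ) (p q : P) : mono K n (p + q) = mono K n p * mono K n q := by
  rw [mono, mono, mono, ← map_mul, AddMonoidAlgebra.single_mul_single, one_mul]

@[simp] lemma mono_zero (n : ℕ) : mono K n 0 = 1 := by
  rw [mono, ← AddMonoidAlgebra.one_def, map_one]

lemma toMod_surjective (n : ℕ) : Function.Surjective (toMod K n) := Ideal.Quotient.mk_surjective

lemma toMod_smul (n : ℕ) (c : K) (g : KP K) : toMod K n (c • g) = c • toMod K n g := rfl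

lemma toMod_eq_sum (n : ℕ) (g : KP K) :
    toMod K n g = ∑ p ∈ g.coeff.support, g.coeff p • mono K n p := by
  conv_lhs => rw [eq_sum_single g]
  rw [map_sum]
  rfl

/-- The coefficient at `q` of an element of `K[P] / mP ^ n`; meaningful if `deg q < n`. -/
noncomputable def coeffMod {n : ℕ} (q : P) (a : KPmod K n) : K :=
  ((toMod_surjective n a).choose).coeff q

/-- The lift chosen in `coeffMod` is immaterial: two lifts differ by an element without terms of
degree below n. -/
lemma coeffMod_toMod {n : ℕ} {q : P} (hq : deg q < n) (g : KP K) :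
    coeffMod q (toMod K n g) = g.coeff q := by
  have h := (toMod_surjective n (toMod K n g)).choose_spec
  set g' := (toMod_surjective n (toMod K n g)).choose with hg'
  have h2 : g' - g ∈ mP K ^ n := Ideal.Quotient.eq.1 h
  rw [mP_pow_eq] at h2
  have h3 : (g' - g).coeff q = 0 := by
    by_contra h4
    have := h2 q h4
    omega
  have h5 : g'.coeff q - g.coeff q = 0 := h3
  exact sub_eq_zero.1 h5

lemma coeffMod_add {n : ℕ} {q : P} (hq : deg q < n) (a b : KPmod K n) :
    coeffMod q (a + b) = coeffMod q a + coeffMod q b := by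
  obtain ⟨g, rfl⟩ := toMod_surjective n a
  obtain ⟨g', rfl⟩ := toMod_surjective n b
  rw [← map_add, coeffMod_toMod hq, coeffMod_toMod hq, coeffMod_toMod hq]
  rfl

lemma coeffMod_smul {n : ℕ} {q : P} (hq : deg q < n) (c : K) (a : KPmod K n) :
    coeffMod q (c • a) = c * coeffMod q a := by
  obtain ⟨g, rfl⟩ := toMod_surjective n a
  rw [← toMod_smul, coeffMod_toMod hq, coeffMod_toMod hq]
  rfl

lemma coeffMod_mono {n : ℕ} {q : P} (hq : deg q < n) (p : P) :
    coeffMod q (mono K n p) = if p = q then 1 else 0 := by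
  classical
  rw [mono, coeffMod_toMod hq, AddMonoidAlgebra.coeff_single, Finsupp.single_apply]

variable (K) in
/-- The coefficient map as a linear map. -/
noncomputable def coeffLin {n : ℕ} (q : P) (hq : deg q < n) : KPmod K n →ₗ[K] K where
  toFun := coeffMod q
  map_add' := coeffMod_add hq
  map_smul' c a := coeffMod_smul hq c a

variable (K) in
/-- The filtration of `K[P] / mP ^ n` by the powers of the ideal. -/
noncomputable def filt (n k : ℕ) : Ideal (KPmod K n) := (Ideal.map (toMod K n) (mP K)) ^ k

lemma filt_eq (n k : ℕ) : filt K n k = Ideal.map (toMod K n) (mP K ^ k) := by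
  rw [filt, Ideal.map_pow]

@[simp] lemma filt_self (n : ℕ) : filt K n n = ⊥ := by
  rw [filt_eq, Ideal.map_quotient_self]

@[simp] lemma filt_zero (n : ℕ) : filt K n 0 = ⊤ := by simp [filt]

lemma filt_mono (n : ℕ) {j k : ℕ} (h : j ≤ k) : filt K n k ≤ filt K n j := Ideal.pow_le_pow_right h

lemma filt_mul {n j k : ℕ} {a b : KPmod K n} (ha : a ∈ filt K n j) (hb : b ∈ filt K n k) :
    a * b ∈ filt K n (j + k) := by
  rw [filt_eq] at ha hb ⊢
  rw [pow_add, Ideal.map_mul]; exact Ideal.mul_mem_mul ha hb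

lemma mono_mem_filt (n : ℕ) {k : ℕ} {p : P} (h : k ≤ deg p) : mono K n p ∈ filt K n k := by
  rw [filt_eq]; exact Ideal.mem_map_of_mem _ (single_mem_mP_pow k p h)

lemma mono_eq_zero {n : ℕ} {p : P} (h : n ≤ deg p) : mono K n p = 0 := by
  have := mono_mem_filt (K := K) n h
  rwa [filt_self, Ideal.mem_bot] at this

lemma mem_filt_iff {n k : ℕ} (hk : k ≤ n) (a : KPmod K n) :
    a ∈ filt K n k ↔ ∀ q, deg q < k → coeffMod q a = 0 := by
  obtain ⟨g, rfl⟩ := toMod_surjective n a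
  rw [filt_eq, Ideal.mem_quotient_iff_mem (Ideal.pow_le_pow_right hk), mP_pow_eq, mem_degIdeal]
  constructor
  · intro h q hq
    rw [coeffMod_toMod (by omega)]
    by_contra h2
    have := h q h2
    omega
  · intro h p hp
    by_contra h2
    exact hp (by rw [← coeffMod_toMod (n := n) (by omega)]; exact h p (by omega))

/-- This is how the uniqueness induction climbs one step: only the coefficients of degree exactly k
remain to be killed. -/
lemma mem_filt_succ {n k : ℕ} (hk : k < n) {a : KPmod K n} (ha : a ∈ filt K n k)
    (h : ∀ q, deg q = k → coeffMod q a = 0) : a ∈ filt K n (k + 1) := by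
  rw [mem_filt_iff hk]
  intro q hq
  rcases Nat.lt_succ_iff_lt_or_eq.1 hq with h1 | h1
  · exact (mem_filt_iff hk.le a).1 ha q h1
  · exact h q h1

/-! ### Reduction of elements of the completion -/

@[simp] lemma trunc_algebraMap (n : ℕ) (g : KP K) :
    trunc n (algebraMap (KP K) (KPhat K) g) = toMod K n g :=
  AdicCompletion.evalₐ_of (mP K) n g

lemma trunc_of_le {m n : ℕ} (h : m ≤ n) (f : KPhat K) :
    trunc m f = Ideal.Quotient.factor (Ideal.pow_le_pow_right h) (trunc n f) := by
  obtain ⟨c, rfl⟩ := AdicCompletion.mk_surjective (mP K) (KP K) f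
  rw [trunc, trunc, AdicCompletion.evalₐ_mk, AdicCompletion.evalₐ_mk, Ideal.Quotient.factor_mk]
  exact (AdicCompletion.Ideal.mk_eq_mk (mP K) h c).symm

lemma trunc_sub_one_mem {f : KPhat K} (hf : trunc 1 f = 1) (n : ℕ) :
    trunc n f - 1 ∈ filt K n 1 := by
  -- Reduction from order n to order 1 needs n ≥ 1; at n = 0 the quotient is the zero ring.
  rcases Nat.eq_zero_or_pos n with rfl | hn
  · have : Subsingleton (KPmod K 0) := by
      rw [KPmod, pow_zero, Ideal.one_eq_top]; exact Ideal.Quotient.subsingleton_iff.2 rfl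
    rw [Subsingleton.elim (trunc 0 f - 1) 0]; exact zero_mem _
  · rw [trunc_of_le hn f] at hf
    obtain ⟨g, hg⟩ := toMod_surjective n (trunc n f)
    rw [← hg] at hf ⊢
    rw [Ideal.Quotient.factor_mk, ← map_one (Ideal.Quotient.mk _), Ideal.Quotient.eq] at hf
    rw [← map_one (toMod K n), ← map_sub, filt_eq]
    exact Ideal.mem_map_of_mem _ hf

lemma isUnit_of_sub_one_mem {n : ℕ} {a : KPmod K n} (h : a - 1 ∈ filt K n 1) : IsUnit a := by
  have h2 : IsNilpotent (a - 1) := by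
    refine ⟨n, ?_⟩
    have : (a - 1) ^ n ∈ filt K n n := by
      rw [filt_eq, pow_one] at h
      exact Ideal.pow_mem_pow h n
    rwa [filt_self, Ideal.mem_bot] at this
  simpa using h2.isUnit_add_one

lemma val_truncUnit {f : KPhat K} (hf : trunc 1 f = 1) (n : ℕ) :
    (truncUnit n f : KPmod K n) = trunc n f := by
  have h := isUnit_of_sub_one_mem (trunc_sub_one_mem hf n)
  rw [truncUnit, dif_pos h, IsUnit.unit_spec]

/-! ### Supports in the truncated rings -/

variable (K) in
/-- The span of the monomials with exponent in `S`. -/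
noncomputable def suppSub (n : ℕ) (S : Set P) : Submodule K (KPmod K n) :=
  Submodule.span K (mono K n '' S)

lemma trunc_mem_suppSub {f : KPhat K} {S : Set P} (h : SupportedOn f S) (n : ℕ) :
    trunc n f ∈ suppSub K n S := by
  obtain ⟨g, hg, h2⟩ := h n
  rw [h2]
  rw [show Ideal.Quotient.mk (mP K ^ n) g = toMod K n g from rfl, toMod_eq_sum]
  exact Submodule.sum_mem _ fun p hp =>
    Submodule.smul_mem _ _ (Submodule.subset_span ⟨p, hg p hp, rfl⟩)

lemma suppSub_mono (n : ℕ) {S T : Set P} (h : S ⊆ T) : suppSub K n S ≤ suppSub K n T :=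
  Submodule.span_mono (Set.image_mono h)

lemma one_mem_suppSub (n : ℕ) {S : Set P} (h : 0 ∈ S) : (1 : KPmod K n) ∈ suppSub K n S :=
  Submodule.subset_span ⟨0, h, mono_zero n⟩

lemma mul_mem_suppSub {n : ℕ} {S : Set P} (hS : ∀ p ∈ S, ∀ q ∈ S, p + q ∈ S) {a b : KPmod K n}
    (ha : a ∈ suppSub K n S) (hb : b ∈ suppSub K n S) : a * b ∈ suppSub K n S := by
  have h : a * b ∈ suppSub K n S * suppSub K n S := Submodule.mul_mem_mul ha hb
  rw [suppSub, Submodule.span_mul_span] at h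
  refine Submodule.span_mono ?_ h
  rintro _ ⟨_, ⟨p, hp, rfl⟩, _, ⟨q, hq, rfl⟩, rfl⟩
  exact ⟨p + q, hS p hp q hq, mono_add n p q⟩

lemma prod_mem_suppSub {n : ℕ} {S : Set P} (h0 : 0 ∈ S) (hS : ∀ p ∈ S, ∀ q ∈ S, p + q ∈ S)
    {ι : Type*} (s : Finset ι) (a : ι → KPmod K n) (ha : ∀ i ∈ s, a i ∈ suppSub K n S) :
    ∏ i ∈ s, a i ∈ suppSub K n S :=
  Finset.prod_induction a (· ∈ suppSub K n S) (fun _ _ => mul_mem_suppSub hS)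
    (one_mem_suppSub n h0) ha

lemma coeffMod_eq_zero_of_mem_suppSub {n : ℕ} {S : Set P} {a : KPmod K n}
    (ha : a ∈ suppSub K n S) {q : P} (hq : deg q < n) (hqS : q ∉ S) : coeffMod q a = 0 := by
  have : suppSub K n S ≤ LinearMap.ker (coeffLin K q hq) := by
    refine Submodule.span_le.2 ?_
    rintro _ ⟨p, hp, rfl⟩
    change coeffMod q (mono K n p) = 0
    rw [coeffMod_mono hq, if_neg]
    rintro rfl
    exact hqS hp
  exact this ha

/-! ### Wall crossing by a general unit -/

/-- The endomorphism `z^p ↦ u ^ ⟨ν, p̄⟩ z^p` of `K[P] / mP ^ n`. -/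
noncomputable def cross (n : ℕ) (u : (KPmod K n)ˣ) (ν : M) : KPmod K n →ₐ[K] KPmod K n :=
  Ideal.Quotient.liftₐ ((mP K) ^ n)
    (AddMonoidAlgebra.lift K (KPmod K n) P (crossingMonoidHom n u ν)) (crossing_kills n u ν)

lemma wallCrossing_eq_cross (n : ℕ) (f : KPhat K) (ν : M) :
    wallCrossing n f ν = cross n (truncUnit n f) ν := rfl

lemma cross_mono (n : ℕ) (u : (KPmod K n)ˣ) (ν : M) (p : P) :
    cross n u ν (mono K n p) = ((u ^ (ν ⬝ᵥ p.1) : (KPmod K n)ˣ) : KPmod K n) * mono K n p := by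
  have : cross n u ν (mono K n p) = AddMonoidAlgebra.lift K (KPmod K n) P (crossingMonoidHom n u ν)
    (AddMonoidAlgebra.single p 1) := rfl
  rw [this, AddMonoidAlgebra.lift_single, one_smul]
  rfl

lemma algHom_ext_mono {n : ℕ} {φ ψ : KPmod K n →ₐ[K] KPmod K n}
    (h : ∀ p, φ (mono K n p) = ψ (mono K n p)) : φ = ψ := by
  ext a
  obtain ⟨g, rfl⟩ := toMod_surjective n a
  rw [toMod_eq_sum]
  simp only [map_sum, map_smul, h]

lemma cross_one (n : ℕ) (ν : M) : cross n (1 : (KPmod K n)ˣ) ν = AlgHom.id K (KPmod K n) :=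
  algHom_ext_mono fun p => by simp [cross_mono]

/-- Monomials tangent to the wall are multiplied by a zeroth power. Wall functions are themselves of
this kind, which is why crossings in a common plane compose by multiplying their functions. -/
lemma cross_apply_of_mem {n : ℕ} (u : (KPmod K n)ˣ) {ν : M} {a : KPmod K n}
    (ha : a ∈ suppSub K n {p | ν ⬝ᵥ p.1 = 0}) : cross n u ν a = a := by
  have : suppSub K n {p | ν ⬝ᵥ p.1 = 0} ≤
      LinearMap.ker ((cross n u ν).toLinearMap - LinearMap.id) := by
    refine Submodule.span_le.2 ?_
    rintro _ ⟨p, hp, rfl⟩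
    change cross n u ν (mono K n p) - mono K n p = 0
    rw [cross_mono, show ν ⬝ᵥ p.1 = 0 from hp]
    simp
  exact sub_eq_zero.1 (this ha)

lemma map_unit_zpow {n : ℕ} (φ : KPmod K n →ₐ[K] KPmod K n) (v : (KPmod K n)ˣ) (k : ℤ) :
    φ ((v ^ k : (KPmod K n)ˣ) : KPmod K n) =
      ((Units.map (φ : KPmod K n →* KPmod K n) v ^ k : (KPmod K n)ˣ) : KPmod K n) := by
  rw [← map_zpow]; rfl

/-- Two covectors are allowed so that a single computation covers both composition on the same side
(μ = ν) and inversion (μ = -ν). -/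
lemma cross_comp_cross {n : ℕ} (u v : (KPmod K n)ˣ) {ν : M}
    (hv : (v : KPmod K n) ∈ suppSub K n {p | ν ⬝ᵥ p.1 = 0}) (w : (KPmod K n)ˣ) {μ : M}
    (h : ∀ m, v ^ (μ ⬝ᵥ m) * u ^ (ν ⬝ᵥ m) = w ^ (ν ⬝ᵥ m)) :
    (cross n u ν).comp (cross n v μ) = cross n w ν := by
  refine algHom_ext_mono fun p => ?_
  have h1 : Units.map (cross n u ν : KPmod K n →* KPmod K n) v = v :=
    Units.ext (cross_apply_of_mem u hv)
  rw [AlgHom.comp_apply, cross_mono, map_mul, cross_mono, map_unit_zpow, h1, cross_mono, ← h,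
    Units.val_mul, mul_assoc]

lemma cross_comp_cross_same {n : ℕ} (u v : (KPmod K n)ˣ) {ν : M}
    (hv : (v : KPmod K n) ∈ suppSub K n {p | ν ⬝ᵥ p.1 = 0}) :
    (cross n u ν).comp (cross n v ν) = cross n (v * u) ν :=
  cross_comp_cross u v hv (v * u) fun _ => (mul_zpow v u _).symm

lemma cross_comp_cross_neg {n : ℕ} (u : (KPmod K n)ˣ) {ν : M}
    (hu : (u : KPmod K n) ∈ suppSub K n {p | ν ⬝ᵥ p.1 = 0}) :
    (cross n u ν).comp (cross n u (-ν)) = AlgHom.id K (KPmod K n) := by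
  rw [cross_comp_cross u u hu 1, cross_one]
  intro m
  rw [neg_dotProduct, ← zpow_add]; simp

lemma suppSub_neg (n : ℕ) (ν : M) :
    suppSub K n {p | (-ν) ⬝ᵥ p.1 = 0} = suppSub K n {p | ν ⬝ᵥ p.1 = 0} := by
  simp [neg_dotProduct]

lemma cross_neg_comp_cross {n : ℕ} (u : (KPmod K n)ˣ) {ν : M}
    (hu : (u : KPmod K n) ∈ suppSub K n {p | ν ⬝ᵥ p.1 = 0}) :
    (cross n u (-ν)).comp (cross n u ν) = AlgHom.id K (KPmod K n) := by
  simpa using cross_comp_cross_neg u (ν := -ν) (by rwa [suppSub_neg])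

lemma cross_bijective {n : ℕ} (u : (KPmod K n)ˣ) {ν : M}
    (hu : (u : KPmod K n) ∈ suppSub K n {p | ν ⬝ᵥ p.1 = 0}) : Function.Bijective (cross n u ν) := by
  refine Function.bijective_iff_has_inverse.2 ⟨cross n u (-ν), fun a => ?_, fun a => ?_⟩
  · exact DFunLike.congr_fun (cross_neg_comp_cross u hu) a
  · exact DFunLike.congr_fun (cross_comp_cross_neg u hu) a

/-! ### Integral and real covectors -/

lemma toReal_dot (μ m : M) : toReal μ ⬝ᵥ toReal m = ((μ ⬝ᵥ m : ℤ) : ℝ) := by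
  simp [toReal, dotProduct]

@[simp] lemma toReal_zero : toReal 0 = 0 := by ext; simp [toReal]

@[simp] lemma toReal_neg (m : M) : toReal (-m) = -toReal m := by ext; simp [toReal]

@[simp] lemma toReal_zsmul (c : ℤ) (m : M) : toReal (c • m) = (c : ℝ) • toReal m := by
  ext; simp [toReal]

lemma toReal_injective : Function.Injective toReal := fun a b h => by
  ext i; exact Int.cast_injective (congrFun h i)

lemma toReal_ne_zero {m : M} (h : m ≠ 0) : toReal m ≠ 0 := fun h2 =>
  h (toReal_injective (by simpa using h2))

/-- Here g is the gcd of the entries, obtained as a positive generator of the ideal they span, and a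
comes from a Bézout relation. The condition ν ⬝ᵥ a = 1 serves throughout as the form of primitivity.
-/
lemma exists_primitive {m : M} (hm : m ≠ 0) :
    ∃ (ν a : M) (g : ℤ), 0 < g ∧ m = g • ν ∧ ν ⬝ᵥ a = 1 := by
  let I : Ideal ℤ := Ideal.span (Set.range m)
  obtain ⟨g, hg⟩ : ∃ g, I = Ideal.span {g} := (IsPrincipalIdealRing.principal I).principal
  obtain ⟨g, hg0, hg⟩ : ∃ g, 0 ≤ g ∧ I = Ideal.span {g} := by
    rcases le_total 0 g with h | h
    · exact ⟨g, h, hg⟩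
    · exact ⟨-g, by omega, by rw [hg, Ideal.span_singleton_neg]⟩
  have h1 : ∀ i, ∃ c, m i = g * c := fun i => by
    have : m i ∈ I := Ideal.subset_span ⟨i, rfl⟩
    rw [hg, Ideal.mem_span_singleton] at this
    exact this
  choose ν hν using h1
  have hgne : g ≠ 0 := by
    rintro rfl
    exact hm (by ext i; simp [hν i])
  have h2 : g ∈ I := by rw [hg]; exact Ideal.mem_span_singleton_self g
  obtain ⟨a, ha⟩ := Ideal.mem_span_range_iff_exists_fun.1 h2
  refine ⟨ν, a, g, by omega, by ext i; simp [hν i], ?_⟩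
  have h3 : g * (ν ⬝ᵥ a) = g * 1 := by
    rw [mul_one]
    conv_rhs => rw [← ha]
    simp only [dotProduct, Finset.mul_sum]
    exact Finset.sum_congr rfl fun i _ => by rw [hν i]; ring
  exact mul_left_cancel₀ hgne h3

lemma exists_smul_of_cross_eq_zero {h c : MR} (hc : c ≠ 0) (hh : h ⨯₃ c = 0) :
    ∃ r : ℝ, h = r • c := by
  obtain ⟨i, hi⟩ : ∃ i, c i ≠ 0 := by
    by_contra h2
    push Not at h2
    exact hc (funext h2)
  rw [cross_apply] at hh
  have h0 : h 1 * c 2 - h 2 * c 1 = 0 := by simpa using congrFun hh 0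
  have h1 : h 2 * c 0 - h 0 * c 2 = 0 := by simpa using congrFun hh 1
  have h2 : h 0 * c 1 - h 1 * c 0 = 0 := by simpa using congrFun hh 2
  -- Any index at which c is nonzero determines the ratio; the vanishing cross product says that the
  -- remaining entries have the same ratio.
  refine ⟨h i / c i, ?_⟩
  ext j
  simp only [Pi.smul_apply, smul_eq_mul]
  field_simp
  fin_cases i <;> fin_cases j <;> simp <;> linarith

lemma exists_smul_cross {w u h : MR} (hwu : w ⨯₃ u ≠ 0) (h1 : h ⬝ᵥ w = 0) (h2 : h ⬝ᵥ u = 0) :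
    ∃ r : ℝ, h = r • (w ⨯₃ u) := by
  refine exists_smul_of_cross_eq_zero hwu ?_
  rw [cross_cross_eq_smul_sub_smul', h2, dotProduct_comm w h, h1]
  simp

/-! ### Rational polyhedra -/

/-- The affine function `x ↦ ⟨h, x⟩ - c` of a pair `(h, c)`. -/
def ev (h : M × ℤ) (x : MR) : ℝ := toReal h.1 ⬝ᵥ x - h.2

lemma ev_add (h : M × ℤ) (x u : MR) : ev h (x + u) = ev h x + toReal h.1 ⬝ᵥ u := by
  simp [ev, dotProduct_add]; ring

lemma ev_sub_ev (h : M × ℤ) (x y : MR) : ev h x - ev h y = toReal h.1 ⬝ᵥ (x - y) := by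
  simp [ev, dotProduct_sub]

lemma continuous_dot (m : MR) : Continuous fun x : MR => m ⬝ᵥ x := by
  simp only [dotProduct]; fun_prop

lemma continuous_ev (h : M × ℤ) : Continuous (ev h) := (continuous_dot _).sub continuous_const

/-- The polyhedron of a finite set of affine functions. -/
def poly (H : Finset (M × ℤ)) : Set MR := {x | ∀ h ∈ H, 0 ≤ ev h x}

lemma isRationalPolyhedron_iff (s : Set MR) : IsRationalPolyhedron s ↔ ∃ H, s = poly H := by
  simp [IsRationalPolyhedron, poly, ev]

lemma isClosed_poly (H : Finset (M × ℤ)) : IsClosed (poly H) := by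
  have : poly H = ⋂ h ∈ H, {x | 0 ≤ ev h x} := by ext; simp [poly]
  rw [this]
  exact isClosed_biInter fun h _ => isClosed_le continuous_const (continuous_ev h)

lemma eventually_sign (A : Finset (M × ℤ)) (x : MR) :
    ∀ᶠ y in 𝓝 x, ∀ h ∈ A, (0 < ev h x → 0 < ev h y) ∧ (ev h x < 0 → ev h y < 0) := by
  rw [Filter.eventually_all_finset]
  intro h _
  rcases lt_trichotomy (ev h x) 0 with h1 | h1 | h1
  · filter_upwards [(continuous_ev h).continuousAt.eventually_lt continuousAt_const h1] with y hy
    exact ⟨fun h2 => by linarith, fun _ => hy⟩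
  · simp [h1]
  · filter_upwards [continuousAt_const.eventually_lt (continuous_ev h).continuousAt h1] with y hy
    exact ⟨fun _ => hy, fun h2 => by linarith⟩

/-- Near `x`, a polyhedron agrees with its tangent cone at `x`. -/
lemma eventually_mem_poly_iff {A : Finset (M × ℤ)} {H : Finset (M × ℤ)} (hH : H ⊆ A) {x y : MR}
    (hy : ∀ h ∈ A, (0 < ev h x → 0 < ev h y) ∧ (ev h x < 0 → ev h y < 0)) :
    y ∈ poly H ↔ x ∈ poly H ∧ ∀ h ∈ H, ev h x = 0 → 0 ≤ toReal h.1 ⬝ᵥ (y - x) := by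
  constructor
  · intro h
    refine ⟨fun k hk => ?_, fun k hk hk0 => ?_⟩
    · by_contra h2
      have := (hy k (hH hk)).2 (by linarith)
      have := h k hk
      linarith
    · rw [← ev_sub_ev, hk0, sub_zero]; exact h k hk
  · rintro ⟨h1, h2⟩ k hk
    rcases (h1 k hk).lt_or_eq with h3 | h3
    · exact ((hy k (hH hk)).1 h3).le
    · have := h2 k hk h3.symm
      rw [← ev_sub_ev] at this; linarith

lemma ev_midpoint {x y : MR} (h : M × ℤ) :
    ev h ((1 / 2 : ℝ) • (x + y)) = (ev h x + ev h y) / 2 := by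
  simp [ev, dotProduct_add]; ring

/-- Averaging works: a midpoint of two points of the polyhedron satisfies strictly every inequality
that is strict at one of them. Constant functions have to be left out, as they may vanish
identically. -/
lemma exists_strict {H : Finset (M × ℤ)} (hne : (poly H).Nonempty)
    (h : ∀ k ∈ H, k.1 ≠ 0 → ∃ x ∈ poly H, ev k x ≠ 0) (H' : Finset (M × ℤ)) (hH' : H' ⊆ H) :
    ∃ x ∈ poly H, ∀ k ∈ H', k.1 ≠ 0 → 0 < ev k x := by
  classical
  induction H' using Finset.induction_on with
  | empty => obtain ⟨x, hx⟩ := hne; exact ⟨x, hx, by simp⟩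
  | insert k H' _ ih =>
    obtain ⟨x, hx, hx2⟩ := ih fun a ha => hH' (Finset.mem_insert_of_mem ha)
    by_cases hk : k.1 = 0
    · refine ⟨x, hx, fun a ha ha0 => ?_⟩
      rcases Finset.mem_insert.1 ha with rfl | ha
      · exact absurd hk ha0
      · exact hx2 a ha ha0
    · have hkH := hH' (Finset.mem_insert_self k H')
      obtain ⟨y, hy, hy2⟩ := h k hkH hk
      refine ⟨(1 / 2 : ℝ) • (x + y), fun a ha => ?_, fun a ha ha0 => ?_⟩
      · rw [ev_midpoint]
        have := hx a ha; have := hy a ha; positivity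
      · rw [ev_midpoint]
        rcases Finset.mem_insert.1 ha with rfl | ha
        · have := hx a hkH
          have := lt_of_le_of_ne (hy a hkH) hy2.symm
          linarith
        · have := hx2 a ha ha0
          have := hy a (hH' (Finset.mem_insert_of_mem ha)); linarith

/-! ### The planes spanned by walls and their primitive normals -/

lemma finrank_ker_dot {m : MR} (hm : m ≠ 0) :
    Module.finrank ℝ (LinearMap.ker (dotProductBilin ℝ ℝ m)) = 2 := by
  have hne : (dotProductBilin ℝ ℝ m : Module.Dual ℝ MR) ≠ 0 := by
    intro h
    have : m ⬝ᵥ m = 0 := DFunLike.congr_fun h m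
    exact hm (dotProduct_self_eq_zero.1 this)
  have := Module.Dual.finrank_ker_add_one_of_ne_zero hne
  have h3 : Module.finrank ℝ MR = 3 := by simp
  rw [h3] at this
  omega

lemma mem_ker_dot {m u : MR} : u ∈ LinearMap.ker (dotProductBilin ℝ ℝ m) ↔ m ⬝ᵥ u = 0 := Iff.rfl

lemma nonempty_of_dim_pos {s : Set MR} (h : 0 < dim s) : s.Nonempty := by
  by_contra h2
  rw [Set.not_nonempty_iff_eq_empty] at h2
  subst h2
  rw [dim, AffineSubspace.span_empty, AffineSubspace.direction_bot, finrank_bot] at h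
  exact lt_irrefl 0 h

lemma direction_le_ker {s : Set MR} {m : MR} (h : ∀ x ∈ s, ∀ y ∈ s, m ⬝ᵥ x = m ⬝ᵥ y) :
    (affineSpan ℝ s).direction ≤ LinearMap.ker (dotProductBilin ℝ ℝ m) := by
  rw [direction_affineSpan, vectorSpan_def, Submodule.span_le]
  rintro _ ⟨x, hx, y, hy, rfl⟩
  rw [SetLike.mem_coe, mem_ker_dot]
  change m ⬝ᵥ (x - y) = 0
  rw [dotProduct_sub, h x hx y hy, sub_self]

/-- A two-dimensional rational polyhedron has an implicit equality. -/
lemma exists_implicit_eq {H : Finset (M × ℤ)} (hdim : dim (poly H) = 2) :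
    ∃ k ∈ H, k.1 ≠ 0 ∧ ∀ x ∈ poly H, ev k x = 0 := by
  by_contra hcon
  push Not at hcon
  -- If no inequality were an equality throughout, some point would satisfy all nonconstant ones
  -- strictly. It would then be an interior point, forcing dimension three.
  obtain ⟨x, hx, hx2⟩ := exists_strict (nonempty_of_dim_pos (by omega)) hcon H le_rfl
  have h1 : poly H ∈ 𝓝 x := by
    filter_upwards [eventually_sign H x] with y hy k hk
    by_cases hk0 : k.1 = 0
    · have := hx k hk
      simpa [ev, hk0] using this
    · exact ((hy k hk).1 (hx2 k hk hk0)).le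
  have h2 : affineSpan ℝ (poly H) = ⊤ :=
    top_le_iff.1 ((IsOpen.affineSpan_eq_top isOpen_interior
      ⟨x, mem_interior_iff_mem_nhds.2 h1⟩).symm.le.trans (affineSpan_mono ℝ interior_subset))
  rw [dim, h2, AffineSubspace.direction_top, finrank_top] at hdim
  simp at hdim

lemma direction_eq_ker {H : Finset (M × ℤ)} (hdim : dim (poly H) = 2) {k : M × ℤ}
    (hk0 : k.1 ≠ 0) (hk : ∀ x ∈ poly H, ev k x = 0) :
    (affineSpan ℝ (poly H)).direction = LinearMap.ker (dotProductBilin ℝ ℝ (toReal k.1)) := by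
  refine Submodule.eq_of_le_of_finrank_eq (direction_le_ker fun x hx y hy => ?_) ?_
  · have h1 := hk x hx
    have h2 := hk y hy
    simp only [ev] at h1 h2
    linarith
  · rw [finrank_ker_dot (toReal_ne_zero hk0)]; exact hdim

/-- The integral vectors ν ⨯₃ c are enough tangent lattice vectors to recover the normal up to a
factor. -/
lemma tangent_cross {s : Set MR} {ν : M}
    (h : ∀ u, u ∈ (affineSpan ℝ s).direction ↔ toReal ν ⬝ᵥ u = 0) (c : M) :
    ν ⨯₃ c ∈ tangentLattice s := by
  rw [tangentLattice, Set.mem_ofPred_eq, h, toReal_dot, dot_self_cross, Int.cast_zero]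

/-- A covector μ that kills every ν ⨯₃ c satisfies μ ⨯₃ ν = 0. Expanding the triple product with a,
for which ν ⬝ᵥ a = 1, gives μ = (μ ⬝ᵥ a) ν, an integral multiple. -/
lemma isNormal_of_direction {s : Set MR} {ν a : M} (ha : ν ⬝ᵥ a = 1)
    (h : ∀ u, u ∈ (affineSpan ℝ s).direction ↔ toReal ν ⬝ᵥ u = 0) : IsNormal s ν := by
  intro μ
  constructor
  · intro hμ
    refine ⟨μ ⬝ᵥ a, ?_⟩
    have h1 : μ ⨯₃ ν = 0 := by
      have : ∀ c : M, (μ ⨯₃ ν) ⬝ᵥ c = 0 := fun c => by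
        have := hμ _ (tangent_cross h c)
        rw [dotProduct_comm, triple_product_permutation, ]
        exact this
      exact dotProduct_eq_zero _ this
    have h2 := cross_cross_eq_smul_sub_smul' a μ ν
    rw [h1, map_zero, dotProduct_comm a ν, ha, one_smul] at h2
    exact sub_eq_zero.1 h2.symm
  · rintro ⟨c, rfl⟩ m hm
    have : toReal ν ⬝ᵥ toReal m = 0 := (h _).1 hm
    rw [toReal_dot] at this
    have h2 : ν ⬝ᵥ m = 0 := by exact_mod_cast this
    rw [smul_dotProduct, h2, smul_zero]

/-- A wall has a primitive normal covector. -/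
lemma IsWall.exists_normal {d : Wall K} (hd : IsWall d) :
    ∃ ν : M, IsNormal d.carrier ν ∧ (∃ a, ν ⬝ᵥ a = 1) ∧
      ∀ u, u ∈ (affineSpan ℝ d.carrier).direction ↔ toReal ν ⬝ᵥ u = 0 := by
  obtain ⟨H, hH⟩ := (isRationalPolyhedron_iff _).1 hd.polyhedron
  have hdim := hd.codim_one
  rw [hH] at hdim ⊢
  obtain ⟨k, -, hk0, hk⟩ := exists_implicit_eq hdim
  obtain ⟨ν, a, g, hg, hkg, ha⟩ := exists_primitive hk0
  have key : ∀ u, u ∈ (affineSpan ℝ (poly H)).direction ↔ toReal ν ⬝ᵥ u = 0 := fun u => by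
    rw [direction_eq_ker hdim hk0 hk, mem_ker_dot, hkg, toReal_zsmul, smul_dotProduct, smul_eq_mul,
      mul_eq_zero, Int.cast_eq_zero, or_iff_right hg.ne']
  exact ⟨ν, isNormal_of_direction ha key, ⟨a, ha⟩, key⟩

/-- Each of two generators is an integral multiple of the other, so the factor is a unit of ℤ. -/
lemma IsNormal.eq_or_neg {s : Set MR} {ν μ a : M} (ha : ν ⬝ᵥ a = 1) (hν : IsNormal s ν)
    (hμ : IsNormal s μ) : μ = ν ∨ μ = -ν := by
  have h1 : ∀ m ∈ tangentLattice s, μ ⬝ᵥ m = 0 := (hμ μ).2 ⟨1, by simp⟩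
  have h2 : ∀ m ∈ tangentLattice s, ν ⬝ᵥ m = 0 := (hν ν).2 ⟨1, by simp⟩
  obtain ⟨c, hc⟩ := (hν μ).1 h1
  obtain ⟨e, he⟩ := (hμ ν).1 h2
  have h3 : e * c = 1 := by
    have := congrArg (fun v : M => v ⬝ᵥ a) he
    simp only [hc, smul_dotProduct, ha, smul_eq_mul, mul_one] at this
    exact this.symm
  rcases Int.isUnit_iff.1 (IsUnit.of_mul_eq_one_right e h3) with h | h
  · left; rw [hc, h, one_smul]
  · right; rw [hc, h, neg_one_smul]

lemma IsNormal.neg {s : Set MR} {ν : M} (h : IsNormal s ν) : IsNormal s (-ν) := by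
  intro μ
  rw [h μ]
  constructor
  · rintro ⟨c, rfl⟩; exact ⟨-c, by simp⟩
  · rintro ⟨c, rfl⟩; exact ⟨-c, by simp⟩

lemma IsWall.normal_spec {d : Wall K} (hd : IsWall d) {ν : M} (hν : IsNormal d.carrier ν) :
    (∃ a, ν ⬝ᵥ a = 1) ∧
      ∀ u, u ∈ (affineSpan ℝ d.carrier).direction ↔ toReal ν ⬝ᵥ u = 0 := by
  obtain ⟨μ, hμ, ⟨a, ha⟩, h⟩ := hd.exists_normal
  rcases hμ.eq_or_neg ha hν with rfl | rfl
  · exact ⟨⟨a, ha⟩, h⟩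
  · exact ⟨⟨-a, by simpa using ha⟩, fun u => by rw [h]; simp⟩

lemma IsWall.normal_ne_zero {d : Wall K} (hd : IsWall d) {ν : M} (hν : IsNormal d.carrier ν) :
    ν ≠ 0 := by
  obtain ⟨⟨a, ha⟩, -⟩ := hd.normal_spec hν
  rintro rfl
  simp at ha

lemma IsWall.dot_eq {d : Wall K} (hd : IsWall d) {ν : M} (hν : IsNormal d.carrier ν) {x y : MR}
    (hx : x ∈ d.carrier) (hy : y ∈ d.carrier) : toReal ν ⬝ᵥ x = toReal ν ⬝ᵥ y := by
  have h : x - y ∈ (affineSpan ℝ d.carrier).direction :=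
    AffineSubspace.vsub_mem_direction (subset_affineSpan ℝ _ hx) (subset_affineSpan ℝ _ hy)
  rw [(hd.normal_spec hν).2, dotProduct_sub] at h
  linarith

lemma IsWall.mem_affineSpan_iff {d : Wall K} (hd : IsWall d) {ν : M} (hν : IsNormal d.carrier ν)
    {x : MR} (hx : x ∈ d.carrier) (y : MR) :
    y ∈ affineSpan ℝ d.carrier ↔ toReal ν ⬝ᵥ y = toReal ν ⬝ᵥ x := by
  rw [← AffineSubspace.vsub_right_mem_direction_iff_mem (subset_affineSpan ℝ _ hx),
    (hd.normal_spec hν).2, vsub_eq_sub, dotProduct_sub, sub_eq_zero]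

lemma IsWall.isClosed {d : Wall K} (hd : IsWall d) : IsClosed d.carrier := by
  obtain ⟨H, hH⟩ := (isRationalPolyhedron_iff _).1 hd.polyhedron
  rw [hH]; exact isClosed_poly H

lemma IsWall.mem_tangentLattice {d : Wall K} (hd : IsWall d) {ν : M} (hν : IsNormal d.carrier ν)
    (m : M) : m ∈ tangentLattice d.carrier ↔ ν ⬝ᵥ m = 0 := by
  rw [tangentLattice, Set.mem_ofPred_eq, (hd.normal_spec hν).2, toReal_dot, Int.cast_eq_zero]

lemma IsWall.trunc_mem {d : Wall K} (hd : IsWall d) {ν : M} (hν : IsNormal d.carrier ν) (n : ℕ) :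
    (truncUnit n d.func : KPmod K n) ∈ suppSub K n {p | ν ⬝ᵥ p.1 = 0} := by
  rw [val_truncUnit hd.func_one]
  refine suppSub_mono n ?_ (trunc_mem_suppSub hd.tangent n)
  intro p hp
  exact (hd.mem_tangentLattice hν p.1).1 hp

/-! ### Points off the singular locus -/

/-- All walls of `D` through `x` have normal `ν`, and near `x` they fill out the plane with this
normal. -/
def LocPlanar (D : Set (Wall K)) (x : MR) (ν : M) : Prop :=
  ∀ d ∈ D, x ∈ d.carrier → IsNormal d.carrier ν ∧
    ∀ᶠ y in 𝓝 x, toReal ν ⬝ᵥ y = toReal ν ⬝ᵥ x → y ∈ d.carrier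

/-- A wall is closed, so its relative frontier is the complement of its relative interior, and the
affine span is the plane of constant ν-value through x. -/
lemma IsWall.notMem_frontier_iff {d : Wall K} (hd : IsWall d) {ν : M}
    (hν : IsNormal d.carrier ν) {x : MR} (hx : x ∈ d.carrier) :
    x ∉ intrinsicFrontier ℝ d.carrier ↔
      ∀ᶠ y in 𝓝 x, toReal ν ⬝ᵥ y = toReal ν ⬝ᵥ x → y ∈ d.carrier := by
  have hxs : x ∈ affineSpan ℝ d.carrier := subset_affineSpan ℝ _ hx
  have h1 : x ∈ intrinsicFrontier ℝ d.carrier ↔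
      (⟨x, hxs⟩ : affineSpan ℝ d.carrier) ∉ interior ((↑) ⁻¹' d.carrier) := by
    rw [mem_intrinsicFrontier]
    have hcl : IsClosed ((↑) ⁻¹' d.carrier : Set (affineSpan ℝ d.carrier)) :=
      hd.isClosed.preimage continuous_subtype_val
    constructor
    · rintro ⟨y, hy, rfl⟩
      exact hy.2
    · intro h
      exact ⟨⟨x, hxs⟩, ⟨subset_closure hx, h⟩, rfl⟩
  rw [h1, not_not, mem_interior_iff_mem_nhds, mem_nhds_subtype]
  constructor
  · rintro ⟨u, hu, hsub⟩
    filter_upwards [hu] with y hy hy2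
    have hys := (hd.mem_affineSpan_iff hν hx y).2 hy2
    exact hsub (show (⟨y, hys⟩ : affineSpan ℝ d.carrier) ∈ _ from hy)
  · intro h
    refine ⟨_, h, ?_⟩
    rintro ⟨y, hys⟩ hy
    exact hy ((hd.mem_affineSpan_iff hν hx y).1 hys)

lemma mem_direction_of_add_mem {s : Set MR} {x u : MR} {δ : ℝ} (hδ : δ ≠ 0) (hx : x ∈ s)
    (hu : x + δ • u ∈ s) : u ∈ (affineSpan ℝ s).direction := by
  have h := AffineSubspace.vsub_mem_direction (subset_affineSpan ℝ _ hu) (subset_affineSpan ℝ _ hx)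
  rw [vsub_eq_sub, add_sub_cancel_left] at h
  have h2 := Submodule.smul_mem _ δ⁻¹ h
  rwa [smul_smul, inv_mul_cancel₀ hδ, one_smul] at h2

lemma exists_pos_of_eventually_add {x u : MR} {p : MR → Prop} (h : ∀ᶠ y in 𝓝 x, p y) :
    ∃ δ : ℝ, 0 < δ ∧ ∀ ε : ℝ, |ε| < δ → p (x + ε • u) := by
  have hc : Tendsto (fun ε : ℝ => x + ε • u) (𝓝 0) (𝓝 x) := by
    have : Continuous fun ε : ℝ => x + ε • u := by fun_prop
    simpa using this.tendsto 0
  obtain ⟨δ, hδ, h2⟩ := Metric.eventually_nhds_iff.1 (hc.eventually h)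
  exact ⟨δ, hδ, fun ε hε => h2 (by simpa using hε)⟩

/-- Two walls that both fill the same plane near x meet in dimension two, so neither clause defining
the singular locus can apply. -/
lemma LocPlanar.notMem_sing {D : Set (Wall K)} (hD : ∀ d ∈ D, IsWall d) {x : MR} {ν : M}
    (h : LocPlanar D x ν) : x ∉ Sing D := by
  rintro (⟨d, hd, hx⟩ | ⟨d, hd, d', hd', hdim, hx, hx'⟩)
  · have hxd : x ∈ d.carrier := intrinsicFrontier_subset (hD d hd).isClosed hx
    obtain ⟨h1, h2⟩ := h d hd hxd
    exact ((hD d hd).notMem_frontier_iff h1 hxd).2 h2 hx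
  · obtain ⟨h1, h2⟩ := h d hd hx
    obtain ⟨-, h3⟩ := h d' hd' hx'
    have hle : LinearMap.ker (dotProductBilin ℝ ℝ (toReal ν)) ≤
        (affineSpan ℝ (d.carrier ∩ d'.carrier)).direction := by
      intro u hu
      rw [mem_ker_dot] at hu
      obtain ⟨δ, hδ, h4⟩ := exists_pos_of_eventually_add (u := u) (h2.and h3)
      have h5 := h4 (δ / 2) (by rw [abs_of_pos (by positivity)]; linarith)
      have h6 : toReal ν ⬝ᵥ (x + (δ / 2) • u) = toReal ν ⬝ᵥ x := by
        rw [dotProduct_add, dotProduct_smul, hu]; simp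
      exact mem_direction_of_add_mem (by positivity) ⟨hx, hx'⟩ ⟨h5.1 h6, h5.2 h6⟩
    have h7 := Submodule.finrank_mono hle
    rw [finrank_ker_dot (toReal_ne_zero ((hD d hd).normal_ne_zero h1))] at h7
    rw [dim] at hdim
    omega

/-- Off the singular locus two walls through x meet in dimension two, hence span parallel planes,
and x lies on the boundary of neither. When no wall passes through x, the value ν = 0 is a vacuous
choice. -/
lemma exists_locPlanar {D : Set (Wall K)} (hD : ∀ d ∈ D, IsWall d) {x : MR} (hx : x ∉ Sing D) :
    ∃ ν, LocPlanar D x ν := by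
  by_cases hex : ∃ d ∈ D, x ∈ d.carrier
  · obtain ⟨d, hd, hxd⟩ := hex
    obtain ⟨ν, hν, -, hν2⟩ := (hD d hd).exists_normal
    refine ⟨ν, fun d' hd' hxd' => ?_⟩
    have hν' : IsNormal d'.carrier ν := by
      have h1 : ¬ dim (d.carrier ∩ d'.carrier) ≤ 1 := fun h =>
        hx (Or.inr ⟨d, hd, d', hd', h, hxd, hxd'⟩)
      have h2 : ∀ e ∈ D, d.carrier ∩ d'.carrier ⊆ e.carrier →
          (affineSpan ℝ (d.carrier ∩ d'.carrier)).direction =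
            (affineSpan ℝ e.carrier).direction := fun e he hsub => by
        have hle := AffineSubspace.direction_le (affineSpan_mono ℝ hsub)
        refine Submodule.eq_of_le_of_finrank_eq hle ?_
        have h3 := Submodule.finrank_mono hle
        have h4 := (hD e he).codim_one
        simp only [dim] at h1 h4
        omega
      have h5 := (h2 d hd Set.inter_subset_left).symm.trans (h2 d' hd' Set.inter_subset_right)
      simp only [IsNormal, tangentLattice] at hν ⊢
      rwa [← h5]
    refine ⟨hν', ((hD d' hd').notMem_frontier_iff hν' hxd').1 fun h => ?_⟩
    exact hx (Or.inl ⟨d', hd', h⟩)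
  · exact ⟨0, fun d hd hxd => absurd ⟨d, hd, hxd⟩ hex⟩

lemma LocPlanar.mono {D D' : Set (Wall K)} (h : D' ⊆ D) {x : MR} {ν : M} (hx : LocPlanar D x ν) :
    LocPlanar D' x ν := fun d hd => hx d (h hd)

/-! ### The product of the wall functions at a point -/

open Classical in
/-- The product of the functions of the walls through `x`. -/
noncomputable def prodAt (D : Finset (Wall K)) (n : ℕ) (x : MR) : (KPmod K n)ˣ :=
  ∏ d ∈ D with x ∈ d.carrier, truncUnit n d.func

lemma prodAt_congr {D : Finset (Wall K)} {n : ℕ} {x y : MR}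
    (h : ∀ d ∈ D, x ∈ d.carrier ↔ y ∈ d.carrier) : prodAt D n x = prodAt D n y := by
  classical
  rw [prodAt, prodAt, Finset.filter_congr h]

lemma prodAt_eq_one {D : Finset (Wall K)} {n : ℕ} {x : MR} (h : ∀ d ∈ D, x ∉ d.carrier) :
    prodAt D n x = 1 := by
  classical
  rw [prodAt, Finset.filter_eq_empty_iff.2 h, Finset.prod_empty]

lemma prodAt_mem {D : Finset (Wall K)} (hD : ∀ d ∈ D, IsWall d) (n : ℕ) {x : MR} {ν : M}
    (h : ∀ d ∈ D, x ∈ d.carrier → IsNormal d.carrier ν) :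
    (prodAt D n x : KPmod K n) ∈ suppSub K n {p | ν ⬝ᵥ p.1 = 0} := by
  classical
  rw [prodAt, Units.coe_prod]
  refine prod_mem_suppSub (by simp) ?_ _ _ fun d hd => ?_
  · intro p hp q hq
    simp only [Set.mem_ofPred_eq, Prod.fst_add, dotProduct_add] at *
    omega
  · rw [Finset.mem_filter] at hd
    exact (hD d hd.1).trunc_mem (h d hd.1 hd.2) n

lemma eventually_notMem {D : Finset (Wall K)} (hD : ∀ d ∈ D, IsWall d) (x : MR) :
    ∀ᶠ y in 𝓝 x, ∀ d ∈ D, y ∈ d.carrier → x ∈ d.carrier := by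
  rw [Filter.eventually_all_finset]
  intro d hd
  by_cases hx : x ∈ d.carrier
  · simp [hx]
  · filter_upwards [(hD d hd).isClosed.isOpen_compl.mem_nhds hx] with y hy hy2
    exact absurd hy2 hy

lemma LocPlanar.eventually_mem_iff {D : Finset (Wall K)} (hD : ∀ d ∈ D, IsWall d) {x : MR} {ν : M}
    (h : LocPlanar (D : Set (Wall K)) x ν) :
    ∀ᶠ y in 𝓝 x, ∀ d ∈ D,
      (y ∈ d.carrier ↔ x ∈ d.carrier ∧ toReal ν ⬝ᵥ y = toReal ν ⬝ᵥ x) := by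
  have h1 : ∀ᶠ y in 𝓝 x, ∀ d ∈ D, x ∈ d.carrier →
      toReal ν ⬝ᵥ y = toReal ν ⬝ᵥ x → y ∈ d.carrier := by
    rw [Filter.eventually_all_finset]
    intro d hd
    by_cases hx : x ∈ d.carrier
    · filter_upwards [(h d hd hx).2] with y hy _ using hy
    · simp [hx]
  filter_upwards [h1, eventually_notMem hD x] with y hy1 hy2 d hd
  refine ⟨fun hy => ?_, fun hy => hy1 d hd hy.1 hy.2⟩
  have hx := hy2 d hd hy
  exact ⟨hx, (hD d hd).dot_eq (h d hd hx).1 hy hx⟩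

/-! ### Generic points of an arrangement -/

/-- The affine functions of `A` that vanish at `x` are proportional. -/
def Gen (A : Finset (M × ℤ)) (x : MR) : Prop :=
  ∃ c : MR, ∀ h ∈ A, ev h x = 0 → ∃ r : ℝ, toReal h.1 = r • c

/-- All walls of `D` are polyhedra cut out by affine functions from `A`. -/
def PresentedBy (D : Finset (Wall K)) (A : Finset (M × ℤ)) : Prop :=
  ∀ d ∈ D, ∃ H ⊆ A, d.carrier = poly H

lemma exists_presentedBy (D : Finset (Wall K)) (hD : ∀ d ∈ D, IsWall d) :
    ∃ A, PresentedBy D A := by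
  classical
  have h : ∀ d : D, ∃ H, d.1.carrier = poly H := fun d =>
    (isRationalPolyhedron_iff _).1 (hD d.1 d.2).polyhedron
  choose H hH using h
  exact ⟨Finset.univ.biUnion H, fun d hd =>
    ⟨H ⟨d, hd⟩, Finset.subset_biUnion_of_mem H (Finset.mem_univ _), hH ⟨d, hd⟩⟩⟩

lemma PresentedBy.mono {D D' : Finset (Wall K)} {A : Finset (M × ℤ)} (h : PresentedBy D A)
    (hD : D' ⊆ D) : PresentedBy D' A := fun d hd => h d (hD hd)

/-- The affine functions presenting a wall include an equation of its plane. -/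
lemma IsWall.exists_equation {d : Wall K} (hd : IsWall d) {ν : M} (hν : IsNormal d.carrier ν)
    {H : Finset (M × ℤ)} (hH : d.carrier = poly H) :
    ∃ k ∈ H, (∃ g : ℝ, g ≠ 0 ∧ toReal k.1 = g • toReal ν) ∧ ∀ x ∈ d.carrier, ev k x = 0 := by
  have hdim := hd.codim_one
  rw [hH] at hdim
  obtain ⟨k, hkH, hk0, hk⟩ := exists_implicit_eq hdim
  refine ⟨k, hkH, ?_, by rwa [hH]⟩
  have h1 := direction_eq_ker hdim hk0 hk
  obtain ⟨c, hc⟩ := (hν k.1).1 fun m hm => by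
    rw [tangentLattice, Set.mem_ofPred_eq, hH, h1, mem_ker_dot, toReal_dot] at hm
    exact_mod_cast hm
  refine ⟨c, ?_, by rw [hc, toReal_zsmul]⟩
  rintro h
  exact hk0 (by rw [hc, Int.cast_eq_zero.1 h, zero_smul])

/-- At a generic point the equations of all walls through it are multiples of one covector c, so the
walls span one plane. The other inequalities active there are also multiples of c, hence constant on
this plane, so they cut nothing off near the point. -/
lemma Gen.exists_locPlanar {D : Finset (Wall K)} (hD : ∀ d ∈ D, IsWall d) {A : Finset (M × ℤ)}
    (hA : PresentedBy D A) {x : MR} (hx : Gen A x) : ∃ ν, LocPlanar (D : Set (Wall K)) x ν := by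
  obtain ⟨c, hc⟩ := hx
  by_cases hex : ∃ d ∈ D, x ∈ d.carrier
  · obtain ⟨d, hd, hxd⟩ := hex
    obtain ⟨ν, hν, -, -⟩ := (hD d hd).exists_normal
    have key : ∀ e ∈ D, x ∈ e.carrier → ∀ μ, IsNormal e.carrier μ →
        ∃ g : ℝ, g ≠ 0 ∧ g • toReal μ = c := by
      intro e he hxe μ hμ
      obtain ⟨H, hHA, hH⟩ := hA e he
      obtain ⟨k, hk, ⟨g, hg, hkg⟩, hk0⟩ := (hD e he).exists_equation hμ hH
      obtain ⟨r, hr⟩ := hc k (hHA hk) (hk0 x hxe)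
      have hr0 : r ≠ 0 := by
        rintro rfl
        rw [zero_smul, hkg] at hr
        exact toReal_ne_zero ((hD e he).normal_ne_zero hμ) ((smul_eq_zero.1 hr).resolve_left hg)
      refine ⟨r⁻¹ * g, mul_ne_zero (inv_ne_zero hr0) hg, ?_⟩
      rw [mul_smul, ← hkg, hr, smul_smul, inv_mul_cancel₀ hr0, one_smul]
    obtain ⟨g, hg, hgc⟩ := key d hd hxd ν hν
    refine ⟨ν, fun e he hxe => ?_⟩
    have hνe : IsNormal e.carrier ν := by
      obtain ⟨μ, hμ, -, hμ2⟩ := (hD e he).exists_normal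
      obtain ⟨g', hg', hgc'⟩ := key e he hxe μ hμ
      have h3 : ∀ u, u ∈ (affineSpan ℝ e.carrier).direction ↔ toReal ν ⬝ᵥ u = 0 := fun u => by
        have h1 : toReal μ ⬝ᵥ u = 0 ↔ c ⬝ᵥ u = 0 := by
          rw [← hgc', smul_dotProduct, smul_eq_mul, mul_eq_zero, or_iff_right hg']
        have h2 : toReal ν ⬝ᵥ u = 0 ↔ c ⬝ᵥ u = 0 := by
          rw [← hgc, smul_dotProduct, smul_eq_mul, mul_eq_zero, or_iff_right hg]
        rw [hμ2, h1, h2]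
      obtain ⟨⟨a, ha⟩, -⟩ := (hD d hd).normal_spec hν
      exact isNormal_of_direction ha h3
    refine ⟨hνe, ?_⟩
    obtain ⟨H, hHA, hH⟩ := hA e (Finset.mem_coe.1 he)
    filter_upwards [eventually_sign A x] with y hy hy2
    rw [hH] at hxe ⊢
    refine (eventually_mem_poly_iff hHA hy).2 ⟨hxe, fun k hk hk0 => ?_⟩
    obtain ⟨r, hr⟩ := hc k (hHA hk) hk0
    rw [hr, ← hgc, smul_smul, smul_dotProduct, dotProduct_sub, hy2, sub_self, smul_zero]
  · exact ⟨0, fun d hd hxd => absurd ⟨d, hd, hxd⟩ hex⟩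

/-! ### Regrouping path-ordered products by crossing times -/

lemma list_eq_filter_append {α : Type*} (τ : α → ℝ) (t : ℝ) (L : List α)
    (hs : L.Pairwise fun a b => τ a ≤ τ b) (ht : ∀ c ∈ L, t ≤ τ c) :
    L = L.filter (fun c => τ c = t) ++ L.filter (fun c => ¬ τ c = t) := by
  induction L with
  | nil => rfl
  | cons c L ih =>
    have ih' := ih (List.pairwise_cons.1 hs).2 fun e he => ht e (List.mem_cons_of_mem _ he)
    by_cases hc : τ c = t
    · simp only [List.filter_cons, hc, decide_true, if_true, not_true_eq_false, decide_false,
        Bool.false_eq_true, if_false, List.cons_append]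
      exact congrArg _ ih'
    · have hlt : t < τ c := lt_of_le_of_ne (ht c List.mem_cons_self) (Ne.symm hc)
      have h1 : ∀ e ∈ c :: L, ¬ τ e = t := by
        intro e he h
        rcases List.mem_cons.1 he with rfl | he
        · exact hc h
        · have := (List.pairwise_cons.1 hs).1 e he
          linarith
      rw [List.filter_eq_nil_iff.2 (by simpa using h1), List.nil_append,
        List.filter_eq_self.2 (by simpa using h1)]

lemma foldl_regroup {α β : Type*} (τ : α → ℝ) (f : β → α → β) (T : List ℝ)
    (hT : T.Pairwise (· < ·)) (L : List α) (hs : L.Pairwise fun a b => τ a ≤ τ b)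
    (hL : ∀ c ∈ L, τ c ∈ T) (b : β) :
    L.foldl f b = T.foldl (fun acc t => (L.filter fun c => τ c = t).foldl f acc) b := by
  induction T generalizing L b with
  | nil =>
    have : L = [] := List.eq_nil_iff_forall_not_mem.2 fun c hc => by simpa using hL c hc
    simp [this]
  | cons t T ih =>
    obtain ⟨hT1, hT2⟩ := List.pairwise_cons.1 hT
    have ht : ∀ c ∈ L, t ≤ τ c := fun c hc => by
      rcases List.mem_cons.1 (hL c hc) with h | h
      · exact h.ge
      · exact (hT1 _ h).le
    have hsplit := list_eq_filter_append τ t L hs ht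
    conv_lhs => rw [hsplit]
    rw [List.foldl_append, List.foldl_cons, ih hT2 _ (hs.sublist List.filter_sublist)]
    · refine List.foldl_ext _ _ _ fun acc s hst => ?_
      congr 1
      rw [List.filter_filter]
      refine List.filter_congr fun c _ => ?_
      have := hT1 s hst
      by_cases h : τ c = s
      · simp [h, this.ne']
      · simp [h]
    · intro c hc
      rw [List.mem_filter] at hc
      rcases List.mem_cons.1 (hL c hc.1) with h | h
      · simp [h] at hc
      · exact h

/-- The composition of the maps `A t`, `t ∈ T`, with the first one applied first. -/
def compose {X : Type*} [Semiring X] [Algebra K X] (T : List ℝ) (A : ℝ → X →ₐ[K] X) : X →ₐ[K] X :=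
  T.foldl (fun acc t => (A t).comp acc) (AlgHom.id K X)

/-- The sign of the covector is fixed by the position of the path just before the crossing, so
opposite covectors cannot both be valid. -/
lemma CrossesAt.eq_of_eq_or_neg {γ : ℝ → MR} {d d' : Wall K} {t : ℝ} {ν ν' : M}
    (h : CrossesAt γ d t ν) (h' : CrossesAt γ d' t ν') (hs : ν' = ν ∨ ν' = -ν) : ν' = ν := by
  rcases hs with rfl | rfl
  · rfl
  · obtain ⟨-, -, ε, hε, -, -, h1, -⟩ := h
    obtain ⟨-, -, ε', hε', -, -, h2, -⟩ := h'
    have hm : t - min ε ε' / 2 ∈ Set.Ioo (t - ε) t ∧ t - min ε ε' / 2 ∈ Set.Ioo (t - ε') t := by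
      have := min_le_left ε ε'
      have := min_le_right ε ε'
      have : 0 < min ε ε' := lt_min hε hε'
      exact ⟨⟨by linarith, by linarith⟩, ⟨by linarith, by linarith⟩⟩
    have h3 := h1 _ hm.1
    have h4 := h2 _ hm.2
    rw [toReal_neg, neg_dotProduct, neg_dotProduct] at h4
    linarith

lemma LocPlanar.crossesAt_unique {D : Set (Wall K)} (hD : ∀ d ∈ D, IsWall d) {γ : ℝ → MR} {t : ℝ}
    {μ : M} (hp : LocPlanar D (γ t) μ) {d d' : Wall K} (hd : d ∈ D) (hd' : d' ∈ D) {ν ν' : M}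
    (h : CrossesAt γ d t ν) (h' : CrossesAt γ d' t ν') : ν' = ν := by
  obtain ⟨⟨a, ha⟩, -⟩ := (hD d hd).normal_spec (hp d hd h.1).1
  have h1 := (hp d hd h.1).1.eq_or_neg ha h.2.1
  have h2 := (hp d' hd' h'.1).1.eq_or_neg ha h'.2.1
  refine h.eq_of_eq_or_neg h' ?_
  rcases h1 with rfl | rfl <;> rcases h2 with rfl | rfl <;> simp

lemma foldl_crossings {n : ℕ} (D : Finset (Wall K)) (hD : ∀ d ∈ D, IsWall d) {ν : M}
    (l : List (ℝ × Wall K × M)) (hl : ∀ c ∈ l, c.2.1 ∈ D ∧ c.2.2 = ν ∧ IsNormal c.2.1.carrier ν)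
    (acc : KPmod K n →ₐ[K] KPmod K n) :
    l.foldl (fun acc c => (wallCrossing n c.2.1.func c.2.2).comp acc) acc =
      (cross n (l.map fun c => truncUnit n c.2.1.func).prod ν).comp acc := by
  induction l generalizing acc with
  | nil => simp [cross_one]
  | cons c l ih =>
    obtain ⟨h1, h2, h3⟩ := hl c List.mem_cons_self
    rw [List.foldl_cons, ih fun e he => hl e (List.mem_cons_of_mem _ he), wallCrossing_eq_cross,
      h2, ← AlgHom.comp_assoc, cross_comp_cross_same _ _ ((hD _ h1).trunc_mem h3 n), List.map_cons,
      List.prod_cons]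

/-- A path-ordered product is the composition over the crossing times of the crossings of the
products of wall functions. -/
lemma eq_compose {n : ℕ} (D : Finset (Wall K)) (hD : ∀ d ∈ D, IsWall d) {γ : ℝ → MR}
    (hγ : IsAdmissible (D : Set (Wall K)) γ) {θ : KPmod K n →ₐ[K] KPmod K n}
    {L : List (ℝ × Wall K × M)} (hnd : L.Nodup) (hs : L.Pairwise (fun a b => a.1 ≤ b.1))
    (hL : ∀ c : ℝ × Wall K × M,
      c ∈ L ↔ c.1 ∈ Set.Icc (0 : ℝ) 1 ∧ c.2.1 ∈ (D : Set (Wall K)) ∧ CrossesAt γ c.2.1 c.1 c.2.2)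
    (hθ : θ = L.foldl (fun acc c => (wallCrossing n c.2.1.func c.2.2).comp acc)
      (AlgHom.id K (KPmod K n)))
    {T : List ℝ} (hT : T.Pairwise (· < ·)) (hTI : ∀ t ∈ T, t ∈ Set.Icc (0 : ℝ) 1)
    (hLT : ∀ c ∈ L, c.1 ∈ T) {A : ℝ → KPmod K n →ₐ[K] KPmod K n}
    (hA0 : ∀ t ∈ T, (∀ d ∈ D, γ t ∉ d.carrier) → A t = AlgHom.id K _)
    (hA1 : ∀ t ∈ T, ∀ d ∈ D, ∀ ν, CrossesAt γ d t ν → A t = cross n (prodAt D n (γ t)) ν) :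
    θ = compose T A := by
  classical
  rw [hθ, compose, foldl_regroup (fun c : ℝ × Wall K × M => c.1) _ T hT L hs hLT]
  refine List.foldl_ext _ _ _ fun acc t ht => ?_
  have htI := hTI t ht
  set l := L.filter (fun c => c.1 = t) with hl
  have hmem : ∀ c, c ∈ l ↔ c.1 = t ∧ c.2.1 ∈ D ∧ CrossesAt γ c.2.1 t c.2.2 := by
    intro c
    rw [hl, List.mem_filter, hL]
    simp only [decide_eq_true_eq]
    constructor
    · rintro ⟨⟨h1, h2, h3⟩, rfl⟩; exact ⟨rfl, h2, h3⟩
    · rintro ⟨rfl, h2, h3⟩; exact ⟨⟨htI, h2, h3⟩, rfl⟩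
  by_cases hex : ∃ d ∈ D, γ t ∈ d.carrier
  · obtain ⟨d, hd, hxd⟩ := hex
    obtain ⟨ν, hν⟩ := hγ.transversal t htI d hd hxd
    obtain ⟨μ, hp⟩ := exists_locPlanar hD (hγ.avoids t htI)
    have hu : ∀ d' ∈ D, ∀ ν', CrossesAt γ d' t ν' → ν' = ν := fun d' hd' ν' h' =>
      hp.crossesAt_unique hD hd hd' hν h'
    have h1 : ∀ c ∈ l, c.2.1 ∈ D ∧ c.2.2 = ν ∧ IsNormal c.2.1.carrier ν := fun c hc => by
      obtain ⟨h1, h2, h3⟩ := (hmem c).1 hc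
      have := hu _ h2 _ h3
      exact ⟨h2, this, this ▸ h3.2.1⟩
    rw [foldl_crossings D hD l h1, hA1 t ht d hd ν hν]
    congr 2
    -- Entries of the list at one time share the time and the covector, so they are told apart by
    -- their walls; the list product is therefore the product over the set of walls through γ t.
    have hinj : (l.map fun c => c.2.1).Nodup := by
      refine List.Nodup.map_on ?_ (hnd.filter _)
      intro c hc e he hce
      have hc1 := ((hmem c).1 hc).1
      have he1 := ((hmem e).1 he).1
      have hc2 := (h1 c hc).2.1
      have he2 := (h1 e he).2.1
      exact Prod.ext (hc1.trans he1.symm) (Prod.ext hce (hc2.trans he2.symm))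
    have : (l.map fun c => truncUnit n c.2.1.func) =
        (l.map fun c => c.2.1).map fun d => truncUnit n d.func := by
      rw [List.map_map]; rfl
    rw [this, prodAt]
    refine (List.prod_toFinset (fun d : Wall K => truncUnit n d.func) hinj).symm.trans ?_
    refine Finset.prod_congr ?_ fun _ _ => rfl
    ext e
    simp only [List.mem_toFinset, List.mem_map, Finset.mem_filter]
    constructor
    · rintro ⟨c, hc, rfl⟩
      obtain ⟨-, h2, h3⟩ := (hmem c).1 hc
      exact ⟨h2, h3.1⟩
    · rintro ⟨he, hxe⟩
      obtain ⟨ν', hν'⟩ := hγ.transversal t htI e he hxe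
      exact ⟨(t, e, ν'), (hmem _).2 ⟨rfl, he, hν'⟩, rfl⟩
  · push Not at hex
    have : l = [] := List.eq_nil_iff_forall_not_mem.2 fun c hc => by
      obtain ⟨-, h2, h3⟩ := (hmem c).1 hc
      exact hex _ h2 h3.1
    rw [this, List.foldl_nil, hA0 t ht hex, AlgHom.id_comp]

open Classical in
/-- The crossing at time `t` of all walls of `D` through `γ t`. -/
noncomputable def crossAt (D : Finset (Wall K)) (n : ℕ) (γ : ℝ → MR) (t : ℝ) :
    KPmod K n →ₐ[K] KPmod K n :=
  if h : ∃ ν, ∃ d ∈ D, CrossesAt γ d t ν then cross n (prodAt D n (γ t)) h.choose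
  else AlgHom.id K _

lemma crossAt_of_notMem {D : Finset (Wall K)} {n : ℕ} {γ : ℝ → MR} {t : ℝ}
    (h : ∀ d ∈ D, γ t ∉ d.carrier) : crossAt D n γ t = AlgHom.id K _ := by
  rw [crossAt, dif_neg]
  rintro ⟨ν, d, hd, hν⟩
  exact h d hd hν.1

lemma crossAt_of_crossesAt {D : Finset (Wall K)} (hD : ∀ d ∈ D, IsWall d) {n : ℕ} {γ : ℝ → MR}
    {t : ℝ} {μ : M} (hp : LocPlanar (D : Set (Wall K)) (γ t) μ) {d : Wall K} (hd : d ∈ D) {ν : M}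
    (h : CrossesAt γ d t ν) : crossAt D n γ t = cross n (prodAt D n (γ t)) ν := by
  have hex : ∃ ν, ∃ d ∈ D, CrossesAt γ d t ν := ⟨ν, d, hd, h⟩
  rw [crossAt, dif_pos hex]
  obtain ⟨d', hd', h'⟩ := hex.choose_spec
  rw [hp.crossesAt_unique hD (Finset.mem_coe.2 hd) (Finset.mem_coe.2 hd') h h']

/-- The list T may contain times at which nothing is crossed, since these contribute the identity.
This lets two wall structures be compared along one common list of times. -/
lemma eq_compose_crossAt {n : ℕ} (D : Finset (Wall K)) (hD : ∀ d ∈ D, IsWall d) {γ : ℝ → MR}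
    (hγ : IsAdmissible (D : Set (Wall K)) γ) {θ : KPmod K n →ₐ[K] KPmod K n}
    (hθ : IsPathOrderedProduct (D : Set (Wall K)) n γ θ) {T : List ℝ} (hT : T.Pairwise (· < ·))
    (hTI : ∀ t ∈ T, t ∈ Set.Icc (0 : ℝ) 1)
    (hLT : ∀ t ∈ Set.Icc (0 : ℝ) 1, ∀ d ∈ D, γ t ∈ d.carrier → t ∈ T) :
    θ = compose T (crossAt D n γ) := by
  obtain ⟨L, hnd, hs, hL, hθ⟩ := hθ
  refine eq_compose D hD hγ hnd hs hL hθ hT hTI (fun c hc => ?_)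
    (fun t _ h => crossAt_of_notMem h) (fun t ht d hd ν h => ?_)
  · obtain ⟨h1, h2, h3⟩ := (hL c).1 hc
    exact hLT _ h1 _ h2 h3.1
  · obtain ⟨μ, hp⟩ := exists_locPlanar hD (hγ.avoids t (hTI t ht))
    exact crossAt_of_crossesAt hD hp hd h

/-- The crossing times of a path that has a path-ordered product. -/
lemma IsPathOrderedProduct.finite_times {n : ℕ} {D : Set (Wall K)} {γ : ℝ → MR}
    (hγ : IsAdmissible D γ) {θ : KPmod K n →ₐ[K] KPmod K n}
    (hθ : IsPathOrderedProduct D n γ θ) :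
    {t ∈ Set.Icc (0 : ℝ) 1 | ∃ d ∈ D, γ t ∈ d.carrier}.Finite := by
  obtain ⟨L, -, -, hL, -⟩ := hθ
  refine (L.map (·.1)).finite_toSet.subset ?_
  rintro t ⟨ht, d, hd, hxd⟩
  obtain ⟨ν, hν⟩ := hγ.transversal t ht d hd hxd
  exact List.mem_map.2 ⟨(t, d, ν), (hL _).2 ⟨ht, hd, hν⟩, rfl⟩

/-- Existence of path-ordered products. -/
lemma exists_isPathOrderedProduct {n : ℕ} (D : Finset (Wall K)) (hD : ∀ d ∈ D, IsWall d)
    {γ : ℝ → MR}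
    (hfin : {t ∈ Set.Icc (0 : ℝ) 1 | ∃ d ∈ D, γ t ∈ d.carrier}.Finite) :
    ∃ θ, IsPathOrderedProduct (D : Set (Wall K)) n γ θ := by
  classical
  have hν : ∀ d : Wall K, ∃ ν a : M, IsWall d → IsNormal d.carrier ν ∧ ν ⬝ᵥ a = 1 := fun d => by
    by_cases hd : IsWall d
    · obtain ⟨ν, hν, ⟨a, ha⟩, -⟩ := hd.exists_normal
      exact ⟨ν, a, fun _ => ⟨hν, ha⟩⟩
    · exact ⟨0, 0, fun h => absurd h hd⟩
  choose ν a hν using hν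
  -- A crossing is determined by one of finitely many times, one of finitely many walls and one of
  -- the two generators ±ν of its conormal lattice.
  have hC : {c : ℝ × Wall K × M | c.1 ∈ Set.Icc (0 : ℝ) 1 ∧ c.2.1 ∈ (D : Set (Wall K)) ∧
      CrossesAt γ c.2.1 c.1 c.2.2}.Finite := by
    refine (hfin.prod (D.finite_toSet.prod
      ((D.finite_toSet.image ν).union (D.finite_toSet.image fun d => -ν d)))).subset ?_
    rintro ⟨t, d, μ⟩ ⟨ht, hd, hc⟩
    refine ⟨⟨ht, d, hd, hc.1⟩, hd, ?_⟩
    obtain ⟨h1, h2⟩ := hν d (hD d hd)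
    rcases h1.eq_or_neg h2 hc.2.1 with h | h
    · exact Or.inl ⟨d, hd, h.symm⟩
    · exact Or.inr ⟨d, hd, h.symm⟩
  let r : ℝ × Wall K × M → ℝ × Wall K × M → Prop := fun a b => a.1 ≤ b.1
  have : Std.Total r := ⟨fun a b => le_total a.1 b.1⟩
  have : IsTrans _ r := ⟨fun a b c h1 h2 => le_trans (a := a.1) h1 h2⟩
  refine ⟨_, (hC.toFinset.toList.insertionSort r), ?_, ?_, ?_, rfl⟩
  · exact (List.perm_insertionSort r _).nodup_iff.2 (Finset.nodup_toList _)
  · exact List.pairwise_insertionSort r _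
  · intro c
    rw [(List.perm_insertionSort r _).mem_iff, Finset.mem_toList, Set.Finite.mem_toFinset]
    rfl

/-! ### Path-ordered products from a potential -/

lemma eq_of_locally_const {X : Type*} (φ : ℝ → X) {a b : ℝ} (hab : a ≤ b)
    (h : ∀ t ∈ Set.Icc a b, ∀ᶠ s in 𝓝[Set.Icc a b] t, φ s = φ t) : φ b = φ a := by
  have hc : IsLocallyConstant (fun t : Set.Icc a b => φ t) := by
    rw [IsLocallyConstant.iff_eventually_eq]
    intro t
    have := h t t.2
    rw [nhdsWithin_eq_map_subtype_coe t.2, Filter.eventually_map] at this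
    exact this
  have : PreconnectedSpace (Set.Icc a b) := Subtype.preconnectedSpace isPreconnected_Icc
  exact hc.apply_eq_of_preconnectedSpace ⟨b, hab, le_rfl⟩ ⟨a, le_rfl, hab⟩

/-- Between consecutive times φ is constant by connectedness of the interval. Evaluation just before
and just after the next time t records the jump `A t`, and induction continues from the point just
after. -/
lemma potential_foldl {X : Type*} (φ : ℝ → X) (A : ℝ → X → X) (T : List ℝ)
    (hT : T.Pairwise (· < ·)) {a b : ℝ} (hab : a ≤ b) (hTI : ∀ t ∈ T, t ∈ Set.Ioo a b)
    (h0 : ∀ t ∈ Set.Icc a b, t ∉ T → ∀ᶠ s in 𝓝[Set.Icc a b] t, φ s = φ t)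
    (h1 : ∀ t ∈ T, ∀ᶠ s in 𝓝[<] t, ∀ᶠ s' in 𝓝[>] t, φ s' = A t (φ s)) :
    φ b = T.foldl (fun acc t => A t acc) (φ a) := by
  induction T generalizing a with
  | nil => exact eq_of_locally_const φ hab fun t ht => h0 t ht List.not_mem_nil
  | cons t T ih =>
    obtain ⟨hT1, hT2⟩ := List.pairwise_cons.1 hT
    have ht := hTI t List.mem_cons_self
    have hlt : ∀ᶠ s in 𝓝[<] t, s ∈ Set.Ioo a t :=
      Ioo_mem_nhdsLT ht.1
    obtain ⟨s, hs, hsI⟩ := ((h1 t List.mem_cons_self).and hlt).exists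
    have hgt : ∀ᶠ s' in 𝓝[>] t, s' ∈ Set.Ioo t b ∧ ∀ u ∈ T, s' < u := by
      refine Filter.Eventually.and (Ioo_mem_nhdsGT ht.2) ?_
      have : ∀ᶠ s' in 𝓝[>] t, ∀ u ∈ T.toFinset, s' < u := by
        rw [Filter.eventually_all_finset]
        intro u hu
        exact mem_nhdsWithin_of_mem_nhds (Iio_mem_nhds (hT1 u (List.mem_toFinset.1 hu)))
      simpa using this
    obtain ⟨s', hs', hs'I, hs'T⟩ := (hs.and hgt).exists
    have e1 : φ s = φ a := by
      refine eq_of_locally_const φ hsI.1.le fun u hu => ?_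
      have huT : u ∉ t :: T := by
        intro hu2
        rcases List.mem_cons.1 hu2 with rfl | h
        · linarith [hu.2, hsI.2]
        · linarith [hT1 u h, hu.2, hsI.2]
      have hsub : Set.Icc a s ⊆ Set.Icc a b :=
        Set.Icc_subset_Icc_right (by linarith [hsI.2, ht.2])
      exact nhdsWithin_mono u hsub (h0 u (hsub hu) huT)
    rw [List.foldl_cons, ← e1, ← hs']
    refine ih hT2 hs'I.2.le (fun u hu => ⟨hs'T u hu, (hTI u (List.mem_cons_of_mem _ hu)).2⟩)
      (fun u hu huT => ?_) fun u hu => h1 u (List.mem_cons_of_mem _ hu)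
    have hsub : Set.Icc s' b ⊆ Set.Icc a b :=
      Set.Icc_subset_Icc_left (by linarith [hs'I.1, ht.1])
    refine nhdsWithin_mono u hsub (h0 u (hsub hu) ?_)
    intro h
    rcases List.mem_cons.1 h with rfl | h
    · linarith [hu.1, hs'I.1]
    · exact huT h

/-- A potential for the wall crossings at the point `x`: it jumps by the wall crossing. -/
def IsPotentialAt (D : Finset (Wall K)) (n : ℕ) (Φ : MR → KPmod K n →ₐ[K] KPmod K n) (x : MR) :
    Prop :=
  ((∀ d ∈ D, x ∉ d.carrier) → ∀ᶠ y in 𝓝 x, Φ y = Φ x) ∧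
  ((∃ d ∈ D, x ∈ d.carrier) → ∃ d ∈ D, x ∈ d.carrier ∧ ∃ ν : M, IsNormal d.carrier ν ∧
    ∃ φ ψ : KPmod K n →ₐ[K] KPmod K n, ψ = (cross n (prodAt D n x) ν).comp φ ∧
      ∀ᶠ y in 𝓝 x, (toReal ν ⬝ᵥ x < toReal ν ⬝ᵥ y → Φ y = φ) ∧
        (toReal ν ⬝ᵥ y < toReal ν ⬝ᵥ x → Φ y = ψ))

lemma CrossesAt.mem_Ioo {γ : ℝ → MR} {d : Wall K} {t : ℝ} {ν : M} (h : CrossesAt γ d t ν) :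
    t ∈ Set.Ioo (0 : ℝ) 1 := by
  obtain ⟨-, -, ε, hε, h1, h2, -⟩ := h
  exact ⟨by linarith, by linarith⟩

/-- The path-ordered product along a loop on which a potential exists is the identity. -/
lemma eq_id_of_potential {n : ℕ} (D : Finset (Wall K)) (hD : ∀ d ∈ D, IsWall d) {γ : ℝ → MR}
    (hγ : IsAdmissible (D : Set (Wall K)) γ) (hloop : γ 0 = γ 1)
    {θ : KPmod K n →ₐ[K] KPmod K n} (hθ : IsPathOrderedProduct (D : Set (Wall K)) n γ θ)
    (Φ : MR → KPmod K n →ₐ[K] KPmod K n)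
    (hΦ : ∀ t ∈ Set.Icc (0 : ℝ) 1, IsPotentialAt D n Φ (γ t))
    (hsurj : Function.Surjective (Φ (γ 0))) : θ = AlgHom.id K _ := by
  classical
  have hfin := hθ.finite_times hγ
  set T := hfin.toFinset.sort (· ≤ ·) with hTdef
  have hmemT : ∀ t, t ∈ T ↔ t ∈ Set.Icc (0 : ℝ) 1 ∧ ∃ d ∈ D, γ t ∈ d.carrier := fun t => by
    rw [hTdef, Finset.mem_sort, Set.Finite.mem_toFinset]; rfl
  have hT : T.Pairwise (· < ·) := (Finset.sortedLT_sort _).pairwise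
  have h1 : θ = compose T (crossAt D n γ) :=
    eq_compose_crossAt D hD hγ hθ hT (fun t ht => ((hmemT t).1 ht).1)
      fun t ht d hd hx => (hmemT t).2 ⟨ht, d, hd, hx⟩
  have hcont : ∀ t ∈ Set.Icc (0 : ℝ) 1, Tendsto γ (𝓝[Set.Icc 0 1] t) (𝓝 (γ t)) :=
    fun t ht => hγ.smooth.1 t ht
  have hcross : ∀ t ∈ T, t ∈ Set.Ioo (0 : ℝ) 1 := fun t ht => by
    obtain ⟨htI, d, hd, hx⟩ := (hmemT t).1 ht
    obtain ⟨ν, hν⟩ := hγ.transversal t htI d hd hx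
    exact hν.mem_Ioo
  have h2 := potential_foldl (fun t => Φ (γ t)) (fun t φ => (crossAt D n γ t).comp φ) T hT
    zero_le_one hcross
    (fun t ht htT => by
      refine (hcont t ht).eventually ((hΦ t ht).1 fun d hd hx => htT ?_)
      exact (hmemT t).2 ⟨ht, d, hd, hx⟩)
    (fun t ht => by
      obtain ⟨htI, d₀, hd₀, hx₀⟩ := (hmemT t).1 ht
      obtain ⟨d, hd, hx, ν, hν, φ, ψ, hψ, hev⟩ := (hΦ t htI).2 ⟨d₀, hd₀, hx₀⟩
      obtain ⟨μ, hμ⟩ := hγ.transversal t htI d hd hx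
      obtain ⟨κ, hp⟩ := exists_locPlanar hD (hγ.avoids t htI)
      have hev' := (hcont t htI).eventually hev
      obtain ⟨ht0, ht1⟩ := hcross t ht
      obtain ⟨ε, hε, hl, hr⟩ := hμ.2.2
      have hlt : ∀ᶠ s in 𝓝[<] t, toReal μ ⬝ᵥ γ t < toReal μ ⬝ᵥ γ s ∧
          (toReal ν ⬝ᵥ γ t < toReal ν ⬝ᵥ γ s → Φ (γ s) = φ) ∧
          (toReal ν ⬝ᵥ γ s < toReal ν ⬝ᵥ γ t → Φ (γ s) = ψ) := by
        have hI : 𝓝[<] t ≤ 𝓝[Set.Icc 0 1] t := by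
          rw [← nhdsWithin_Ioo_eq_nhdsLT ht0]
          exact nhdsWithin_mono _ fun s hs => ⟨hs.1.le, by linarith [hs.2]⟩
        filter_upwards [hI hev', Ioo_mem_nhdsLT (show t - ε < t by linarith)] with s hs hs2
        exact ⟨hr.2.1 s hs2, hs⟩
      have hgt : ∀ᶠ s in 𝓝[>] t, toReal μ ⬝ᵥ γ s < toReal μ ⬝ᵥ γ t ∧
          (toReal ν ⬝ᵥ γ t < toReal ν ⬝ᵥ γ s → Φ (γ s) = φ) ∧
          (toReal ν ⬝ᵥ γ s < toReal ν ⬝ᵥ γ t → Φ (γ s) = ψ) := by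
        have hI : 𝓝[>] t ≤ 𝓝[Set.Icc 0 1] t := by
          rw [← nhdsWithin_Ioo_eq_nhdsGT ht1]
          exact nhdsWithin_mono _ fun s hs => ⟨by linarith [hs.1], hs.2.le⟩
        filter_upwards [hI hev', Ioo_mem_nhdsGT (show t < t + ε by linarith)] with s hs hs2
        exact ⟨hr.2.2 s hs2, hs⟩
      rw [crossAt_of_crossesAt hD hp hd hμ]
      obtain ⟨⟨a, ha⟩, -⟩ := (hD d hd).normal_spec hν
      filter_upwards [hlt] with s hs
      filter_upwards [hgt] with s' hs'
      -- The path passes either from the positive to the negative side of ν, as in the definition of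
      -- the potential, or in the opposite sense, where the inverse crossing occurs.
      rcases hν.eq_or_neg ha hμ.2.1 with rfl | rfl
      · rw [hs.2.1 hs.1, hs'.2.2 hs'.1, hψ]
      · simp only [toReal_neg, neg_dotProduct, neg_lt_neg_iff] at hs hs'
        rw [hs.2.2 hs.1, hs'.2.1 hs'.1, hψ, ← AlgHom.comp_assoc, cross_neg_comp_cross,
          AlgHom.id_comp]
        have hκ : ∀ d ∈ D, γ t ∈ d.carrier → IsNormal d.carrier κ := fun d hd hx => (hp d hd hx).1
        obtain ⟨⟨b, hb⟩, -⟩ := (hD d hd).normal_spec (hκ d hd hx)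
        have := prodAt_mem hD n hκ
        rcases (hκ d hd hx).eq_or_neg hb hν with rfl | rfl
        · exact this
        · rwa [suppSub_neg])
  -- Crossings act by composition on the left, so the initial value Φ (γ 0) can be factored out on
  -- the right; surjectivity then cancels it.
  have h3 : ∀ (l : List ℝ) (φ ψ : KPmod K n →ₐ[K] KPmod K n),
      l.foldl (fun acc t => (crossAt D n γ t).comp acc) (ψ.comp φ) =
        (l.foldl (fun acc t => (crossAt D n γ t).comp acc) ψ).comp φ := by
    intro l
    induction l with
    | nil => intro φ ψ; rfl
    | cons t l ih => intro φ ψ; rw [List.foldl_cons, List.foldl_cons, ← AlgHom.comp_assoc, ih]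
  have h4 : Φ (γ 1) = θ.comp (Φ (γ 0)) := by
    rw [h1, compose, ← h3, AlgHom.id_comp]
    exact h2
  rw [← hloop] at h4
  ext a
  obtain ⟨b, rfl⟩ := hsurj a
  exact (DFunLike.congr_fun h4 b).symm

/-! ### Unipotent automorphisms to first order -/

lemma mem_filt_of_suppSub {n j : ℕ} {a : KPmod K n} :
    a ∈ filt K n j ↔ a ∈ suppSub K n {p | j ≤ deg p} := by
  constructor
  · intro h
    rw [filt_eq] at h
    obtain ⟨g, hg, rfl⟩ := (Ideal.mem_map_iff_of_surjective _ (toMod_surjective n)).1 h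
    rw [mP_pow_eq] at hg
    rw [toMod_eq_sum]
    exact Submodule.sum_mem _ fun p hp => Submodule.smul_mem _ _
      (Submodule.subset_span ⟨p, hg p (Finsupp.mem_support_iff.1 hp), rfl⟩)
  · intro h
    have : suppSub K n {p | j ≤ deg p} ≤ (filt K n j).restrictScalars K := by
      refine Submodule.span_le.2 ?_
      rintro _ ⟨p, hp, rfl⟩
      exact mono_mem_filt n hp
    exact this h

lemma mapsTo_filt_of_mono {n i j : ℕ} (φ : KPmod K n →ₗ[K] KPmod K n)
    (h : ∀ p, i ≤ deg p → φ (mono K n p) ∈ filt K n j) {a : KPmod K n} (ha : a ∈ filt K n i) :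
    φ a ∈ filt K n j := by
  rw [mem_filt_of_suppSub] at ha
  have : suppSub K n {p | i ≤ deg p} ≤ ((filt K n j).restrictScalars K).comap φ := by
    refine Submodule.span_le.2 ?_
    rintro _ ⟨p, hp, rfl⟩
    exact h p hp
  exact this ha

lemma zpow_sub_zpow_mem {n j : ℕ} {u v : (KPmod K n)ˣ} (h : (u : KPmod K n) - v ∈ filt K n j)
    (k : ℤ) : ((u ^ k : (KPmod K n)ˣ) : KPmod K n) - (v ^ k : (KPmod K n)ˣ) ∈ filt K n j := by
  let π : KPmod K n →* KPmod K n ⧸ filt K n j := (Ideal.Quotient.mk (filt K n j) : _ →* _)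
  have h1 : Units.map π u = Units.map π v := Units.ext (Ideal.Quotient.eq.2 h)
  have h2 : Units.map π (u ^ k) = Units.map π (v ^ k) := by rw [map_zpow, map_zpow, h1]
  exact Ideal.Quotient.eq.1 (congrArg Units.val h2)

lemma zpow_sub_one_mem {n : ℕ} {u : (KPmod K n)ˣ} (h : (u : KPmod K n) - 1 ∈ filt K n 1)
    (k : ℤ) : ((u ^ k : (KPmod K n)ˣ) : KPmod K n) - 1 ∈ filt K n 1 := by
  simpa using zpow_sub_zpow_mem (v := 1) (by simpa using h) k

/-- This is the derivative of the k-th power at 1, valid in every characteristic. Raising k by one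
changes the error by (u^k - v^k)(u - 1) + (u - v)(v^k - 1), and both products lie one filtration
step deeper. -/
lemma zpow_sub_zpow_linear {n j : ℕ} {u v : (KPmod K n)ˣ} (hu : (u : KPmod K n) - 1 ∈ filt K n 1)
    (hv : (v : KPmod K n) - 1 ∈ filt K n 1) (h : (u : KPmod K n) - v ∈ filt K n j) (k : ℤ) :
    ((u ^ k : (KPmod K n)ˣ) : KPmod K n) - (v ^ k : (KPmod K n)ˣ) - k • ((u : KPmod K n) - v) ∈
      filt K n (j + 1) := by
  have step : ∀ k : ℤ, (((u ^ (k + 1) : (KPmod K n)ˣ) : KPmod K n) - (v ^ (k + 1) : (KPmod K n)ˣ)) -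
      (((u ^ k : (KPmod K n)ˣ) : KPmod K n) - (v ^ k : (KPmod K n)ˣ)) - ((u : KPmod K n) - v) ∈
        filt K n (j + 1) := by
    intro k
    have e : (((u ^ (k + 1) : (KPmod K n)ˣ) : KPmod K n) - (v ^ (k + 1) : (KPmod K n)ˣ)) -
      (((u ^ k : (KPmod K n)ˣ) : KPmod K n) - (v ^ k : (KPmod K n)ˣ)) - ((u : KPmod K n) - v) =
      (((u ^ k : (KPmod K n)ˣ) : KPmod K n) - (v ^ k : (KPmod K n)ˣ)) * ((u : KPmod K n) - 1) +
      ((u : KPmod K n) - v) * (((v ^ k : (KPmod K n)ˣ) : KPmod K n) - 1) := by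
      rw [zpow_add_one, zpow_add_one, Units.val_mul, Units.val_mul]; ring
    rw [e]
    exact Ideal.add_mem _ (filt_mul (zpow_sub_zpow_mem h k) hu)
      (filt_mul h (zpow_sub_one_mem hv k))
  induction k with
  | zero => simp
  | succ i ih =>
    have := Ideal.add_mem _ (step i) ih
    convert this using 1
    rw [add_smul, one_smul]; ring
  | pred i ih =>
    have := Ideal.sub_mem _ ih (step (-i - 1))
    convert this using 1
    rw [sub_smul, one_smul, sub_add_cancel]; ring

lemma cross_sub_mem {n j : ℕ} {u : (KPmod K n)ˣ} (hu : (u : KPmod K n) - 1 ∈ filt K n 1) (ν : M)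
    {a : KPmod K n} (ha : a ∈ filt K n j) : cross n u ν a - a ∈ filt K n (j + 1) := by
  refine mapsTo_filt_of_mono ((cross n u ν).toLinearMap - LinearMap.id) (fun p hp => ?_) ha
  change cross n u ν (mono K n p) - mono K n p ∈ _
  rw [cross_mono, ← sub_one_mul, add_comm]
  exact filt_mul (zpow_sub_one_mem hu _) (mono_mem_filt n hp)

lemma cross_sub_cross_mem {n i j : ℕ} {u v : (KPmod K n)ˣ}
    (h : (u : KPmod K n) - v ∈ filt K n j) (ν : M) {a : KPmod K n} (ha : a ∈ filt K n i) :
    cross n u ν a - cross n v ν a ∈ filt K n (j + i) := by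
  refine mapsTo_filt_of_mono ((cross n u ν).toLinearMap - (cross n v ν).toLinearMap)
    (fun p hp => ?_) ha
  change cross n u ν (mono K n p) - cross n v ν (mono K n p) ∈ _
  rw [cross_mono, cross_mono, ← sub_mul]
  exact filt_mul (zpow_sub_zpow_mem h _) (mono_mem_filt n hp)

@[simp] lemma compose_nil {X : Type*} [Semiring X] [Algebra K X] (A : ℝ → X →ₐ[K] X) :
    compose [] A = AlgHom.id K X := rfl

lemma compose_concat {X : Type*} [Semiring X] [Algebra K X] (T : List ℝ) (t : ℝ)
    (A : ℝ → X →ₐ[K] X) : compose (T ++ [t]) A = (A t).comp (compose T A) := by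
  simp [compose]

lemma compose_congr {X : Type*} [Semiring X] [Algebra K X] {T : List ℝ}
    {A B : ℝ → X →ₐ[K] X} (h : ∀ t ∈ T, A t = B t) : compose T A = compose T B :=
  List.foldl_ext _ _ _ fun acc t ht => by rw [h t ht]

/-- The first order difference of two compositions of wall crossings. -/
lemma compose_sub_compose {n k : ℕ} (T : List ℝ) (u v : ℝ → (KPmod K n)ˣ) (ν : ℝ → M)
    (hu : ∀ t ∈ T, (u t : KPmod K n) - 1 ∈ filt K n 1)
    (hv : ∀ t ∈ T, (v t : KPmod K n) - 1 ∈ filt K n 1)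
    (huv : ∀ t ∈ T, (u t : KPmod K n) - v t ∈ filt K n k) (m : M) :
    (compose T (fun t => cross n (u t) (ν t)) (mono K n (m, 0)) - mono K n (m, 0) ∈ filt K n 1) ∧
    (compose T (fun t => cross n (u t) (ν t)) (mono K n (m, 0)) -
      compose T (fun t => cross n (v t) (ν t)) (mono K n (m, 0)) ∈ filt K n k) ∧
    (compose T (fun t => cross n (u t) (ν t)) (mono K n (m, 0)) -
      compose T (fun t => cross n (v t) (ν t)) (mono K n (m, 0)) -
      (T.map fun t => (ν t ⬝ᵥ m) • ((u t : KPmod K n) - v t)).sum * mono K n (m, 0) ∈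
        filt K n (k + 1)) := by
  induction T using List.reverseRecOn with
  | nil => simp
  | append_singleton T t ih =>
    have hmem : ∀ s ∈ T, s ∈ T ++ [t] := fun s hs => List.mem_append_left _ hs
    have htm : t ∈ T ++ [t] := by simp
    obtain ⟨ih1, ih2, ih3⟩ := ih (fun s hs => hu s (hmem s hs)) (fun s hs => hv s (hmem s hs))
      (fun s hs => huv s (hmem s hs))
    set z := mono K n (m, 0) with hz
    rw [compose_concat, compose_concat, AlgHom.comp_apply, AlgHom.comp_apply]
    set b := compose T (fun t => cross n (u t) (ν t)) z with hb
    set b' := compose T (fun t => cross n (v t) (ν t)) z with hb'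
    have hz0 : z ∈ filt K n 0 := by simp
    have e1 := cross_sub_mem (hu t htm) (ν t) ih1
    have e2 := cross_sub_mem (hu t htm) (ν t) hz0
    have e3 := cross_sub_cross_mem (huv t htm) (ν t) ih1
    have e4 := cross_sub_mem (hv t htm) (ν t) ih2
    have e5 : cross n (u t) (ν t) z - cross n (v t) (ν t) z -
        ((ν t ⬝ᵥ m) • ((u t : KPmod K n) - v t)) * z ∈ filt K n (k + 1) := by
      rw [hz, cross_mono, cross_mono, ← sub_mul, ← sub_mul]
      exact Ideal.mul_mem_right _ _ (zpow_sub_zpow_linear (hu t htm) (hv t htm) (huv t htm) _)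
    have e6 := cross_sub_cross_mem (huv t htm) (ν t) hz0
    rw [map_sub] at e1 e4
    rw [map_sub, map_sub] at e3
    have hle := filt_mono (K := K) n (show 1 ≤ 1 + 1 by omega)
    have hle2 := filt_mono (K := K) n (show k ≤ k + 1 by omega)
    refine ⟨?_, ?_, ?_⟩
    · have := Ideal.add_mem _ (Ideal.add_mem _ (hle e1) e2) ih1
      convert this using 1; ring
    · have := Ideal.add_mem _ (Ideal.add_mem _ (Ideal.add_mem _ (hle2 e3) e6) (hle2 e4)) ih2
      convert this using 1; ring
    -- With A and B the crossings at t by u t and v t, the difference Ab - Bb' equals (A - B)(b - z)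
    -- + (A - B)z + (B - 1)(b - b') + (b - b'). The first and third terms are negligible, the second
    -- is the new summand, and the last is the induction hypothesis.
    · have := Ideal.add_mem _ (Ideal.add_mem _ (Ideal.add_mem _ e3 e5) e4) ih3
      convert this using 1
      rw [List.map_append, List.sum_append, List.map_singleton, List.sum_singleton]; ring

/-- If two compositions of wall crossings agree, then so do their differences to first order. -/
lemma sum_mem_of_compose_eq {n k : ℕ} (T : List ℝ) (u v : ℝ → (KPmod K n)ˣ) (ν : ℝ → M)
    (hu : ∀ t ∈ T, (u t : KPmod K n) - 1 ∈ filt K n 1)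
    (hv : ∀ t ∈ T, (v t : KPmod K n) - 1 ∈ filt K n 1)
    (huv : ∀ t ∈ T, (u t : KPmod K n) - v t ∈ filt K n k)
    (h : compose T (fun t => cross n (u t) (ν t)) = compose T (fun t => cross n (v t) (ν t)))
    (m : M) : (T.map fun t => (ν t ⬝ᵥ m) • ((u t : KPmod K n) - v t)).sum ∈ filt K n (k + 1) := by
  have h1 := (compose_sub_compose T u v ν hu hv huv m).2.2
  rw [h, sub_self, zero_sub, neg_mem_iff] at h1
  -- The monomial z^m is invertible, so it can be divided out.
  have h2 := Ideal.mul_mem_right (mono K n (-m, 0)) _ h1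
  rw [mul_assoc, ← mono_add] at h2
  have h3 : ((m, 0) + (-m, 0) : P) = 0 := by simp
  rwa [h3, mono_zero, mul_one] at h2

/-- The same linearization for products: all factors are 1 modulo the ideal, so the difference of
the products is the sum of the differences one order deeper. -/
lemma prod_sub_prod_linear {n k : ℕ} {ι : Type*} (s : Finset ι) (u v : ι → KPmod K n)
    (hu : ∀ i ∈ s, u i - 1 ∈ filt K n 1) (hv : ∀ i ∈ s, v i - 1 ∈ filt K n 1)
    (h : ∀ i ∈ s, u i - v i ∈ filt K n k) :
    (∏ i ∈ s, u i - 1 ∈ filt K n 1) ∧ (∏ i ∈ s, u i - ∏ i ∈ s, v i ∈ filt K n k) ∧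
    ∏ i ∈ s, u i - ∏ i ∈ s, v i - ∑ i ∈ s, (u i - v i) ∈ filt K n (k + 1) := by
  classical
  induction s using Finset.induction_on with
  | empty => simp
  | insert a s ha ih =>
    obtain ⟨ih1, ih2, ih3⟩ := ih (fun i hi => hu i (Finset.mem_insert_of_mem hi))
      (fun i hi => hv i (Finset.mem_insert_of_mem hi))
      (fun i hi => h i (Finset.mem_insert_of_mem hi))
    have ham := Finset.mem_insert_self a s
    rw [Finset.prod_insert ha, Finset.prod_insert ha, Finset.sum_insert ha]
    set U := ∏ i ∈ s, u i
    set V := ∏ i ∈ s, v i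
    have e1 := filt_mul (h a ham) ih1
    have e2 := filt_mul ih2 (hv a ham)
    have hle2 := filt_mono (K := K) n (show k ≤ k + 1 by omega)
    refine ⟨?_, ?_, ?_⟩
    · have := Ideal.add_mem _ (Ideal.mul_mem_left _ (u a) ih1) (hu a ham)
      convert this using 1; ring
    · have := Ideal.add_mem _ (Ideal.mul_mem_right U _ (h a ham)) (Ideal.mul_mem_left _ (v a) ih2)
      convert this using 1; ring
    · have := Ideal.add_mem _ (Ideal.add_mem _ e1 e2) ih3
      convert this using 1; ring

lemma IsWall.truncUnit_sub_one_mem {d : Wall K} (hd : IsWall d) (n : ℕ) :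
    (truncUnit n d.func : KPmod K n) - 1 ∈ filt K n 1 := by
  rw [val_truncUnit hd.func_one]; exact trunc_sub_one_mem hd.func_one n

lemma prodAt_sub_one_mem {D : Finset (Wall K)} (hD : ∀ d ∈ D, IsWall d) (n : ℕ) (x : MR) :
    (prodAt D n x : KPmod K n) - 1 ∈ filt K n 1 := by
  classical
  rw [prodAt, Units.coe_prod]
  have h : ∀ d ∈ D.filter (fun d => x ∈ d.carrier),
      (truncUnit n d.func : KPmod K n) - 1 ∈ filt K n 1 := fun d hd =>
    (hD d (Finset.mem_filter.1 hd).1).truncUnit_sub_one_mem n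
  exact (prod_sub_prod_linear (k := 0) _ _ _ h h fun d _ => by simp).1

/-! ### Faces of an arrangement -/

lemma ev_neg (h : M × ℤ) (x : MR) : ev (-h) x = -ev h x := by
  simp [ev]; ring

lemma ev_affine (h : M × ℤ) (x y : MR) (δ : ℝ) :
    ev h (x + δ • (x - y)) = ev h x + δ * (ev h x - ev h y) := by
  rw [ev_add, dotProduct_smul, ev_sub_ev, smul_eq_mul]

open Classical in
/-- The affine functions cutting out the closed face of the arrangement `A` that contains `y` in
its interior. -/
noncomputable def faceFns (A : Finset (M × ℤ)) (y : MR) : Finset (M × ℤ) :=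
  (A.filter fun h => 0 ≤ ev h y) ∪ (A.filter fun h => ev h y ≤ 0).image fun h => -h

/-- The closed face of the arrangement `A` that contains `y` in its interior. -/
noncomputable def face (A : Finset (M × ℤ)) (y : MR) : Set MR := poly (faceFns A y)

lemma mem_face {A : Finset (M × ℤ)} {y x : MR} :
    x ∈ face A y ↔ ∀ h ∈ A, (0 ≤ ev h y → 0 ≤ ev h x) ∧ (ev h y ≤ 0 → ev h x ≤ 0) := by
  classical
  simp only [face, poly, faceFns, Set.mem_ofPred_eq, Finset.mem_union, Finset.mem_filter,
    Finset.mem_image]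
  constructor
  · intro H h hA
    refine ⟨fun h1 => H h (Or.inl ⟨hA, h1⟩), fun h1 => ?_⟩
    have := H (-h) (Or.inr ⟨h, ⟨hA, h1⟩, rfl⟩)
    rw [ev_neg] at this
    linarith
  · rintro H h (⟨h1, h2⟩ | ⟨k, ⟨h1, h2⟩, rfl⟩)
    · exact (H h h1).1 h2
    · rw [ev_neg]
      have := (H k h1).2 h2
      linarith

lemma self_mem_face (A : Finset (M × ℤ)) (y : MR) : y ∈ face A y :=
  mem_face.2 fun _ _ => ⟨id, id⟩

lemma ev_eq_zero_of_mem_face {A : Finset (M × ℤ)} {y x : MR} (hx : x ∈ face A y) {h : M × ℤ}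
    (hA : h ∈ A) (h0 : ev h y = 0) : ev h x = 0 :=
  le_antisymm ((mem_face.1 hx h hA).2 h0.le) ((mem_face.1 hx h hA).1 h0.ge)

lemma face_subset_poly {A H : Finset (M × ℤ)} (hH : H ⊆ A) {y : MR} (hy : y ∈ poly H) :
    face A y ⊆ poly H := fun _ hx h hh => (mem_face.1 hx h (hH hh)).1 (hy h hh)

lemma direction_face_le {A : Finset (M × ℤ)} {y : MR} {h : M × ℤ} (hA : h ∈ A)
    (h0 : ev h y = 0) {u : MR} (hu : u ∈ (affineSpan ℝ (face A y)).direction) :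
    toReal h.1 ⬝ᵥ u = 0 := by
  refine mem_ker_dot.1 (direction_le_ker (fun a ha b hb => ?_) hu)
  have h1 := ev_eq_zero_of_mem_face ha hA h0
  have h2 := ev_eq_zero_of_mem_face hb hA h0
  simp only [ev] at h1 h2
  linarith

lemma eventually_mem_face {A : Finset (M × ℤ)} (y : MR) :
    ∀ᶠ x in 𝓝 y, (∀ h ∈ A, ev h y = 0 → ev h x = 0) → x ∈ face A y := by
  filter_upwards [eventually_sign A y] with x hx h2
  refine mem_face.2 fun h hA => ⟨fun h3 => ?_, fun h3 => ?_⟩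
  · rcases h3.lt_or_eq with h4 | h4
    · exact ((hx h hA).1 h4).le
    · exact (h2 h hA h4.symm).ge
  · rcases h3.lt_or_eq with h4 | h4
    · exact ((hx h hA).2 h4).le
    · exact (h2 h hA h4).le

lemma mem_intrinsicInterior_face (A : Finset (M × ℤ)) (y : MR) :
    y ∈ intrinsicInterior ℝ (face A y) := by
  have hys := subset_affineSpan ℝ _ (self_mem_face A y)
  rw [mem_intrinsicInterior]
  refine ⟨⟨y, hys⟩, ?_, rfl⟩
  rw [mem_interior_iff_mem_nhds, mem_nhds_subtype]
  refine ⟨_, eventually_mem_face (A := A) y, ?_⟩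
  rintro ⟨x, hx⟩ hx2
  refine hx2 fun h hA h0 => ?_
  have h1 := AffineSubspace.vsub_mem_direction hx hys
  have h2 := direction_face_le hA h0 h1
  rw [vsub_eq_sub, ← ev_sub_ev, h0, sub_zero] at h2
  exact h2

lemma exists_extension {s : Set MR} {x y : MR} (hx : x ∈ intrinsicInterior ℝ s) (hy : y ∈ s) :
    ∃ δ : ℝ, 0 < δ ∧ x + δ • (x - y) ∈ s := by
  obtain ⟨⟨x, hxs⟩, hx', rfl⟩ := mem_intrinsicInterior.1 hx
  clear hx
  rename' hx' => hx
  rw [mem_interior_iff_mem_nhds, mem_nhds_subtype] at hx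
  obtain ⟨U, hU, hsub⟩ := hx
  obtain ⟨δ, hδ, h⟩ := exists_pos_of_eventually_add (u := x - y) (p := (· ∈ U)) hU
  refine ⟨δ / 2, by positivity, ?_⟩
  have h1 := h (δ / 2) (by rw [abs_of_pos (by positivity)]; linarith)
  have h2 : x + (δ / 2) • (x - y) ∈ affineSpan ℝ s := by
    have hd := AffineSubspace.vsub_mem_direction hxs (subset_affineSpan ℝ _ hy)
    have := AffineSubspace.vadd_mem_of_mem_direction (Submodule.smul_mem _ (δ / 2) hd) hxs
    rwa [vsub_eq_sub, vadd_eq_add, add_comm] at this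
  exact hsub (show (⟨_, h2⟩ : affineSpan ℝ s) ∈ _ from h1)

/-- The segment from y to x can be prolonged beyond x inside the face. A function negative at y is
nonpositive on the whole face; were it nonnegative at x, it would be positive on the prolongation.
-/
lemma mem_poly_of_mem_interior_face {A H : Finset (M × ℤ)} (hH : H ⊆ A) {x y : MR}
    (hx : x ∈ intrinsicInterior ℝ (face A y)) (hxH : x ∈ poly H) : y ∈ poly H := by
  obtain ⟨δ, hδ, h1⟩ := exists_extension hx (self_mem_face A y)
  intro h hh
  by_contra hlt
  push Not at hlt
  have h2 := (mem_face.1 h1 h (hH hh)).2 hlt.le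
  have h3 := hxH h hh
  rw [ev_affine] at h2
  nlinarith

/-- A wall is singular along the whole face if it is so at an interior point. -/
lemma mem_frontier_of_mem_face {d : Wall K} (hd : IsWall d) {A H : Finset (M × ℤ)} (hH : H ⊆ A)
    (hdH : d.carrier = poly H) {x y : MR} (hx : x ∈ face A y)
    (hy : y ∈ intrinsicFrontier ℝ d.carrier) : x ∈ intrinsicFrontier ℝ d.carrier := by
  have hyd : y ∈ d.carrier := intrinsicFrontier_subset hd.isClosed hy
  have hsub : face A y ⊆ d.carrier := by rw [hdH] at hyd ⊢; exact face_subset_poly hH hyd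
  obtain ⟨ν, hν, -, -⟩ := hd.exists_normal
  by_contra hcon
  rw [hd.notMem_frontier_iff hν (hsub hx)] at hcon
  refine (hd.notMem_frontier_iff hν hyd).2 ?_ hy
  obtain ⟨δ, hδ, h1⟩ := exists_extension (mem_intrinsicInterior_face A y) hx
  -- A point z of the plane near y is the convex combination, with weights 1/(1+δ) and δ/(1+δ), of y
  -- + δ(y - x) and of x + ((1+δ)/δ)(z - y). The former lies in the face and the latter is close to
  -- x, so the wall fills the plane near y if it does so near x.
  have hc : Tendsto (fun z : MR => x + ((1 + δ) / δ) • (z - y)) (𝓝 y) (𝓝 x) := by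
    have : Continuous fun z : MR => x + ((1 + δ) / δ) • (z - y) := by fun_prop
    simpa using this.tendsto y
  filter_upwards [hc.eventually hcon] with z hz hz2
  have h2 : x + ((1 + δ) / δ) • (z - y) ∈ d.carrier := hz (by
    rw [dotProduct_add, dotProduct_smul, dotProduct_sub, hz2, sub_self, smul_zero, add_zero])
  have h3 := hsub h1
  rw [hdH] at h2 h3 ⊢
  intro h hh
  have h4 := h2 h hh
  have h5 := h3 h hh
  rw [ev_affine] at h5
  rw [ev_add, dotProduct_smul, ← ev_sub_ev, smul_eq_mul] at h4
  have h6 : 0 ≤ δ * (ev h x + (1 + δ) / δ * (ev h z - ev h y)) := by positivity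
  have h7 : δ * (ev h x + (1 + δ) / δ * (ev h z - ev h y)) =
      δ * ev h x + (1 + δ) * (ev h z - ev h y) := by field_simp
  rw [h7] at h6
  have h8 : 0 ≤ (1 + δ) * ev h z := by linarith
  exact nonneg_of_mul_nonneg_right h8 (by linarith)

/-! ### Joint cells and triviality of small loops -/

lemma exists_indep_of_not_gen {A : Finset (M × ℤ)} {y : MR} (h : ¬ Gen A y) :
    ∃ h₁ ∈ A, ∃ h₂ ∈ A, ev h₁ y = 0 ∧ ev h₂ y = 0 ∧ toReal h₁.1 ⨯₃ toReal h₂.1 ≠ 0 := by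
  simp only [Gen, not_exists, not_forall] at h
  obtain ⟨h₁, hA₁, h01, hn⟩ := h 0
  have hne : toReal h₁.1 ≠ 0 := fun h2 => hn 0 (by simp [h2])
  obtain ⟨h₂, hA₂, h02, hn2⟩ := h (toReal h₁.1)
  refine ⟨h₁, hA₁, h₂, hA₂, h01, h02, fun hc => ?_⟩
  obtain ⟨r, hr⟩ := exists_smul_of_cross_eq_zero (h := toReal h₂.1) hne
    (by rw [← cross_anticomm, hc, neg_zero])
  exact hn2 r hr

/-- A singular point at which all vanishing affine functions are constant along a line lies in the
interior of a joint cell. -/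
lemma exists_isJointCell {D : Finset (Wall K)} (hD : ∀ d ∈ D, IsWall d) {A : Finset (M × ℤ)}
    (hA : PresentedBy D A) {y w : MR} (hw : w ≠ 0)
    (hyw : ∀ h ∈ A, ev h y = 0 → toReal h.1 ⬝ᵥ w = 0) (hy : y ∈ Sing (D : Set (Wall K))) :
    IsJointCell (D : Set (Wall K)) (face A y) := by
  have hgen : ¬ Gen A y := fun h => by
    obtain ⟨ν, hp⟩ := h.exists_locPlanar hD hA
    exact hp.notMem_sing hD hy
  obtain ⟨h₁, hA₁, h₂, hA₂, h01, h02, hc⟩ := exists_indep_of_not_gen hgen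
  refine ⟨(isRationalPolyhedron_iff _).2 ⟨_, rfl⟩, ?_, ?_, ?_⟩
  · have hwd : w ∈ (affineSpan ℝ (face A y)).direction := by
      obtain ⟨δ, hδ, h⟩ := exists_pos_of_eventually_add (u := w) (eventually_mem_face (A := A) y)
      refine mem_direction_of_add_mem (δ := δ / 2) (by positivity) (self_mem_face A y) (h _ ?_ ?_)
      · rw [abs_of_pos (by positivity)]; linarith
      · intro k hk hk0
        rw [ev_add, dotProduct_smul, hyw k hk hk0, hk0]; simp
    -- Two independent functions vanish on the face, so its direction is at most a line; it contains
    -- w, so it is exactly that line.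
    have hline : ∀ u ∈ (affineSpan ℝ (face A y)).direction,
        ∃ r : ℝ, u = r • (toReal h₁.1 ⨯₃ toReal h₂.1) := fun u hu =>
      exists_smul_cross hc (by rw [dotProduct_comm]; exact direction_face_le hA₁ h01 hu)
        (by rw [dotProduct_comm]; exact direction_face_le hA₂ h02 hu)
    have : (affineSpan ℝ (face A y)).direction = Submodule.span ℝ {w} := by
      apply le_antisymm
      · intro u hu
        obtain ⟨r, hr⟩ := hline u hu
        obtain ⟨r', hr'⟩ := hline w hwd
        have hr0 : r' ≠ 0 := by rintro rfl; exact hw (by simpa using hr')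
        rw [Submodule.mem_span_singleton]
        refine ⟨r / r', ?_⟩
        rw [hr', smul_smul, div_mul_cancel₀ _ hr0, ← hr]
      · rw [Submodule.span_singleton_le_iff_mem]; exact hwd
    rw [dim, this, finrank_span_singleton hw]
  · intro x hx
    rcases hy with ⟨d, hd, hyd⟩ | ⟨d, hd, d', hd', hdim, hyd, hyd'⟩
    · obtain ⟨H, hHA, hH⟩ := hA d hd
      exact Or.inl ⟨d, hd, mem_frontier_of_mem_face (hD d hd) hHA hH hx hyd⟩
    · refine Or.inr ⟨d, hd, d', hd', hdim, ?_, ?_⟩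
      · obtain ⟨H, hHA, hH⟩ := hA d hd
        rw [hH] at hyd ⊢
        exact face_subset_poly hHA hyd hx
      · obtain ⟨H, hHA, hH⟩ := hA d' hd'
        rw [hH] at hyd' ⊢
        exact face_subset_poly hHA hyd' hx
  · intro x hx x' hx' d hd
    obtain ⟨H, hHA, hH⟩ := hA d hd
    rw [hH]
    exact ⟨fun h => face_subset_poly hHA (mem_poly_of_mem_interior_face hHA hx h)
        (intrinsicInterior_subset hx'),
      fun h => face_subset_poly hHA (mem_poly_of_mem_interior_face hHA hx' h)
        (intrinsicInterior_subset hx)⟩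

/-- The path-ordered products along small loops at `y` are trivial. -/
def LoopTrivialAt (D : Set (Wall K)) (n : ℕ) (y : MR) : Prop :=
  ∃ U ∈ 𝓝 y, ∀ γ : ℝ → MR, IsAdmissible D γ → γ 0 = γ 1 →
    (∀ t ∈ Set.Icc (0 : ℝ) 1, γ t ∈ U) →
    ∀ θ, IsPathOrderedProduct D n γ θ → θ = AlgHom.id K (KPmod K n)

/-- Small loops at points off the singular locus are trivial. -/
lemma LocPlanar.loopTrivialAt {D : Finset (Wall K)} (hD : ∀ d ∈ D, IsWall d) (n : ℕ) {y : MR}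
    {ν : M} (hp : LocPlanar (D : Set (Wall K)) y ν) : LoopTrivialAt (D : Set (Wall K)) n y := by
  classical
  obtain ⟨V, hVsub, hVo, hyV⟩ := eventually_nhds_iff.1 (hp.eventually_mem_iff hD)
  refine ⟨V, hVo.mem_nhds hyV, fun γ hγ hloop hγV θ hθ => ?_⟩
  have hVsub' : ∀ x ∈ V, ∀ d ∈ D,
      (x ∈ d.carrier ↔ y ∈ d.carrier ∧ toReal ν ⬝ᵥ x = toReal ν ⬝ᵥ y) := fun x hx => hVsub x hx
  have hmem := prodAt_mem hD n (x := y) fun d hd hx => (hp d hd hx).1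
  -- Near y all walls fill one plane, so the potential is the identity on its positive side and the
  -- single crossing on the other. If no wall passes through y, the crossing is by 1 and nothing
  -- jumps.
  let Φ : MR → KPmod K n →ₐ[K] KPmod K n := fun x =>
    if toReal ν ⬝ᵥ y < toReal ν ⬝ᵥ x then AlgHom.id K _ else cross n (prodAt D n y) ν
  refine eq_id_of_potential D hD hγ hloop hθ Φ (fun t ht => ⟨fun hno => ?_, ?_⟩) ?_
  · have hcont := (continuous_dot (toReal ν)).continuousAt (x := γ t)
    by_cases hex : ∃ d ∈ D, y ∈ d.carrier
    · obtain ⟨d, hd, hyd⟩ := hex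
      have hne : toReal ν ⬝ᵥ γ t ≠ toReal ν ⬝ᵥ y := fun h =>
        hno d hd ((hVsub' _ (hγV t ht) d hd).2 ⟨hyd, h⟩)
      rcases lt_or_gt_of_ne hne with h | h
      · filter_upwards [hcont.eventually_lt continuousAt_const h] with x hx
        simp only [Φ, if_neg hx.not_gt, if_neg h.not_gt]
      · filter_upwards [continuousAt_const.eventually_lt hcont h] with x hx
        simp only [Φ, if_pos hx, if_pos h]
    · push Not at hex
      refine Filter.Eventually.of_forall fun x => ?_
      simp only [Φ, prodAt_eq_one hex, cross_one, ite_self]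
  · rintro ⟨d, hd, hxd⟩
    obtain ⟨hyd, hxy⟩ := (hVsub' _ (hγV t ht) d hd).1 hxd
    refine ⟨d, hd, hxd, ν, (hp d hd hyd).1, AlgHom.id K _, cross n (prodAt D n y) ν, ?_, ?_⟩
    · rw [AlgHom.comp_id]
      congr 1
      refine prodAt_congr fun e he => ?_
      rw [hVsub' _ (hγV t ht) e he, and_iff_left hxy]
    · refine Filter.Eventually.of_forall fun x => ⟨fun h => ?_, fun h => ?_⟩
      · rw [hxy] at h
        simp only [Φ, if_pos h]
      · rw [hxy] at h
        simp only [Φ, if_neg h.not_gt]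
  · by_cases h : toReal ν ⬝ᵥ y < toReal ν ⬝ᵥ γ 0
    · simp only [Φ, if_pos h]; exact Function.surjective_id
    · simp only [Φ, if_neg h]; exact (cross_bijective _ hmem).2

/-- A singular point y is interior to the joint cell given by its face of the arrangement; other
points are locally planar. The direction w excludes points of codimension three, about which
consistency says nothing. -/
lemma IsConsistent.loopTrivialAt {D : Set (Wall K)} (hD : ∀ d ∈ D, IsWall d)
    (hc : IsConsistent D) {n : ℕ} {Dn : Finset (Wall K)} (hDn : (Dn : Set (Wall K)) = atOrder D n)
    {A : Finset (M × ℤ)} (hA : PresentedBy Dn A) {y w : MR} (hw : w ≠ 0)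
    (hyw : ∀ h ∈ A, ev h y = 0 → toReal h.1 ⬝ᵥ w = 0) :
    LoopTrivialAt (Dn : Set (Wall K)) n y := by
  have hDn' : ∀ d ∈ Dn, IsWall d := fun d hd => hD d (by
    have : d ∈ (Dn : Set (Wall K)) := hd
    rw [hDn] at this
    exact this.1)
  by_cases hy : y ∈ Sing (Dn : Set (Wall K))
  · have hj := exists_isJointCell hDn' hA hw hyw hy
    rw [hDn] at hj ⊢
    exact hc n _ hj y (mem_intrinsicInterior_face A y)
  · obtain ⟨ν, hp⟩ := exists_locPlanar hDn' hy
    exact hp.loopTrivialAt hDn' n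

section Circles

open Real

/-! ### Small circles around a joint -/

/-- An ellipse around `y`, based at `y + ε u`. -/
noncomputable def circ (y u r : MR) (ε s : ℝ) : MR :=
  y + ε • (cos (2 * π * s) • u + sin (2 * π * s) • r)

lemma dot_circ (c y u r : MR) (ε s : ℝ) :
    c ⬝ᵥ circ y u r ε s =
      c ⬝ᵥ y + ε * (cos (2 * π * s) * (c ⬝ᵥ u) + sin (2 * π * s) * (c ⬝ᵥ r)) := by
  simp [circ, dotProduct_add, dotProduct_smul]
  ring

lemma ev_circ (h : M × ℤ) (y u r : MR) (ε s : ℝ) :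
    ev h (circ y u r ε s) = ev h y +
      ε * (cos (2 * π * s) * (toReal h.1 ⬝ᵥ u) + sin (2 * π * s) * (toReal h.1 ⬝ᵥ r)) := by
  rw [ev, dot_circ, ev]; ring

lemma circ_zero (y u r : MR) (ε : ℝ) : circ y u r ε 0 = circ y u r ε 1 := by
  simp [circ]

lemma circ_quarter (y u r : MR) (ε : ℝ) : circ y u r ε (1 / 4) = y + ε • r := by
  have : 2 * π * (1 / 4) = π / 2 := by ring
  rw [circ, this]
  simp

lemma sin_three_quarter : sin (2 * π * (3 / 4)) = -1 := by
  have : 2 * π * (3 / 4) = π / 2 + π := by ring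
  rw [this, sin_add_pi, sin_pi_div_two]

lemma cos_three_quarter : cos (2 * π * (3 / 4)) = 0 := by
  have : 2 * π * (3 / 4) = π / 2 + π := by ring
  rw [this, cos_add_pi, cos_pi_div_two, neg_zero]

lemma circ_three_quarter (y u r : MR) (ε : ℝ) : circ y u r ε (3 / 4) = y - ε • r := by
  rw [circ, sin_three_quarter, cos_three_quarter]
  simp [sub_eq_add_neg]

lemma eventually_circ_mem {y u r : MR} {V : Set MR} (hV : V ∈ 𝓝 y) :
    ∀ᶠ ε in 𝓝[>] (0 : ℝ), ∀ s, circ y u r ε s ∈ V := by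
  obtain ⟨δ, hδ, hsub⟩ := Metric.mem_nhds_iff.1 hV
  have h1 : ∀ᶠ ε in 𝓝[>] (0 : ℝ), ε * (‖u‖ + ‖r‖) < δ := by
    have : Tendsto (fun ε : ℝ => ε * (‖u‖ + ‖r‖)) (𝓝 0) (𝓝 0) := by
      have : Continuous fun ε : ℝ => ε * (‖u‖ + ‖r‖) := by fun_prop
      simpa using this.tendsto 0
    exact nhdsWithin_le_nhds (this.eventually (Iio_mem_nhds hδ))
  filter_upwards [h1, self_mem_nhdsWithin] with ε h2 hε s
  apply hsub
  have hε' : (0 : ℝ) < ε := hε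
  rw [Metric.mem_ball, dist_eq_norm, circ, add_sub_cancel_left, norm_smul, norm_eq_abs,
    abs_of_pos hε']
  refine lt_of_le_of_lt (mul_le_mul_of_nonneg_left ?_ hε'.le) h2
  refine (norm_add_le _ _).trans (add_le_add ?_ ?_)
  · rw [norm_smul]
    exact mul_le_of_le_one_left (norm_nonneg _) (abs_cos_le_one _)
  · rw [norm_smul]
    exact mul_le_of_le_one_left (norm_nonneg _) (abs_sin_le_one _)

lemma contDiff_circ (y u r : MR) (ε : ℝ) : ContDiff ℝ (⊤ : ℕ∞) (circ y u r ε) := by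
  unfold circ
  fun_prop

lemma isPiecewiseSmooth_circ (y u r : MR) (ε : ℝ) : IsPiecewiseSmooth (circ y u r ε) :=
  ⟨(contDiff_circ y u r ε).continuous.continuousOn, ∅, fun _ _ _ _ _ _ =>
    (contDiff_circ y u r ε).contDiffOn⟩

/-- The vectors `w, u, r` form a basis, all affine functions of `A` vanishing at `y` are constant in
the direction `w` and nonconstant in the direction `u`, and the circle stays close to `y`. -/
structure IsCircle (A : Finset (M × ℤ)) (y w u r : MR) (ε : ℝ) : Prop where
  pos : 0 < ε
  vanish : ∀ h ∈ A, ev h y = 0 → toReal h.1 ⬝ᵥ w = 0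
  generic : ∀ h ∈ A, h.1 ≠ 0 → toReal h.1 ⬝ᵥ u ≠ 0
  basis : w ⬝ᵥ (u ⨯₃ r) ≠ 0
  persist : ∀ s, ∀ h ∈ A, (0 < ev h y → 0 < ev h (circ y u r ε s)) ∧
    (ev h y < 0 → ev h (circ y u r ε s) < 0)

namespace IsCircle

variable {A : Finset (M × ℤ)} {y w u r : MR} {ε : ℝ}

lemma cross_ne_zero (hC : IsCircle A y w u r ε) (s : ℝ) : w ⨯₃ (cos (2 * π * s) • u + sin (2 * π * s) • r) ≠ 0 := by
  intro h
  apply hC.basis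
  set c := cos (2 * π * s)
  set e := sin (2 * π * s)
  have hce : e ^ 2 + c ^ 2 = 1 := sin_sq_add_cos_sq _
  -- Pairing with the tangent vector of the ellipse gives (c² + e²) det(w, u, r), so the determinant
  -- would vanish.
  have h2 : (w ⨯₃ (c • u + e • r)) ⬝ᵥ (-e • u + c • r) = 0 := by rw [h, zero_dotProduct]
  simp only [cross_apply, Matrix.vec3_dotProduct, Pi.add_apply, Pi.smul_apply, smul_eq_mul,
    Matrix.cons_val_zero, Matrix.cons_val_one, Matrix.cons_val] at h2 ⊢
  linear_combination h2 - (w 0 * (u 1 * r 2 - u 2 * r 1) + w 1 * (u 2 * r 0 - u 0 * r 2) +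
    w 2 * (u 0 * r 1 - u 1 * r 0)) * hce

lemma active (hC : IsCircle A y w u r ε) {s : ℝ} {h : M × ℤ} (hA : h ∈ A) (h0 : ev h (circ y u r ε s) = 0) : ev h y = 0 := by
  obtain ⟨h1, h2⟩ := hC.persist s h hA
  rcases lt_trichotomy (ev h y) 0 with h3 | h3 | h3
  · linarith [h2 h3]
  · exact h3
  · linarith [h1 h3]

/-- A function vanishing at a point of the ellipse already vanishes at the centre. It is therefore
orthogonal both to w and to the radial vector, which leaves one line of covectors. -/
lemma gen (hC : IsCircle A y w u r ε) (s : ℝ) : Gen A (circ y u r ε s) := by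
  refine ⟨_, fun h hA h0 => exists_smul_cross (hC.cross_ne_zero s) ?_ ?_⟩
  · exact hC.vanish h hA (hC.active hA h0)
  · have h1 := ev_circ h y u r ε s
    rw [h0, hC.active hA h0, zero_add] at h1
    rw [dotProduct_add, dotProduct_smul, dotProduct_smul, smul_eq_mul, smul_eq_mul]
    exact (mul_eq_zero.1 h1.symm).resolve_left hC.pos.ne'

variable {W : Finset (Wall K)}

/-- The normal is a multiple of a nonconstant function of A vanishing on the wall, so it inherits
genericity with respect to u. In particular no wall passes through the base point y + ε u of the
loop. -/
lemma normal_eq (hC : IsCircle A y w u r ε) (hW : ∀ d ∈ W, IsWall d)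
    (hA : PresentedBy W A) {d : Wall K} (hd : d ∈ W) {s : ℝ} (hs : circ y u r ε s ∈ d.carrier) {ν : M}
    (hν : IsNormal d.carrier ν) : toReal ν ⬝ᵥ u ≠ 0 ∧ toReal ν ⬝ᵥ w = 0 ∧
      cos (2 * π * s) * (toReal ν ⬝ᵥ u) + sin (2 * π * s) * (toReal ν ⬝ᵥ r) = 0 := by
  obtain ⟨H, hHA, hH⟩ := hA d hd
  obtain ⟨k, hk, ⟨g, hg, hkg⟩, hk0⟩ := (hW d hd).exists_equation hν hH
  have hy := hC.active (hHA hk) (hk0 _ hs)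
  have h1 := hC.vanish k (hHA hk) hy
  have hkne : k.1 ≠ 0 := fun h => by
    rw [h, toReal_zero] at hkg
    exact (smul_ne_zero hg (toReal_ne_zero ((hW d hd).normal_ne_zero hν))) hkg.symm
  have h2 := hC.generic k (hHA hk) hkne
  have h3 := ev_circ k y u r ε s
  rw [hk0 _ hs, hy, zero_add] at h3
  rw [hkg] at h1 h2 h3
  simp only [smul_dotProduct, smul_eq_mul] at h1 h2 h3
  refine ⟨fun h => h2 (by rw [h, mul_zero]), (mul_eq_zero.1 h1).resolve_left hg, ?_⟩
  have h4 : ε * g * (cos (2 * π * s) * (toReal ν ⬝ᵥ u) + sin (2 * π * s) * (toReal ν ⬝ᵥ r)) = 0 := by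
    rw [h3]; ring
  exact (mul_eq_zero.1 h4).resolve_left (mul_ne_zero hC.pos.ne' hg)

lemma crossesAt (hC : IsCircle A y w u r ε) (hW : ∀ d ∈ W, IsWall d)
    (hA : PresentedBy W A) {d : Wall K} (hd : d ∈ W) {s : ℝ} (hsI : s ∈ Set.Icc (0 : ℝ) 1)
    (hs : circ y u r ε s ∈ d.carrier) {ν : M} (hν : IsNormal d.carrier ν)
    (hneg : -sin (2 * π * s) * (toReal ν ⬝ᵥ u) + cos (2 * π * s) * (toReal ν ⬝ᵥ r) < 0) :
    CrossesAt (circ y u r ε) d s ν := by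
  obtain ⟨h1, -, h2⟩ := hC.normal_eq hW hA hd hs hν
  set a := toReal ν ⬝ᵥ u
  set b := toReal ν ⬝ᵥ r
  have hs0 : s ≠ 0 := by
    rintro rfl
    simp at h2
    exact h1 h2
  have hs1 : s ≠ 1 := by
    rintro rfl
    simp at h2
    exact h1 h2
  have hs0' : 0 < s := lt_of_le_of_ne hsI.1 hs0.symm
  have hs1' : s < 1 := lt_of_le_of_ne hsI.2 hs1
  -- Along the ellipse the ν-value is sinusoidal with a zero of its variation at s, so it is a
  -- multiple of sin(2π(s' - s)); the factor is, up to 2π, the derivative at s.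
  have key : ∀ s', toReal ν ⬝ᵥ circ y u r ε s' - toReal ν ⬝ᵥ circ y u r ε s =
      ε * ((-sin (2 * π * s) * a + cos (2 * π * s) * b) * sin (2 * π * s' - 2 * π * s)) := by
    intro s'
    rw [dot_circ, dot_circ, h2, sin_sub]
    have hce := sin_sq_add_cos_sq (2 * π * s)
    linear_combination (-ε * (sin (2 * π * s') * b + cos (2 * π * s') * a)) * hce +
      ε * (sin (2 * π * s) * sin (2 * π * s') + cos (2 * π * s) * cos (2 * π * s')) * h2
  -- The bound 1/4 keeps 2π(s' - s) where the sine has the sign of its argument; the other bound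
  -- keeps the interval inside [0,1].
  refine ⟨hs, hν, min (1 / 4) (min s (1 - s)), by
    refine lt_min (by norm_num) (lt_min hs0' (by linarith)), ?_, ?_, ?_, ?_⟩
  · linarith [(min_le_right (1 / 4) (min s (1 - s))).trans (min_le_left _ _)]
  · linarith [(min_le_right (1 / 4) (min s (1 - s))).trans (min_le_right _ _)]
  · intro s' hs'
    have h3 := min_le_left (1 / 4) (min s (1 - s))
    have h4 : sin (2 * π * s' - 2 * π * s) < 0 := by
      apply sin_neg_of_neg_of_neg_pi_lt
      · nlinarith [pi_pos, hs'.2]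
      · nlinarith [pi_pos, hs'.1]
    have := mul_pos hC.pos (mul_pos_of_neg_of_neg hneg h4)
    linarith [key s']
  · intro s' hs'
    have h3 := min_le_left (1 / 4) (min s (1 - s))
    have h4 : 0 < sin (2 * π * s' - 2 * π * s) := by
      apply sin_pos_of_pos_of_lt_pi
      · nlinarith [pi_pos, hs'.1]
      · nlinarith [pi_pos, hs'.2]
    have := mul_neg_of_pos_of_neg hC.pos (mul_neg_of_neg_of_pos hneg h4)
    linarith [key s']

lemma exists_crossesAt (hC : IsCircle A y w u r ε) (hW : ∀ d ∈ W, IsWall d)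
    (hA : PresentedBy W A) {d : Wall K} (hd : d ∈ W) {s : ℝ} (hsI : s ∈ Set.Icc (0 : ℝ) 1)
    (hs : circ y u r ε s ∈ d.carrier) : ∃ ν, CrossesAt (circ y u r ε) d s ν := by
  obtain ⟨ν, hν, -, -⟩ := (hW d hd).exists_normal
  obtain ⟨h1, -, h2⟩ := hC.normal_eq hW hA hd hs hν
  rcases lt_trichotomy (-sin (2 * π * s) * (toReal ν ⬝ᵥ u) + cos (2 * π * s) * (toReal ν ⬝ᵥ r)) 0
    with h | h | h
  · exact ⟨ν, hC.crossesAt hW hA hd hsI hs hν h⟩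
  · exfalso
    apply h1
    have hce := sin_sq_add_cos_sq (2 * π * s)
    linear_combination (-(toReal ν ⬝ᵥ u)) * hce + cos (2 * π * s) * h2 - sin (2 * π * s) * h
  · refine ⟨-ν, hC.crossesAt hW hA hd hsI hs hν.neg ?_⟩
    rw [toReal_neg, neg_dotProduct, neg_dotProduct]
    linarith

lemma admissible (hC : IsCircle A y w u r ε) (hW : ∀ d ∈ W, IsWall d)
    (hA : PresentedBy W A) : IsAdmissible (W : Set (Wall K)) (circ y u r ε) where
  smooth := isPiecewiseSmooth_circ y u r ε
  avoids t _ := by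
    obtain ⟨ν, hp⟩ := (hC.gen t).exists_locPlanar hW hA
    exact hp.notMem_sing hW
  transversal t ht _ hd hx := hC.exists_crossesAt hW hA hd ht hx

lemma finite_times (hC : IsCircle A y w u r ε) (hW : ∀ d ∈ W, IsWall d)
    (hA : PresentedBy W A) : {t ∈ Set.Icc (0 : ℝ) 1 | ∃ d ∈ W, circ y u r ε t ∈ d.carrier}.Finite := by
  have : {t ∈ Set.Icc (0 : ℝ) 1 | ∃ d ∈ W, circ y u r ε t ∈ d.carrier} ⊆
      ⋃ d ∈ W, {t ∈ Set.Icc (0 : ℝ) 1 | circ y u r ε t ∈ d.carrier} := by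
    rintro t ⟨ht, d, hd, hx⟩
    exact Set.mem_biUnion hd ⟨ht, hx⟩
  refine (Set.Finite.biUnion W.finite_toSet fun d hd => ?_).subset this
  rcases Set.eq_empty_or_nonempty {t ∈ Set.Icc (0 : ℝ) 1 | circ y u r ε t ∈ d.carrier} with h | h
  · rw [h]; exact Set.finite_empty
  obtain ⟨s, hsI, hs⟩ := h
  obtain ⟨ν, hν, -, -⟩ := (hW d hd).exists_normal
  obtain ⟨h1, -, h2⟩ := hC.normal_eq hW hA hd hs hν
  -- A plane is met only at times differing by half-integers, and both times lie in [0,1], so twice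
  -- their difference is an integer between -2 and 2.
  refine ((Set.finite_Icc (-2 : ℤ) 2).image fun k : ℤ => s + k / 2).subset ?_
  rintro t ⟨htI, ht⟩
  obtain ⟨-, -, h3⟩ := hC.normal_eq hW hA hd ht hν
  set a := toReal ν ⬝ᵥ u
  set b := toReal ν ⬝ᵥ r
  have h4 : sin (2 * π * t - 2 * π * s) = 0 := by
    rw [sin_sub]
    have h5 : a * (sin (2 * π * t) * cos (2 * π * s) - cos (2 * π * t) * sin (2 * π * s)) = 0 := by
      linear_combination sin (2 * π * t) * h2 - sin (2 * π * s) * h3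
    exact (mul_eq_zero.1 h5).resolve_left h1
  obtain ⟨k, hk⟩ := sin_eq_zero_iff.1 h4
  have h5 : (k : ℝ) = 2 * t - 2 * s := by
    have : π * (k : ℝ) = π * (2 * t - 2 * s) := by linarith
    exact mul_left_cancel₀ pi_ne_zero this
  refine ⟨k, ⟨?_, ?_⟩, ?_⟩
  · have : (-2 : ℝ) ≤ k := by rw [h5]; linarith [htI.1, hsI.2]
    exact_mod_cast this
  · have : (k : ℝ) ≤ 2 := by rw [h5]; linarith [htI.2, hsI.1]
    exact_mod_cast this
  · change s + (k : ℝ) / 2 = t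
    rw [h5]; ring

end IsCircle

/-! ### Comparing two wall structures along a small circle -/

lemma Sing_mono {D D' : Set (Wall K)} (h : D' ⊆ D) : Sing D' ⊆ Sing D := by
  rintro x (⟨d, hd, hx⟩ | ⟨d, hd, d', hd', hx⟩)
  · exact Or.inl ⟨d, h hd, hx⟩
  · exact Or.inr ⟨d, h hd, d', h hd', hx⟩

lemma IsAdmissible.mono {D D' : Set (Wall K)} (h : D' ⊆ D) {γ : ℝ → MR} (hγ : IsAdmissible D γ) :
    IsAdmissible D' γ :=
  ⟨hγ.smooth, fun t ht hx => hγ.avoids t ht (Sing_mono h hx), fun t ht d hd hx =>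
    hγ.transversal t ht d (h hd) hx⟩

lemma eq_quarter_of_cos_eq_zero {t : ℝ} (ht : t ∈ Set.Icc (0 : ℝ) 1) (h : cos (2 * π * t) = 0) :
    t = 1 / 4 ∨ t = 3 / 4 := by
  obtain ⟨k, hk⟩ := cos_eq_zero_iff.1 h
  have h1 : t = (2 * k + 1) / 4 := by
    have : π * (2 * t) = π * ((2 * k + 1) / 2) := by linarith
    have := mul_left_cancel₀ pi_ne_zero this
    linarith
  have h2 : (-1 : ℝ) < k := by linarith [ht.1]
  have h3 : (k : ℝ) < 2 := by linarith [ht.2]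
  have h2' : (-1 : ℤ) < k := by exact_mod_cast h2
  have h3' : k < 2 := by exact_mod_cast h3
  obtain rfl | rfl : k = 0 ∨ k = 1 := by omega
  · left; rw [h1]; norm_num
  · right; rw [h1]; norm_num

/-- The coefficient at `q` of the difference of the products of wall functions at `x`. -/
noncomputable def diffCoeff (D D' : Finset (Wall K)) (N : ℕ) (q : P) (x : MR) : K :=
  coeffMod q ((prodAt D N x : KPmod K N) - (prodAt D' N x : KPmod K N))

/-- Let `D` and `D'` agree to order `k` and have trivial loops at `y`. Then the coefficients of order
`k` with exponent proportional to `ρ` of their difference agree on both sides of `y` in the direction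
`ρ`. -/
lemma coeff_eq_across {N k : ℕ} {W D D' : Finset (Wall K)} (hW : ∀ d ∈ W, IsWall d)
    {A : Finset (M × ℤ)} (hA : PresentedBy W A) (hDW : D ⊆ W) (hDW' : D' ⊆ W) {y w u : MR} {ρ : M}
    (hvan : ∀ h ∈ A, ev h y = 0 → toReal h.1 ⬝ᵥ w = 0)
    (hgen : ∀ h ∈ A, h.1 ≠ 0 → toReal h.1 ⬝ᵥ u ≠ 0) (hdet : w ⬝ᵥ (u ⨯₃ toReal ρ) ≠ 0)
    (hl : LoopTrivialAt (D : Set (Wall K)) N y) (hl' : LoopTrivialAt (D' : Set (Wall K)) N y)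
    (hS : ∀ x, Gen A x → (prodAt D N x : KPmod K N) - prodAt D' N x ∈ filt K N k)
    {ν m : M} (hνw : toReal ν ⬝ᵥ w = 0) (hνρ : ν ⬝ᵥ ρ = 0) (hνm : ν ⬝ᵥ m = 1)
    {q : P} (hq : deg q = k) (hkN : k < N) {j : ℕ} (hj : 0 < j) (hqρ : q.1 = j • ρ) :
    ∀ᶠ ε in 𝓝[>] (0 : ℝ),
      diffCoeff D D' N q (y + ε • toReal ρ) = diffCoeff D D' N q (y - ε • toReal ρ) := by
  classical
  have hqN : deg q < N := by omega
  have hνρ' : toReal ν ⬝ᵥ toReal ρ = 0 := by rw [toReal_dot, hνρ, Int.cast_zero]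
  -- The sign of ν is free. The value ν ⬝ᵥ u cannot be zero: ν would then be a multiple of u ⨯₃ ρ,
  -- and the nonzero determinant together with ν ⬝ᵥ w = 0 would give ν = 0.
  wlog hpos : 0 < toReal ν ⬝ᵥ u generalizing ν m with hwlog
  · refine hwlog (ν := -ν) (m := -m) (by simpa using hνw) (by simpa using hνρ) (by simpa using hνm)
      (by simpa using hνρ') ?_
    rw [toReal_neg, neg_dotProduct, Left.neg_pos_iff]
    refine lt_of_le_of_ne (not_lt.1 hpos) fun h0 => ?_
    have hne : w ⨯₃ (u ⨯₃ toReal ρ) ≠ 0 ∨ u ⨯₃ toReal ρ ≠ 0 := by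
      right; intro h; rw [h, dotProduct_zero] at hdet; exact hdet rfl
    obtain ⟨c, hc⟩ := exists_smul_cross (w := u) (u := toReal ρ) (h := toReal ν)
      (by rcases hne with h | h
          · intro h2; rw [h2, map_zero] at h; exact h rfl
          · exact h) h0 hνρ'
    rw [hc, smul_dotProduct, dotProduct_comm, smul_eq_mul] at hνw
    have hc0 := (mul_eq_zero.1 hνw).resolve_right hdet
    rw [hc0, zero_smul] at hc
    have : ν = 0 := toReal_injective (by rw [hc, toReal_zero])
    rw [this, zero_dotProduct] at hνm
    exact zero_ne_one hνm
  obtain ⟨U, hU, hUl⟩ := hl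
  obtain ⟨U', hU', hUl'⟩ := hl'
  have hDwall : ∀ d ∈ D, IsWall d := fun d hd => hW d (hDW hd)
  have hDwall' : ∀ d ∈ D', IsWall d := fun d hd => hW d (hDW' hd)
  filter_upwards [eventually_circ_mem (u := u) (r := toReal ρ) hU,
    eventually_circ_mem (u := u) (r := toReal ρ) hU',
    eventually_circ_mem (u := u) (r := toReal ρ) (eventually_sign A y), self_mem_nhdsWithin]
    with ε hεU hεU' hper hε
  have hC : IsCircle A y w u (toReal ρ) ε := ⟨hε, hvan, hgen, hdet, hper⟩
  set γ := circ y u (toReal ρ) ε with hγdef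
  have hadm := hC.admissible hW hA
  have hfin := hC.finite_times hW hA
  have hp : ∀ t, ∃ μ, LocPlanar (W : Set (Wall K)) (γ t) μ := fun t =>
    (hC.gen t).exists_locPlanar hW hA
  have hcr : ∀ t, ∃ μ : M, t ∈ Set.Icc (0 : ℝ) 1 → ∀ e ∈ W, γ t ∈ e.carrier →
      CrossesAt γ e t μ := by
    intro t
    by_cases hex : t ∈ Set.Icc (0 : ℝ) 1 ∧ ∃ e ∈ W, γ t ∈ e.carrier
    · obtain ⟨htI, e, he, hx⟩ := hex
      obtain ⟨μ, hμ⟩ := hC.exists_crossesAt hW hA he htI hx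
      refine ⟨μ, fun _ e' he' hx' => ?_⟩
      obtain ⟨μ', hμ'⟩ := hC.exists_crossesAt hW hA he' htI hx'
      obtain ⟨κ, hκ⟩ := hp t
      have := hκ.crossesAt_unique hW he he' hμ hμ'
      rwa [this] at hμ'
    · exact ⟨0, fun htI e he hx => absurd ⟨htI, e, he, hx⟩ hex⟩
  choose μ hμ using hcr
  -- The times 1/4 and 3/4 correspond to y + ε ρ and y - ε ρ; they are included even if no wall
  -- passes there, so that both coefficients occur in the sum.
  set 𝒯 : Finset ℝ := hfin.toFinset ∪ {1 / 4, 3 / 4} with h𝒯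
  have h𝒯I : ∀ t ∈ 𝒯, t ∈ Set.Icc (0 : ℝ) 1 := by
    intro t ht
    rw [h𝒯, Finset.mem_union, Set.Finite.mem_toFinset, Finset.mem_insert,
      Finset.mem_singleton] at ht
    rcases ht with ht | rfl | rfl
    · exact ht.1
    · constructor <;> norm_num
    · constructor <;> norm_num
  set T := 𝒯.sort (· ≤ ·) with hTdef
  have hTmem : ∀ t, t ∈ T ↔ t ∈ 𝒯 := fun t => by rw [hTdef, Finset.mem_sort]
  have hT : T.Pairwise (· < ·) := (Finset.sortedLT_sort _).pairwise
  have hcompose : ∀ E : Finset (Wall K), E ⊆ W → ∀ V : Set MR, (∀ s, γ s ∈ V) →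
      (∀ γ : ℝ → MR, IsAdmissible (E : Set (Wall K)) γ → γ 0 = γ 1 →
        (∀ t ∈ Set.Icc (0 : ℝ) 1, γ t ∈ V) →
        ∀ θ, IsPathOrderedProduct (E : Set (Wall K)) N γ θ → θ = AlgHom.id K (KPmod K N)) →
      compose T (fun t => cross N (prodAt E N (γ t)) (μ t)) = AlgHom.id K _ := by
    intro E hE V hV hloop
    have hEw : ∀ d ∈ E, IsWall d := fun d hd => hW d (hE hd)
    have hadmE : IsAdmissible (E : Set (Wall K)) γ := hadm.mono (Finset.coe_subset.2 hE)
    obtain ⟨θ, hθ⟩ := exists_isPathOrderedProduct (n := N) E hEw (γ := γ)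
      (hfin.subset fun t ⟨ht, d, hd, hx⟩ => ⟨ht, d, hE hd, hx⟩)
    have h1 := hloop γ hadmE (circ_zero _ _ _ _) (fun t _ => hV t) θ hθ
    have h2 := eq_compose_crossAt E hEw hadmE hθ hT (fun t ht => h𝒯I t ((hTmem t).1 ht))
      fun t ht d hd hx => (hTmem t).2 (Finset.mem_union_left _
        (hfin.mem_toFinset.2 ⟨ht, d, hE hd, hx⟩))
    rw [← h1, h2]
    refine compose_congr fun t ht => ?_
    have htI := h𝒯I t ((hTmem t).1 ht)
    by_cases hex : ∃ d ∈ E, γ t ∈ d.carrier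
    · obtain ⟨d, hd, hx⟩ := hex
      obtain ⟨κ, hκ⟩ := hp t
      exact (crossAt_of_crossesAt hEw (hκ.mono (Finset.coe_subset.2 hE)) hd
        (hμ t htI d (hE hd) hx)).symm
    · push Not at hex
      rw [crossAt_of_notMem hex, prodAt_eq_one hex, cross_one]
  have hc1 := hcompose D hDW U hεU hUl
  have hc2 := hcompose D' hDW' U' hεU' hUl'
  -- Both compositions are the identity, so the weighted sum of the differences vanishes in degree
  -- k. The covector m, with ν ⬝ᵥ m = 1, normalizes the weights at the two relevant times.
  have hsum := sum_mem_of_compose_eq T (fun t => prodAt D N (γ t)) (fun t => prodAt D' N (γ t)) μ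
    (fun t _ => prodAt_sub_one_mem hDwall N _) (fun t _ => prodAt_sub_one_mem hDwall' N _)
    (fun t _ => hS _ (hC.gen t)) (hc1.trans hc2.symm) m
  set c : ℝ → K := fun t => diffCoeff D D' N q (γ t) with hcdef
  have hsum2 : ∑ t ∈ 𝒯, (μ t ⬝ᵥ m) • c t = 0 := by
    have h1 : (T.map fun t => (μ t ⬝ᵥ m) •
        ((prodAt D N (γ t) : KPmod K N) - prodAt D' N (γ t))).sum =
        ∑ t ∈ 𝒯, (μ t ⬝ᵥ m) • ((prodAt D N (γ t) : KPmod K N) - prodAt D' N (γ t)) := by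
      rw [← List.sum_toFinset _ (Finset.sort_nodup 𝒯 (· ≤ ·)), Finset.sort_toFinset]
    rw [h1, mem_filt_iff (by omega)] at hsum
    have h2 := hsum q (by omega)
    have h3 : coeffLin K q hqN (∑ t ∈ 𝒯, (μ t ⬝ᵥ m) •
      ((prodAt D N (γ t) : KPmod K N) - prodAt D' N (γ t))) = 0 := h2
    rw [map_sum] at h3
    rw [← h3]
    exact Finset.sum_congr rfl fun t _ => (map_zsmul (coeffLin K q hqN) _ _).symm
  have hc0 : coeffMod q (0 : KPmod K N) = 0 := map_zero (coeffLin K q hqN)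
  have hnowall : ∀ t, (∀ e ∈ W, γ t ∉ e.carrier) → c t = 0 := fun t h => by
    rw [hcdef]
    simp only [diffCoeff]
    rw [prodAt_eq_one fun d hd => h d (hDW hd), prodAt_eq_one fun d hd => h d (hDW' hd), sub_self,
      hc0]
  -- Away from the line through y along ρ the normal at the crossing does not kill ρ. Functions of
  -- walls through that point only involve exponents tangent to them, hence have no term at q.
  have hother : ∀ t ∈ 𝒯, t ∉ ({1 / 4, 3 / 4} : Finset ℝ) → (μ t ⬝ᵥ m) • c t = 0 := by
    intro t ht hne
    have htI := h𝒯I t ht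
    by_cases hex : ∃ e ∈ W, γ t ∈ e.carrier
    · obtain ⟨e, he, hx⟩ := hex
      have hμt : ∀ e ∈ W, γ t ∈ e.carrier → IsNormal e.carrier (μ t) := fun e he hx =>
        (hμ t htI e he hx).2.1
      obtain ⟨h1, -, h2⟩ := hC.normal_eq hW hA he hx (hμt e he hx)
      have hq0 : μ t ⬝ᵥ q.1 ≠ 0 := by
        intro h0
        rw [hqρ, dotProduct_smul, smul_eq_zero, or_iff_right hj.ne'] at h0
        have h3 : toReal (μ t) ⬝ᵥ toReal ρ = 0 := by rw [toReal_dot, h0, Int.cast_zero]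
        rw [h3, mul_zero, add_zero] at h2
        have h4 := eq_quarter_of_cos_eq_zero htI ((mul_eq_zero.1 h2).resolve_right h1)
        apply hne
        rw [Finset.mem_insert, Finset.mem_singleton]
        exact h4
      have h5 : c t = 0 := by
        have e1 := prodAt_mem hDwall N (x := γ t) (ν := μ t) fun d hd hx => hμt d (hDW hd) hx
        have e2 := prodAt_mem hDwall' N (x := γ t) (ν := μ t) fun d hd hx => hμt d (hDW' hd) hx
        exact coeffMod_eq_zero_of_mem_suppSub (Submodule.sub_mem _ e1 e2) hqN hq0
      rw [h5, smul_zero]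
    · push Not at hex
      rw [hnowall t hex, smul_zero]
  rw [← Finset.sum_subset (s₁ := {1 / 4, 3 / 4}) Finset.subset_union_right hother,
    Finset.sum_pair (by norm_num)] at hsum2
  -- On the line through y along ρ, the normals of the walls met are orthogonal to w and ρ, as ν is,
  -- so these walls have the normal ν.
  have hnormal : ∀ t ∈ Set.Icc (0 : ℝ) 1, cos (2 * π * t) = 0 → ∀ e ∈ W, γ t ∈ e.carrier →
      IsNormal e.carrier ν := by
    intro t htI hcos e he hx
    obtain ⟨κ, hκ, -, hκ2⟩ := (hW e he).exists_normal
    obtain ⟨h1, h2, h3⟩ := hC.normal_eq hW hA he hx hκ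
    have hsin : sin (2 * π * t) ≠ 0 := fun h0 => by
      have := sin_sq_add_cos_sq (2 * π * t)
      rw [h0, hcos] at this
      norm_num at this
    rw [hcos, zero_mul, zero_add] at h3
    have h4 := (mul_eq_zero.1 h3).resolve_left hsin
    have hwρ : w ⨯₃ toReal ρ ≠ 0 := by
      intro h0
      apply hdet
      rw [triple_product_permutation, ← cross_anticomm, h0, neg_zero, dotProduct_zero]
    obtain ⟨a, ha⟩ := exists_smul_cross hwρ h2 h4
    obtain ⟨b, hb⟩ := exists_smul_cross hwρ hνw hνρ'
    have ha0 : a ≠ 0 := by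
      rintro rfl
      rw [zero_smul] at ha
      exact toReal_ne_zero ((hW e he).normal_ne_zero hκ) ha
    have hb0 : b ≠ 0 := by
      rintro rfl
      rw [hb, zero_smul, zero_dotProduct] at hpos
      exact lt_irrefl _ hpos
    refine isNormal_of_direction hνm fun x => ?_
    rw [hκ2, ha, hb, smul_dotProduct, smul_dotProduct, smul_eq_mul, smul_eq_mul, mul_eq_zero,
      mul_eq_zero, or_iff_right ha0, or_iff_right hb0]
  -- At 1/4 the ellipse moves in the direction -u and at 3/4 in the direction u. The crossing
  -- covectors are therefore ν and -ν, and the two contributions enter with opposite signs.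
  have hquarter : (μ (1 / 4) ⬝ᵥ m) • c (1 / 4) = c (1 / 4) := by
    by_cases hex : ∃ e ∈ W, γ (1 / 4) ∈ e.carrier
    · obtain ⟨e, he, hx⟩ := hex
      have htI : (1 / 4 : ℝ) ∈ Set.Icc (0 : ℝ) 1 := by constructor <;> norm_num
      have hcs : 2 * π * (1 / 4) = π / 2 := by ring
      have hn := hnormal _ htI (by rw [hcs, cos_pi_div_two]) e he hx
      have h1 : CrossesAt γ e (1 / 4) ν := hC.crossesAt hW hA he htI hx hn (by
        rw [hcs, sin_pi_div_two, cos_pi_div_two]; linarith)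
      obtain ⟨κ, hκ⟩ := hp (1 / 4)
      rw [hκ.crossesAt_unique hW he he h1 (hμ _ htI e he hx), hνm, one_smul]
    · push Not at hex
      rw [hnowall _ hex, smul_zero]
  have hquarter' : (μ (3 / 4) ⬝ᵥ m) • c (3 / 4) = -c (3 / 4) := by
    by_cases hex : ∃ e ∈ W, γ (3 / 4) ∈ e.carrier
    · obtain ⟨e, he, hx⟩ := hex
      have htI : (3 / 4 : ℝ) ∈ Set.Icc (0 : ℝ) 1 := by constructor <;> norm_num
      have hn := hnormal _ htI cos_three_quarter e he hx
      have h1 : CrossesAt γ e (3 / 4) (-ν) := hC.crossesAt hW hA he htI hx hn.neg (by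
        rw [sin_three_quarter, cos_three_quarter, toReal_neg, neg_dotProduct]; linarith)
      obtain ⟨κ, hκ⟩ := hp (3 / 4)
      rw [hκ.crossesAt_unique hW he he h1 (hμ _ htI e he hx), neg_dotProduct, hνm, neg_one_smul]
    · push Not at hex
      rw [hnowall _ hex, smul_zero, neg_zero]
  rw [hquarter, hquarter'] at hsum2
  have h1 : c (1 / 4) = c (3 / 4) := by rwa [← sub_eq_add_neg, sub_eq_zero] at hsum2
  simp only [hcdef, hγdef] at h1
  rwa [circ_quarter, circ_three_quarter] at h1

end Circles

/-! ### Uniqueness of consistent completions at generic points -/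

/-- Finitely many proper linear subspaces do not cover ℝ³. -/
lemma exists_generic_vector (F : Finset MR) (hF : ∀ c ∈ F, c ≠ 0) :
    ∃ u : MR, ∀ c ∈ F, c ⬝ᵥ u ≠ 0 := by
  obtain ⟨u, hu⟩ := Module.Dual.exists_forall_ne_zero_of_forall_exists (K := ℝ) (M := MR)
    (ι := F) (fun c => (dotProductBilin ℝ ℝ c.1 : Module.Dual ℝ MR)) fun c =>
      ⟨c.1, fun h => hF c.1 c.2 (dotProduct_self_eq_zero.1 h)⟩
  exact ⟨u, fun c hc => hu ⟨c, hc⟩⟩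

/-- The wall function only involves exponents that are multiples of the primitive vector `r`, modulo
the `n`-th power of the ideal. -/
structure HasRay (n : ℕ) (d : Wall K) (r : M) : Prop where
  primitive : ∃ a, r ⬝ᵥ a = 1
  tangent : r ∈ tangentLattice d.carrier
  supp : (truncUnit n d.func : KPmod K n) ∈
    suppSub K n {p | p = 0 ∨ ∃ k : ℕ, 0 < k ∧ p.1 = k • r}

/-- Pairing with a and with a' shows that j and k divide each other. Distinct primitive vectors
therefore share no positive multiples, so the exponents along different rays do not mix. -/
lemma eq_of_smul_primitive {r r' a a' : M} (ha : r ⬝ᵥ a = 1) (ha' : r' ⬝ᵥ a' = 1) {j k : ℕ}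
    (hj : 0 < j) (hk : 0 < k) (h : j • r = k • r') : r = r' := by
  have h1 : (j : ℤ) = k * (r' ⬝ᵥ a) := by
    have := congrArg (fun v : M => v ⬝ᵥ a) h
    simp only [smul_dotProduct, ha] at this
    simpa only [nsmul_eq_mul, mul_one] using this
  have h2 : (k : ℤ) = j * (r ⬝ᵥ a') := by
    have := congrArg (fun v : M => v ⬝ᵥ a') h
    simp only [smul_dotProduct, ha'] at this
    simpa only [nsmul_eq_mul, mul_one] using this.symm
  have h3 : j = k := Nat.dvd_antisymm (Int.natCast_dvd_natCast.1 ⟨_, h2⟩ |> fun h => h)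
    (Int.natCast_dvd_natCast.1 ⟨_, h1⟩)
  subst h3
  exact smul_right_injective M hj.ne' h

lemma prodAt_ray_mem {n : ℕ} {E : Finset (Wall K)} {r : M} (hE : ∀ d ∈ E, HasRay n d r) (x : MR) :
    (prodAt E n x : KPmod K n) ∈ suppSub K n {p | p = 0 ∨ ∃ k : ℕ, 0 < k ∧ p.1 = k • r} ∨
      prodAt E n x = 1 := by
  classical
  rcases E.eq_empty_or_nonempty with rfl | ⟨e, he⟩
  · right; simp [prodAt]
  left
  have hsub : (prodAt E n x : KPmod K n) ∈ suppSub K n {p | p = 0 ∨ ∃ k : ℕ, 0 < k ∧ p.1 = k • r} := by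
    rw [prodAt, Units.coe_prod]
    refine prod_mem_suppSub (Or.inl rfl) ?_ _ _ fun d hd => (hE d (Finset.mem_filter.1 hd).1).supp
    rintro p (rfl | ⟨k, hk, hp⟩) p' (rfl | ⟨k', hk', hp'⟩)
    · left; simp
    · right; exact ⟨k', hk', by simpa using hp'⟩
    · right; exact ⟨k, hk, by simpa using hp⟩
    · right; exact ⟨k + k', by omega, by rw [Prod.fst_add, hp, hp', add_smul]⟩
  exact hsub

lemma coeffMod_prodAt_ray {n : ℕ} {E : Finset (Wall K)} {r : M} (hE : ∀ d ∈ E, HasRay n d r)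
    (x : MR) {q : P} (hq : deg q < n) (hq0 : q ≠ 0) (hqr : ¬ ∃ k : ℕ, 0 < k ∧ q.1 = k • r) :
    coeffMod q (prodAt E n x : KPmod K n) = 0 := by
  rcases prodAt_ray_mem hE x with h | h
  · exact coeffMod_eq_zero_of_mem_suppSub h hq (by rintro (h | h) <;> contradiction)
  · rw [h, Units.val_one, ← mono_zero, coeffMod_mono hq, if_neg hq0.symm]

open Classical in
/-- The walls of `D` with exponents along `r`. -/
noncomputable def along (ray : Wall K → M) (D : Finset (Wall K)) (r : M) : Finset (Wall K) :=
  D.filter fun d => ray d = r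

lemma mem_along {ray : Wall K → M} {D : Finset (Wall K)} {r : M} {d : Wall K} :
    d ∈ along ray D r ↔ d ∈ D ∧ ray d = r := by
  classical
  simp [along]

lemma prodAt_eq_prod_along {n : ℕ} (ray : Wall K → M) (D : Finset (Wall K)) (R : Finset M)
    (hR : ∀ d ∈ D, ray d ∈ R) (x : MR) :
    prodAt D n x = ∏ r ∈ R, prodAt (along ray D r) n x := by
  classical
  rw [prodAt, ← Finset.prod_fiberwise_of_maps_to (g := ray) (t := R)]
  · refine Finset.prod_congr rfl fun r _ => ?_
    rw [prodAt]
    refine Finset.prod_congr ?_ fun _ _ => rfl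
    ext d
    simp only [Finset.mem_filter, mem_along]
    tauto
  · intro d hd
    exact hR d (Finset.mem_filter.1 hd).1

lemma diffCoeff_eq_zero_of_eq {D D' : Finset (Wall K)} {N : ℕ} {q : P} (hq : deg q < N) {x : MR}
    (h : prodAt D N x = prodAt D' N x) : diffCoeff D D' N q x = 0 := by
  rw [diffCoeff, h, sub_self]
  exact map_zero (coeffLin K q hq)

/-- The coefficients of order `k` along `r` only depend on the walls along `r`, if the walls along
all rays agree to order `k`. -/
lemma diffCoeff_eq_along {N k : ℕ} {D D' : Finset (Wall K)} {ray : Wall K → M}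
    (hD : ∀ d ∈ D, IsWall d) (hD' : ∀ d ∈ D', IsWall d)
    (hray : ∀ d ∈ D, HasRay N d (ray d)) (hray' : ∀ d ∈ D', HasRay N d (ray d)) {x : MR}
    (hS : ∀ r, (prodAt (along ray D r) N x : KPmod K N) -
      (prodAt (along ray D' r) N x : KPmod K N) ∈ filt K N k) :
    (prodAt D N x : KPmod K N) - (prodAt D' N x : KPmod K N) ∈ filt K N k ∧
    ∀ (r a : M) (q : P), k < N → r ⬝ᵥ a = 1 → deg q = k → (∃ j : ℕ, 0 < j ∧ q.1 = j • r) →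
      diffCoeff D D' N q x = diffCoeff (along ray D r) (along ray D' r) N q x := by
  classical
  set R : Finset M := (D ∪ D').image ray with hR
  have e1 := prodAt_eq_prod_along (n := N) ray D R
    (fun d hd => Finset.mem_image_of_mem _ (Finset.mem_union_left _ hd)) x
  have e2 := prodAt_eq_prod_along (n := N) ray D' R
    (fun d hd => Finset.mem_image_of_mem _ (Finset.mem_union_right _ hd)) x
  obtain ⟨-, h2, h3⟩ := prod_sub_prod_linear (n := N) (k := k) R
    (fun r => (prodAt (along ray D r) N x : KPmod K N))
    (fun r => (prodAt (along ray D' r) N x : KPmod K N))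
    (fun r _ => prodAt_sub_one_mem (fun d hd => hD d (mem_along.1 hd).1) N x)
    (fun r _ => prodAt_sub_one_mem (fun d hd => hD' d (mem_along.1 hd).1) N x)
    (fun r _ => hS r)
  rw [← Units.coe_prod, ← Units.coe_prod, ← e1, ← e2] at h2 h3
  refine ⟨h2, ?_⟩
  rintro r a q hkN ha hq ⟨j, hj, hqr⟩
  have hqN : deg q < N := by omega
  have hq0 : q ≠ 0 := by
    rintro rfl
    have : r = 0 := (smul_eq_zero.1 (show j • r = 0 from hqr.symm)).resolve_left hj.ne'
    rw [this, zero_dotProduct] at ha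
    exact zero_ne_one ha
  have h4 := (mem_filt_iff (by omega) _).1 h3 q (by omega)
  have h5 : coeffLin K q hqN ((prodAt D N x : KPmod K N) - (prodAt D' N x : KPmod K N) -
    ∑ r ∈ R, ((prodAt (along ray D r) N x : KPmod K N) -
      (prodAt (along ray D' r) N x : KPmod K N))) = 0 := h4
  rw [map_sub, map_sum, sub_eq_zero] at h5
  change diffCoeff D D' N q x = ∑ r ∈ R, diffCoeff (along ray D r) (along ray D' r) N q x at h5
  rw [h5]
  -- In degree k the difference is a sum over rays, and the products along another ray have no term
  -- at q. If r occurs on no wall at all, both of its products are empty.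
  refine Finset.sum_eq_single r (fun r' hr' hne => ?_) fun hr => ?_
  · obtain ⟨e, he, rfl⟩ := Finset.mem_image.1 hr'
    obtain ⟨a', ha'⟩ : ∃ a', ray e ⬝ᵥ a' = 1 := by
      rcases Finset.mem_union.1 he with he | he
      · exact (hray e he).primitive
      · exact (hray' e he).primitive
    have hqr' : ¬ ∃ k : ℕ, 0 < k ∧ q.1 = k • ray e := by
      rintro ⟨i, hi, hqi⟩
      exact hne (eq_of_smul_primitive ha ha' hj hi (hqr.symm.trans hqi)).symm
    have c1 := coeffMod_prodAt_ray (E := along ray D (ray e)) (r := ray e)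
      (fun d hd => (mem_along.1 hd).2 ▸ hray d (mem_along.1 hd).1) x hqN hq0 hqr'
    have c2 := coeffMod_prodAt_ray (E := along ray D' (ray e)) (r := ray e)
      (fun d hd => (mem_along.1 hd).2 ▸ hray' d (mem_along.1 hd).1) x hqN hq0 hqr'
    have : diffCoeff (along ray D (ray e)) (along ray D' (ray e)) N q x =
      coeffMod q (prodAt (along ray D (ray e)) N x : KPmod K N) -
      coeffMod q (prodAt (along ray D' (ray e)) N x : KPmod K N) := map_sub (coeffLin K q hqN) _ _
    rw [this, c1, c2, sub_zero]
  · refine diffCoeff_eq_zero_of_eq hqN ?_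
    rw [prodAt_eq_one, prodAt_eq_one]
    · intro d hd
      exact absurd (Finset.mem_image.2 ⟨d, Finset.mem_union_right _ (mem_along.1 hd).1,
        (mem_along.1 hd).2⟩) hr
    · intro d hd
      exact absurd (Finset.mem_image.2 ⟨d, Finset.mem_union_left _ (mem_along.1 hd).1,
        (mem_along.1 hd).2⟩) hr

/-- The product of wall functions is constant along short open rays. -/
lemma exists_eventually_prodAt {N : ℕ} {E : Finset (Wall K)} {A : Finset (M × ℤ)}
    (hA : PresentedBy E A) (y v : MR) :
    ∃ g, ∀ᶠ ε in 𝓝[>] (0 : ℝ), prodAt E N (y + ε • v) = g := by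
  have hc : Tendsto (fun ε : ℝ => y + ε • v) (𝓝[>] 0) (𝓝 y) := by
    have : Continuous fun ε : ℝ => y + ε • v := by fun_prop
    have h2 : Tendsto (fun ε : ℝ => y + ε • v) (𝓝 0) (𝓝 y) := by simpa using this.tendsto 0
    exact h2.mono_left nhdsWithin_le_nhds
  have hs : ∀ᶠ ε in 𝓝[>] (0 : ℝ), 0 < ε ∧ ∀ h ∈ A, (0 < ev h y → 0 < ev h (y + ε • v)) ∧
      (ev h y < 0 → ev h (y + ε • v) < 0) :=
    Filter.Eventually.and (self_mem_nhdsWithin : ∀ᶠ ε in 𝓝[>] (0 : ℝ), ε ∈ Set.Ioi 0)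
      (hc.eventually (eventually_sign A y))
  obtain ⟨ε₀, h0, h1⟩ := hs.exists
  refine ⟨prodAt E N (y + ε₀ • v), ?_⟩
  filter_upwards [hs] with ε hε
  refine prodAt_congr fun d hd => ?_
  obtain ⟨H, hHA, hH⟩ := hA d hd
  -- Near y a polyhedron is its tangent cone, and membership of y + ε • v in a cone with apex y is
  -- independent of ε > 0.
  rw [hH, eventually_mem_poly_iff hHA hε.2, eventually_mem_poly_iff hHA h1]
  simp only [add_sub_cancel_left, dotProduct_smul, smul_eq_mul, mul_nonneg_iff_of_pos_left h0,
    mul_nonneg_iff_of_pos_left hε.1]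

lemma eventually_gen_of_cross {A : Finset (M × ℤ)} {y w v : MR} (hwv : w ⨯₃ v ≠ 0)
    (hvan : ∀ h ∈ A, ev h y = 0 → toReal h.1 ⬝ᵥ w = 0) :
    ∀ᶠ ε in 𝓝[>] (0 : ℝ), Gen A (y + ε • v) := by
  have hc : Tendsto (fun ε : ℝ => y + ε • v) (𝓝[>] 0) (𝓝 y) := by
    have : Continuous fun ε : ℝ => y + ε • v := by fun_prop
    have h2 : Tendsto (fun ε : ℝ => y + ε • v) (𝓝 0) (𝓝 y) := by simpa using this.tendsto 0
    exact h2.mono_left nhdsWithin_le_nhds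
  filter_upwards [hc.eventually (eventually_sign A y), self_mem_nhdsWithin] with ε hε hpos
  have hpos' : (0 : ℝ) < ε := hpos
  refine ⟨_, fun h hA h0 => exists_smul_cross hwv ?_ ?_⟩
  all_goals
    have hy : ev h y = 0 := by
      rcases lt_trichotomy (ev h y) 0 with h3 | h3 | h3
      · linarith [(hε h hA).2 h3]
      · exact h3
      · linarith [(hε h hA).1 h3]
  · exact hvan h hA hy
  · rw [ev_add, hy, zero_add, dotProduct_smul, smul_eq_mul] at h0
    exact (mul_eq_zero.1 h0).resolve_left hpos'.ne'

/-- A function on the line that is constant on punctured neighbourhoods is constant up to its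
exceptional values. -/
lemma eq_of_punctured_const {X : Type*} (φ : ℝ → X)
    (h : ∀ s, ∃ c, ∀ᶠ s' in 𝓝[≠] s, φ s' = c) {a b : ℝ} (hab : a ≤ b) {ca cb : X}
    (ha : ∀ᶠ s' in 𝓝[≠] a, φ s' = ca) (hb : ∀ᶠ s' in 𝓝[≠] b, φ s' = cb) : ca = cb := by
  -- Filling in the punctured values gives ψ, which is locally constant everywhere and therefore
  -- constant on the interval.
  choose ψ hψ using h
  have huniq : ∀ s c, (∀ᶠ s' in 𝓝[≠] s, φ s' = c) → ψ s = c := fun s c hc => by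
    obtain ⟨s', h1, h2⟩ := ((hψ s).and hc).exists
    exact h1.symm.trans h2
  have hloc : ∀ s, ∀ᶠ s' in 𝓝 s, ψ s' = ψ s := by
    intro s
    have h1 := eventually_eventually_nhdsWithin.2 (hψ s)
    rw [eventually_nhdsWithin_iff] at h1
    filter_upwards [h1] with s' hs'
    by_cases hne : s' = s
    · rw [hne]
    · refine huniq s' _ ?_
      have h2 := hs' hne
      rw [IsOpen.nhdsWithin_eq isOpen_compl_singleton hne] at h2
      exact nhdsWithin_le_nhds h2
  rw [← huniq a ca ha, ← huniq b cb hb]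
  exact (eq_of_locally_const ψ hab fun s _ => nhdsWithin_le_nhds (hloc s)).symm

/-- On a generic line in the plane through `x` spanned by `b` and `r`, the affine functions of `A`
vanishing at a point are constant along a common direction. -/
lemma exists_generic_line (A : Finset (M × ℤ)) (x b r : MR) :
    ∃ B : Finset ℝ, ∀ τ ∉ B, ∀ s : ℝ, ∃ i j : ℝ, i ≠ 0 ∧
      ∀ h ∈ A, ev h (x + τ • b + s • r) = 0 → toReal h.1 ⬝ᵥ (i • b - j • r) = 0 := by
  classical
  let β : M × ℤ → ℝ := fun h => toReal h.1 ⬝ᵥ b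
  let ϱ : M × ℤ → ℝ := fun h => toReal h.1 ⬝ᵥ r
  -- In the coordinates (τ, s) each function is affine. Excluded are the values of τ at which a zero
  -- line is parallel to the s-axis and those at which two nonparallel zero lines meet; vanishing
  -- denominators merely exclude a few further values.
  refine ⟨A.image (fun h => -ev h x / β h) ∪ (A ×ˢ A).image (fun h =>
    -(ev h.1 x * ϱ h.2 - ev h.2 x * ϱ h.1) / (β h.1 * ϱ h.2 - β h.2 * ϱ h.1)), fun τ hτ s => ?_⟩
  have hev : ∀ h, ev h (x + τ • b + s • r) = ev h x + τ * β h + s * ϱ h := fun h => by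
    rw [ev_add, ev_add, dotProduct_smul, dotProduct_smul]; rfl
  have hdot : ∀ h i j, toReal h.1 ⬝ᵥ (i • b - j • r) = i * β h - j * ϱ h := fun h i j => by
    rw [dotProduct_sub, dotProduct_smul, dotProduct_smul]; rfl
  simp only [hev, hdot]
  rw [Finset.mem_union, not_or] at hτ
  by_cases hex : ∃ h ∈ A, ev h x + τ * β h + s * ϱ h = 0 ∧ ¬ (β h = 0 ∧ ϱ h = 0)
  · obtain ⟨h₁, hA₁, h01, hne⟩ := hex
    have hϱ : ϱ h₁ ≠ 0 := by
      intro h0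
      have hβ : β h₁ ≠ 0 := fun h => hne ⟨h, h0⟩
      refine hτ.1 (Finset.mem_image.2 ⟨h₁, hA₁, ?_⟩)
      rw [h0, mul_zero, add_zero] at h01
      field_simp
      linarith
    -- These coefficients describe the direction of the zero line of h₁; every other function
    -- vanishing at the point is constant along it as well.
    refine ⟨ϱ h₁, β h₁, hϱ, fun h₂ hA₂ h02 => ?_⟩
    by_contra hdet
    have hdet' : β h₁ * ϱ h₂ - β h₂ * ϱ h₁ ≠ 0 := fun h => hdet (by linarith)
    refine hτ.2 (Finset.mem_image.2 ⟨(h₁, h₂), Finset.mem_product.2 ⟨hA₁, hA₂⟩, ?_⟩)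
    rw [div_eq_iff hdet']
    linear_combination (-ϱ h₂) * h01 + ϱ h₁ * h02
  · push Not at hex
    refine ⟨1, 0, one_ne_zero, fun h hA h0 => ?_⟩
    rw [(hex h hA h0).1]; simp

/-- Two finite sets of walls with directions and with trivial small loops, whose walls far out in
their direction coincide, have the same products of wall functions at generic points. -/
theorem prodAt_eq_of_loopTrivial {N : ℕ} {D D' : Finset (Wall K)} {ray : Wall K → M}
    (hD : ∀ d ∈ D, IsWall d) (hD' : ∀ d ∈ D', IsWall d)
    (hray : ∀ d ∈ D, HasRay N d (ray d)) (hray' : ∀ d ∈ D', HasRay N d (ray d))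
    {A : Finset (M × ℤ)} (hA : PresentedBy D A) (hA' : PresentedBy D' A)
    (hl : ∀ y w : MR, w ≠ 0 → (∀ h ∈ A, ev h y = 0 → toReal h.1 ⬝ᵥ w = 0) →
      LoopTrivialAt (D : Set (Wall K)) N y ∧ LoopTrivialAt (D' : Set (Wall K)) N y)
    (hfar : ∀ (x : MR) (r : M), ∃ S : ℝ, 0 ≤ S ∧ ∀ s, S ≤ s → ∀ d, ray d = r →
      x + s • toReal r ∈ d.carrier → (d ∈ D ↔ d ∈ D')) {x : MR} (hx : Gen A x) :
    prodAt D N x = prodAt D' N x := by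
  classical
  set W := D ∪ D' with hWdef
  have hDW : D ⊆ W := Finset.subset_union_left
  have hDW' : D' ⊆ W := Finset.subset_union_right
  have hW : ∀ d ∈ W, IsWall d := fun d hd => (Finset.mem_union.1 hd).elim (hD d) (hD' d)
  have hrayW : ∀ d ∈ W, HasRay N d (ray d) := fun d hd =>
    (Finset.mem_union.1 hd).elim (hray d) (hray' d)
  have hAW : PresentedBy W A := fun d hd => (Finset.mem_union.1 hd).elim (hA d) (hA' d)
  have hsubD : ∀ r, along ray D r ⊆ W := fun r d hd => hDW (mem_along.1 hd).1
  have hsubD' : ∀ r, along ray D' r ⊆ W := fun r d hd => hDW' (mem_along.1 hd).1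
  -- The induction keeps the rays separate, because far out along r the two structures are known to
  -- coincide only on walls with exponents along r.
  have main : ∀ k ≤ N, ∀ x, Gen A x → ∀ r, (prodAt (along ray D r) N x : KPmod K N) -
      (prodAt (along ray D' r) N x : KPmod K N) ∈ filt K N k := by
    intro k
    induction k with
    | zero => intro _ x _ r; simp
    | succ k ih =>
      intro hkN x hx r
      have ih' := ih (by omega)
      have hone := Ideal.sub_mem _
        (prodAt_sub_one_mem (fun d hd => hW d (hsubD r hd)) N x)
        (prodAt_sub_one_mem (fun d hd => hW d (hsubD' r hd)) N x)
      rw [sub_sub_sub_cancel_right] at hone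
      rcases Nat.eq_zero_or_pos k with rfl | hk
      · exact hone
      refine mem_filt_succ (by omega) (ih' x hx r) fun q hq => ?_
      have hqN : deg q < N := by omega
      have hq0 : q ≠ 0 := by rintro rfl; rw [deg_zero] at hq; omega
      change diffCoeff (along ray D r) (along ray D' r) N q x = 0
      by_cases hqr : ∃ j : ℕ, 0 < j ∧ q.1 = j • r
      swap
      · have c1 := coeffMod_prodAt_ray (E := along ray D r) (r := r)
          (fun d hd => (mem_along.1 hd).2 ▸ hray d (mem_along.1 hd).1) x hqN hq0 hqr
        have c2 := coeffMod_prodAt_ray (E := along ray D' r) (r := r)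
          (fun d hd => (mem_along.1 hd).2 ▸ hray' d (mem_along.1 hd).1) x hqN hq0 hqr
        have : diffCoeff (along ray D r) (along ray D' r) N q x =
          coeffMod q (prodAt (along ray D r) N x : KPmod K N) -
          coeffMod q (prodAt (along ray D' r) N x : KPmod K N) := map_sub (coeffLin K q hqN) _ _
        rw [this, c1, c2, sub_zero]
      by_cases hex : ∃ d ∈ W, ray d = r ∧ x ∈ d.carrier
      swap
      · push Not at hex
        refine diffCoeff_eq_zero_of_eq hqN ?_
        rw [prodAt_eq_one fun d hd => hex d (hsubD r hd) (mem_along.1 hd).2,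
          prodAt_eq_one fun d hd => hex d (hsubD' r hd) (mem_along.1 hd).2]
      obtain ⟨d, hd, hdr, hxd⟩ := hex
      obtain ⟨a, ha⟩ := hdr ▸ (hrayW d hd).primitive
      obtain ⟨ν, hp⟩ := hx.exists_locPlanar hW hAW
      have hν := (hp d hd hxd).1
      obtain ⟨⟨m, hm⟩, -⟩ := (hW d hd).normal_spec hν
      have hνr : ν ⬝ᵥ r = 0 := ((hW d hd).mem_tangentLattice hν r).1 (hdr ▸ (hrayW d hd).tangent)
      have hνr' : toReal ν ⬝ᵥ toReal r = 0 := by rw [toReal_dot, hνr, Int.cast_zero]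
      have hr0 : toReal r ≠ 0 := toReal_ne_zero (by rintro rfl; simp at ha)
      have hν0 : toReal ν ≠ 0 := toReal_ne_zero ((hW d hd).normal_ne_zero hν)
      -- Together with r this spans the plane of the walls through x, inside which the line is
      -- displaced.
      set b : MR := toReal ν ⨯₃ toReal r with hb
      have hνb : toReal ν ⬝ᵥ b = 0 := dot_self_cross _ _
      have hbr : b ⨯₃ toReal r ≠ 0 := by
        intro h0
        obtain ⟨c, hc⟩ := exists_smul_of_cross_eq_zero hr0 h0
        have h1 : b ⬝ᵥ b = 0 := by
          have h2 : toReal r ⬝ᵥ b = 0 := dot_cross_self (toReal ν) (toReal r)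
          nth_rewrite 1 [hc]
          rw [smul_dotProduct, h2, smul_zero]
        have hb0 : b = 0 := dotProduct_self_eq_zero.1 h1
        rw [hb] at hb0
        obtain ⟨c', hc'⟩ := exists_smul_of_cross_eq_zero hr0 hb0
        rw [hc', smul_dotProduct, smul_eq_mul] at hνr'
        rcases mul_eq_zero.1 hνr' with h | h
        · rw [h, zero_smul] at hc'; exact hν0 hc'
        · exact hr0 (dotProduct_self_eq_zero.1 h)
      obtain ⟨V, hVsub, hVo, hxV⟩ := eventually_nhds_iff.1 (hp.eventually_mem_iff hW)
      have hVprod : ∀ E ⊆ W, ∀ z ∈ V, toReal ν ⬝ᵥ z = toReal ν ⬝ᵥ x →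
          prodAt E N z = prodAt E N x := fun E hE z hz hzν =>
        prodAt_congr fun e he => by
          rw [hVsub z hz e (hE he), and_iff_left hzν]
      obtain ⟨B, hB⟩ := exists_generic_line A x b (toReal r)
      -- A small shift within the wall leaves the products at x unchanged. It makes the line in the
      -- direction r avoid points at which no common invariant direction w exists.
      obtain ⟨τ, hτV, hτB⟩ : ∃ τ : ℝ, x + τ • b ∈ V ∧ τ ∉ B := by
        obtain ⟨δ, hδ, hδV⟩ := exists_pos_of_eventually_add (u := b) (p := (· ∈ V))
          (hVo.mem_nhds hxV)
        obtain ⟨τ, hτ, hτB⟩ := (Set.Ioo_infinite hδ).exists_notMem_finset B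
        exact ⟨τ, hδV τ (by rw [abs_of_pos hτ.1]; exact hτ.2), hτB⟩
      set x' := x + τ • b with hx'
      have hνx' : ∀ s : ℝ, toReal ν ⬝ᵥ (x' + s • toReal r) = toReal ν ⬝ᵥ x := fun s => by
        rw [hx', dotProduct_add, dotProduct_add, dotProduct_smul, dotProduct_smul, hνb, hνr']
        simp
      let c : MR → K := diffCoeff (along ray D r) (along ray D' r) N q
      let φ : ℝ → K := fun s => c (x' + s • toReal r)
      have hloc : ∀ s, ∃ c₀, ∀ᶠ s' in 𝓝[≠] s, φ s' = c₀ := by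
        intro s
        obtain ⟨i, j, hi, hvan⟩ := hB τ hτB s
        set y := x' + s • toReal r with hy
        set w : MR := i • b - j • toReal r with hw
        have hwr : w ⨯₃ toReal r ≠ 0 := by
          rw [hw, map_sub, map_smul, map_smul, LinearMap.sub_apply, LinearMap.smul_apply,
            LinearMap.smul_apply, cross_self, smul_zero, sub_zero]
          exact smul_ne_zero hi hbr
        have hw0 : w ≠ 0 := fun h => hwr (by rw [h]; simp)
        have hνw : toReal ν ⬝ᵥ w = 0 := by
          rw [hw, dotProduct_sub, dotProduct_smul, dotProduct_smul, hνb, hνr']; simp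
        have hrw : toReal r ⨯₃ w ≠ 0 := by
          rw [← cross_anticomm]; exact neg_ne_zero.2 hwr
        obtain ⟨u, hu⟩ := exists_generic_vector
          (insert (toReal r ⨯₃ w) ((A.filter fun h => h.1 ≠ 0).image fun h => toReal h.1)) (by
            intro e he
            rcases Finset.mem_insert.1 he with rfl | he
            · exact hrw
            · obtain ⟨h, hh, rfl⟩ := Finset.mem_image.1 he
              exact toReal_ne_zero (Finset.mem_filter.1 hh).2)
        -- The vector r ⨯₃ w was put among the covectors that u must not be orthogonal to, precisely
        -- for this determinant.
        have hdet : w ⬝ᵥ (u ⨯₃ toReal r) ≠ 0 := by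
          rw [triple_product_permutation, dotProduct_comm]
          exact hu _ (Finset.mem_insert_self _ _)
        have hugen : ∀ h ∈ A, h.1 ≠ 0 → toReal h.1 ⬝ᵥ u ≠ 0 := fun h hA h0 =>
          hu _ (Finset.mem_insert_of_mem (Finset.mem_image.2
            ⟨h, Finset.mem_filter.2 ⟨hA, h0⟩, rfl⟩))
        obtain ⟨hly, hly'⟩ := hl y w hw0 hvan
        obtain ⟨j', hj', hqj'⟩ := hqr
        have hacross := coeff_eq_across hW hAW hDW hDW' hvan hugen hdet hly hly'
          (fun z hz => (diffCoeff_eq_along hD hD' hray hray' (ih' z hz)).1) hνw hνr hm hq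
          (by omega) hj' hqj'
        have hg1 := eventually_gen_of_cross hwr hvan
        have hg2 := eventually_gen_of_cross (v := -toReal r)
          (by rw [map_neg]; exact neg_ne_zero.2 hwr) hvan
        have hcz : ∀ z, Gen A z → diffCoeff D D' N q z = c z := fun z hz =>
          (diffCoeff_eq_along hD hD' hray hray' (ih' z hz)).2 r a q (by omega) ha hq
            ⟨j', hj', hqj'⟩
        have hconst : ∀ v : MR, ∃ c₀, ∀ᶠ ε in 𝓝[>] (0 : ℝ), c (y + ε • v) = c₀ := fun v => by
          obtain ⟨g, hg⟩ := exists_eventually_prodAt (N := N) (hAW.mono (hsubD r)) y v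
          obtain ⟨g', hg'⟩ := exists_eventually_prodAt (N := N) (hAW.mono (hsubD' r)) y v
          refine ⟨coeffMod q ((g : KPmod K N) - (g' : KPmod K N)), ?_⟩
          filter_upwards [hg, hg'] with ε h1 h2
          simp only [c, diffCoeff, h1, h2]
        obtain ⟨c₁, hc₁⟩ := hconst (toReal r)
        obtain ⟨c₂, hc₂⟩ := hconst (-toReal r)
        have hc12 : c₁ = c₂ := by
          obtain ⟨ε, h1, h2, h3, h4, h5⟩ :=
            (hacross.and (hg1.and (hg2.and (hc₁.and hc₂)))).exists
          rw [hcz _ h2, h4, sub_eq_add_neg, ← smul_neg, hcz _ h3, h5] at h1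
          exact h1
        refine ⟨c₁, ?_⟩
        rw [← Set.Iio_union_Ioi, nhdsWithin_union, Filter.eventually_sup]
        constructor
        · have ht : Tendsto (fun s' : ℝ => s - s') (𝓝[<] s) (𝓝[>] 0) := by
            refine tendsto_nhdsWithin_iff.2 ⟨?_, ?_⟩
            · have : Continuous fun s' : ℝ => s - s' := by fun_prop
              have h2 : Tendsto (fun s' : ℝ => s - s') (𝓝 s) (𝓝 0) := by simpa using this.tendsto s
              exact h2.mono_left nhdsWithin_le_nhds
            · filter_upwards [self_mem_nhdsWithin] with s' hs'
              exact Set.mem_Ioi.2 (sub_pos.2 hs')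
          filter_upwards [ht.eventually hc₂] with s' hs'
          rw [hc12, ← hs']
          simp only [φ, hy]
          congr 1
          rw [smul_neg, sub_smul]; abel
        · have ht : Tendsto (fun s' : ℝ => s' - s) (𝓝[>] s) (𝓝[>] 0) := by
            refine tendsto_nhdsWithin_iff.2 ⟨?_, ?_⟩
            · have : Continuous fun s' : ℝ => s' - s := by fun_prop
              have h2 : Tendsto (fun s' : ℝ => s' - s) (𝓝 s) (𝓝 0) := by simpa using this.tendsto s
              exact h2.mono_left nhdsWithin_le_nhds
            · filter_upwards [self_mem_nhdsWithin] with s' hs'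
              exact Set.mem_Ioi.2 (sub_pos.2 hs')
          filter_upwards [ht.eventually hc₁] with s' hs'
          rw [← hs']
          simp only [φ, hy]
          congr 1
          rw [sub_smul]; abel
      obtain ⟨S, hS0, hS⟩ := hfar x' r
      -- Beyond S the two structures have the same walls along r through the points of the line, so
      -- the products coincide and the difference vanishes.
      have hφS : ∀ᶠ s' in 𝓝[≠] (S + 1), φ s' = 0 := by
        have : ∀ᶠ s' in 𝓝 (S + 1), S < s' := lt_mem_nhds (by linarith)
        filter_upwards [nhdsWithin_le_nhds this] with s' hs'
        refine diffCoeff_eq_zero_of_eq hqN ?_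
        rw [prodAt, prodAt]
        refine Finset.prod_congr ?_ fun _ _ => rfl
        ext e
        simp only [Finset.mem_filter, mem_along]
        constructor
        · rintro ⟨⟨h1, h2⟩, h3⟩
          exact ⟨⟨(hS s' hs'.le e h2 h3).1 h1, h2⟩, h3⟩
        · rintro ⟨⟨h1, h2⟩, h3⟩
          exact ⟨⟨(hS s' hs'.le e h2 h3).2 h1, h2⟩, h3⟩
      have hφ0 : ∀ᶠ s' in 𝓝[≠] (0 : ℝ), φ s' = c x := by
        have ht : Tendsto (fun s : ℝ => x' + s • toReal r) (𝓝 0) (𝓝 x') := by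
          have : Continuous fun s : ℝ => x' + s • toReal r := by fun_prop
          simpa using this.tendsto 0
        filter_upwards [nhdsWithin_le_nhds (ht.eventually (hVo.mem_nhds hτV))] with s hs
        simp only [φ, c, diffCoeff, hVprod _ (hsubD r) _ hs (hνx' s),
          hVprod _ (hsubD' r) _ hs (hνx' s)]
      exact eq_of_punctured_const φ hloc (by linarith) hφ0 hφS
  have h1 := (diffCoeff_eq_along hD hD' hray hray' (main N le_rfl x hx)).1
  rw [filt_self, Ideal.mem_bot, sub_eq_zero] at h1
  exact Units.ext h1

/-! ### Diagonal automorphisms -/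

/-- The homomorphism of monoids `p ↦ u ^ p̄ z^p`. -/
noncomputable def diagMonoidHom (n : ℕ) (u : Fin 3 → (KPmod K n)ˣ) :
    Multiplicative P →* KPmod K n where
  toFun p := ((∏ i, u i ^ (p.toAdd.1 i) : (KPmod K n)ˣ) : KPmod K n) * mono K n p.toAdd
  map_one' := by
    simp [mono_zero]
  map_mul' p q := by
    simp only [toAdd_mul, Prod.fst_add, Pi.add_apply, zpow_add, Finset.prod_mul_distrib,
      Units.val_mul, mono_add]
    ring

lemma diagMonoidHom_kills (n : ℕ) (u : Fin 3 → (KPmod K n)ˣ) (g : KP K) (hg : g ∈ (mP K) ^ n) :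
    AddMonoidAlgebra.lift K (KPmod K n) P (diagMonoidHom n u) g = 0 := by
  rw [eq_sum_single g, map_sum]
  refine Finset.sum_eq_zero fun p hp => ?_
  rw [mP_pow_eq] at hg
  have h1 : n ≤ deg p := mem_degIdeal.1 hg p (Finsupp.mem_support_iff.1 hp)
  rw [map_smul, AddMonoidAlgebra.lift_single]
  simp [diagMonoidHom, mono_eq_zero h1]

/-- The endomorphism `z^p ↦ u ^ p̄ z^p` of `K[P] / mP ^ n`. -/
noncomputable def diag (n : ℕ) (u : Fin 3 → (KPmod K n)ˣ) : KPmod K n →ₐ[K] KPmod K n :=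
  Ideal.Quotient.liftₐ ((mP K) ^ n)
    (AddMonoidAlgebra.lift K (KPmod K n) P (diagMonoidHom n u)) (diagMonoidHom_kills n u)

lemma diag_mono (n : ℕ) (u : Fin 3 → (KPmod K n)ˣ) (p : P) :
    diag n u (mono K n p) = ((∏ i, u i ^ (p.1 i) : (KPmod K n)ˣ) : KPmod K n) * mono K n p := by
  change AddMonoidAlgebra.lift K (KPmod K n) P (diagMonoidHom n u)
    (AddMonoidAlgebra.single p 1) = _
  rw [AddMonoidAlgebra.lift_single, one_smul]
  rfl

lemma diag_one (n : ℕ) : diag n (1 : Fin 3 → (KPmod K n)ˣ) = AlgHom.id K (KPmod K n) :=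
  algHom_ext_mono fun p => by simp [diag_mono]

/-- Both sides are multiplicative in the exponent, so the relation only needs to be checked in the
three basis directions of M. Each check is a single identity between units. -/
lemma cross_comp_diag {n : ℕ} {F : (KPmod K n)ˣ} {ν : M} {u v : Fin 3 → (KPmod K n)ˣ}
    (h : ∀ i, cross n F ν (u i) * ((F ^ ν i : (KPmod K n)ˣ) : KPmod K n) = v i) :
    (cross n F ν).comp (diag n u) = diag n v := by
  refine algHom_ext_mono fun p => ?_
  have h' : ∀ i, v i = Units.map (cross n F ν : KPmod K n →* KPmod K n) (u i) * F ^ ν i :=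
    fun i => Units.ext (h i).symm
  rw [AlgHom.comp_apply, diag_mono, map_mul, cross_mono, diag_mono, ← mul_assoc]
  congr 1
  have h2 : cross n F ν ((∏ i, u i ^ (p.1 i) : (KPmod K n)ˣ) : KPmod K n) =
      ((∏ i, Units.map (cross n F ν : KPmod K n →* KPmod K n) (u i) ^ (p.1 i) :
        (KPmod K n)ˣ) : KPmod K n) := by
    rw [Units.coe_prod, map_prod, Units.coe_prod]
    exact Finset.prod_congr rfl fun i _ => map_unit_zpow _ _ _
  rw [h2, ← Units.val_mul]
  congr 1
  have h3 : ∀ i, v i ^ p.1 i = Units.map (cross n F ν : KPmod K n →* KPmod K n) (u i) ^ p.1 i *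
      F ^ (ν i * p.1 i) := fun i => by
    rw [zpow_mul, h' i]
    exact mul_zpow (Units.map (cross n F ν : KPmod K n →* KPmod K n) (u i)) (F ^ ν i) (p.1 i)
  rw [Finset.prod_congr rfl fun i _ => h3 i, Finset.prod_mul_distrib]
  congr 1
  simp only [dotProduct, Fin.sum_univ_three, Fin.prod_univ_three, zpow_add]

/-! ### The wall functions of the final wall structure -/

/-- The exponent of `t₁x`. -/
def expX : P := (ray 0, Pi.single 0 1)

/-- The exponent of `t₂y`. -/
def expY : P := (ray 1, Pi.single 1 1)

lemma tx_eq : (t 0 * z (ray 0) : KP K) = AddMonoidAlgebra.single expX 1 := by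
  rw [t, z, AddMonoidAlgebra.single_mul_single, expX]; simp

lemma ty_eq : (t 1 * z (ray 1) : KP K) = AddMonoidAlgebra.single expY 1 := by
  rw [t, z, AddMonoidAlgebra.single_mul_single, expY]; simp

lemma deg_expX : deg expX = 1 := by simp [deg, expX]

lemma deg_expY : deg expY = 1 := by simp [deg, expY]

variable (K) in
/-- The class of `t₁x`. -/
noncomputable def varX (n : ℕ) : KPmod K n := mono K n expX

variable (K) in
/-- The class of `t₂y`. -/
noncomputable def varY (n : ℕ) : KPmod K n := mono K n expY

lemma varX_mem (n : ℕ) : varX K n ∈ filt K n 1 := mono_mem_filt n deg_expX.ge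

lemma varY_mem (n : ℕ) : varY K n ∈ filt K n 1 := mono_mem_filt n deg_expY.ge

lemma cross_varX (n : ℕ) (F : (KPmod K n)ˣ) (ν : M) :
    cross n F ν (varX K n) = ((F ^ ν 0 : (KPmod K n)ˣ) : KPmod K n) * varX K n := by
  rw [varX, cross_mono]
  congr 4
  simp [expX, ray, dotProduct, Fin.sum_univ_three]

lemma cross_varY (n : ℕ) (F : (KPmod K n)ˣ) (ν : M) :
    cross n F ν (varY K n) = ((F ^ ν 1 : (KPmod K n)ˣ) : KPmod K n) * varY K n := by
  rw [varY, cross_mono]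
  congr 4
  simp [expY, ray, dotProduct, Fin.sum_univ_three]

/-- `1 + a` as a unit, for `a` in the ideal. -/
noncomputable def oneAdd {n : ℕ} (a : KPmod K n) (h : a ∈ filt K n 1) : (KPmod K n)ˣ :=
  (isUnit_of_sub_one_mem (a := 1 + a) (by rwa [add_sub_cancel_left])).unit

@[simp] lemma val_oneAdd {n : ℕ} (a : KPmod K n) (h : a ∈ filt K n 1) :
    (oneAdd a h : KPmod K n) = 1 + a := IsUnit.unit_spec _

lemma oneAdd_ne_one {n : ℕ} {a : KPmod K n} {h : a ∈ filt K n 1} (ha : a ≠ 0) :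
    oneAdd a h ≠ 1 := fun h1 => ha (by
  have := congrArg Units.val h1
  simpa using this)

lemma mono_ne_zero {n : ℕ} {p : P} (h : deg p < n) : mono K n p ≠ 0 := fun h0 => by
  have h1 := coeffMod_mono (K := K) h p
  rw [if_pos rfl, h0] at h1
  exact zero_ne_one ((map_zero (coeffLin K p h)).symm.trans h1)

section Functions

variable (K) (n : ℕ)

/-- The class of `1 + t₁x`. -/
noncomputable def uX : (KPmod K n)ˣ := oneAdd (varX K n) (varX_mem n)

/-- The class of `1 + t₂y`. -/
noncomputable def uY : (KPmod K n)ˣ := oneAdd (varY K n) (varY_mem n)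

/-- The class of `1 + t₁t₂xy`. -/
noncomputable def uXY : (KPmod K n)ˣ :=
  oneAdd (varX K n * varY K n) (Ideal.mul_mem_left _ _ (varY_mem n))

/-- The class of `1 + t₁x + t₁t₂xy`. -/
noncomputable def uXXY : (KPmod K n)ˣ :=
  oneAdd (varX K n + varX K n * varY K n) (add_mem (varX_mem n) (Ideal.mul_mem_left _ _ (varY_mem n)))

/-- The class of `1 + t₂y + t₁t₂xy`. -/
noncomputable def uYXY : (KPmod K n)ˣ :=
  oneAdd (varY K n + varX K n * varY K n) (add_mem (varY_mem n) (Ideal.mul_mem_left _ _ (varY_mem n)))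

end Functions

/-! ### The fan of the final wall structure -/

/-- The rays in the plane of `e₁` and `e₂`, in cyclic order. -/
def planeRay : Fin 5 → M := ![![1, 0, 0], ![0, 1, 0], ![-1, 0, 0], ![-1, -1, 0], ![0, -1, 0]]

/-- The rays `e₃` and `e₄` off the plane of `e₁` and `e₂`. -/
def apex : Fin 2 → M := ![![0, 0, 1], ![-1, -1, -1]]

/-- The generators of the maximal cones. -/
def chamberGen (c : Fin 2 × Fin 5) : Fin 3 → M := ![planeRay c.2, planeRay (c.2 + 1), apex c.1]

/-- The dual bases of the generators of the maximal cones. -/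
def chamberDual (c : Fin 2 × Fin 5) : Fin 3 → M :=
  ![![![![1, 0, 0], ![0, 1, 0], ![-1, 1, 0], ![-1, 0, 0], ![0, -1, 0]],
      ![![1, 0, -1], ![0, 1, -1], ![-1, 1, 0], ![-1, 0, 1], ![0, -1, 1]]] c.1 c.2,
    ![![![0, 1, 0], ![-1, 0, 0], ![0, -1, 0], ![1, -1, 0], ![1, 0, 0]],
      ![![0, 1, -1], ![-1, 0, 1], ![0, -1, 1], ![1, -1, 0], ![1, 0, -1]]] c.1 c.2,
    ![![0, 0, 1], ![0, 0, -1]] c.1]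

/-- The first generator of the two-dimensional cone. The cones `(0, s)` lie in the plane of `e₁` and
`e₂`, the cones `(1, s)` contain `e₃` and the cones `(2, s)` contain `e₄`. -/
def cellFst (i : Fin 3 × Fin 5) : M := planeRay i.2

/-- The second generator of the two-dimensional cone. -/
def cellSnd (i : Fin 3 × Fin 5) : M := ![planeRay (i.2 + 1), apex 0, apex 1] i.1

/-- A vector completing the generators of the two-dimensional cone to a basis. -/
def cellCompl (i : Fin 3 × Fin 5) : M := ![apex 0, planeRay (i.2 + 1), planeRay (i.2 + 1)] i.1

/-- The maximal cone on the positive side of the two-dimensional cone. -/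
def posChamber (i : Fin 3 × Fin 5) : Fin 2 × Fin 5 := ![(0, i.2), (0, i.2), (1, i.2)] i.1

/-- The maximal cone on the negative side of the two-dimensional cone. -/
def negChamber (i : Fin 3 × Fin 5) : Fin 2 × Fin 5 := ![(1, i.2), (0, i.2 - 1), (1, i.2 - 1)] i.1

/-- The linear form that is `1` on the first generator of the two-dimensional cone. -/
def cellDualFst (i : Fin 3 × Fin 5) : M := chamberDual (posChamber i) 0

/-- The linear form that is `1` on the second generator of the two-dimensional cone. -/
def cellDualSnd (i : Fin 3 × Fin 5) : M := chamberDual (posChamber i) (![1, 2, 2] i.1)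

/-- The normal of the two-dimensional cone. -/
def cellNormal (i : Fin 3 × Fin 5) : M := chamberDual (posChamber i) (![2, 1, 1] i.1)

/-- The two-dimensional cones of the fan. -/
def cell (i : Fin 3 × Fin 5) : Set MR := cone (cellFst i) (cellSnd i)

/-- The maximal cones of the fan. -/
def chamber (c : Fin 2 × Fin 5) : Set MR := {x | ∀ j, 0 ≤ toReal (chamberDual c j) ⬝ᵥ x}

variable (K) in
/-- The product of the wall functions on the two-dimensional cone. -/
noncomputable def cellFun (n : ℕ) (i : Fin 3 × Fin 5) : (KPmod K n)ˣ :=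
  ![![uX K n * uY K n, uXXY K n, uXY K n, uXY K n, uYXY K n] i.2,
    ![uX K n, uY K n, uX K n, uXY K n, uY K n] i.2,
    ![uX K n, uY K n, uX K n, uXY K n, uY K n] i.2] i.1

variable (K) in
/-- The potential of the wall crossings on the maximal cones. -/
noncomputable def chamberUnits (n : ℕ) (c : Fin 2 × Fin 5) : Fin 3 → (KPmod K n)ˣ :=
  ![![1, uY K n, uYXY K n, uY K n, 1] c.2, ![1, 1, uX K n, uXXY K n, uX K n] c.2,
    ![1, cellFun K n (0, c.2)] c.1]

/-- The potential is 1 on the cone of e₁, e₂, e₃, and crossing the cones containing e₃ in turn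
determines the other values on that side. Passing to the e₄ side multiplies the third component by
the function of the planar cone. That everything closes up, around the plane and on the e₄ side, is
the content of consistency. -/
lemma chamberUnits_crossing (n : ℕ) (i : Fin 3 × Fin 5) :
    (cross n (cellFun K n i) (cellNormal i)).comp (diag n (chamberUnits K n (posChamber i))) =
      diag n (chamberUnits K n (negChamber i)) := by
  have hX := (uX K n).inv_mul
  have hY := (uY K n).inv_mul
  have hXY := (uXY K n).inv_mul
  simp only [uX, uY, uXY, val_oneAdd] at hX hY hXY
  set w : KPmod K n := Units.val
    (oneAdd (varX K n * varY K n) (Ideal.mul_mem_left _ _ (varY_mem n)))⁻¹ with hw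
  refine cross_comp_diag fun j => ?_
  obtain ⟨i, s⟩ := i
  fin_cases i <;> fin_cases s <;> fin_cases j <;>
    simp [cellFun, cellNormal, posChamber, negChamber, chamberUnits, chamberDual] <;>
    try simp [uX, uY, uXY, uXXY, uYXY, cross_varX, cross_varY]
  · linear_combination varY K n * hX
  · linear_combination varY K n * hXY
  · linear_combination (1 + varX K n + w * varX K n * varY K n) * hXY
  · ring
  · linear_combination (1 + varY K n + varX K n * varY K n) * hX
  · linear_combination varX K n * hY
  · linear_combination varY K n * hX
  · linear_combination varX K n * varY K n * hX
  · linear_combination varY K n * hXY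
  · linear_combination (1 + varX K n + w * varX K n * varY K n) * hXY
  · linear_combination varX K n * varY K n * hXY
  · ring
  · linear_combination (1 + varX K n * varY K n) * hY

/-! ### Geometry of the fan -/

lemma eq_sum_of_dual {u α : Fin 3 → M}
    (h : ∀ a b : Fin 3, ∑ j, α j a * u j b = if a = b then 1 else 0) (x : MR) :
    x = ∑ j, (toReal (α j) ⬝ᵥ x) • toReal (u j) := by
  have h' : ∀ a b : Fin 3, ∑ j, (α j a : ℝ) * (u j b : ℝ) = if a = b then 1 else 0 :=
    fun a b => by exact_mod_cast h a b
  ext b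
  simp only [Finset.sum_apply, Pi.smul_apply, smul_eq_mul, dotProduct, toReal, Finset.sum_mul]
  rw [Finset.sum_comm]
  have : ∀ a, ∑ j, (α j a : ℝ) * x a * (u j b : ℝ) = x a * if a = b then 1 else 0 := fun a => by
    rw [← h', Finset.mul_sum]
    exact Finset.sum_congr rfl fun j _ => by ring
  simp [this]

lemma chamber_dual_gen : ∀ c, ∀ a b : Fin 3,
    ∑ j, chamberDual c j a * chamberGen c j b = if a = b then 1 else 0 := by decide +kernel

lemma cell_dual_gen : ∀ i, ∀ a b : Fin 3,
    ∑ j : Fin 3, (![cellDualFst i, cellDualSnd i, cellNormal i] : Fin 3 → M) j a *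
      (![cellFst i, cellSnd i, cellCompl i] : Fin 3 → M) j b = if a = b then 1 else 0 := by
  decide +kernel

lemma cell_pairing : ∀ i, cellDualFst i ⬝ᵥ cellFst i = 1 ∧ cellDualFst i ⬝ᵥ cellSnd i = 0 ∧
    cellDualSnd i ⬝ᵥ cellFst i = 0 ∧ cellDualSnd i ⬝ᵥ cellSnd i = 1 ∧
    cellNormal i ⬝ᵥ cellFst i = 0 ∧ cellNormal i ⬝ᵥ cellSnd i = 0 ∧
    cellNormal i ⬝ᵥ cellCompl i = 1 := by decide +kernel

/-- A certificate that interior points of c lie in no other maximal cone: a facet inequality of c'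
is nonpositive on all generators of c and negative on one. The following certificates play the same
role for cones of dimension two. -/
lemma exists_separating_chamber : ∀ c c', c' ≠ c → ∃ j, (∀ k, chamberDual c' j ⬝ᵥ chamberGen c k ≤ 0) ∧
    ∃ k, chamberDual c' j ⬝ᵥ chamberGen c k < 0 := by decide +kernel

lemma exists_separating_cell_chamber : ∀ i c, c ≠ posChamber i → c ≠ negChamber i →
    ∃ j, chamberDual c j ⬝ᵥ cellFst i ≤ 0 ∧ chamberDual c j ⬝ᵥ cellSnd i ≤ 0 ∧
      chamberDual c j ⬝ᵥ cellFst i + chamberDual c j ⬝ᵥ cellSnd i < 0 := by decide +kernel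

lemma exists_separating_cell : ∀ i i', i' ≠ i →
    ∃ h ∈ [cellDualFst i', cellDualSnd i', cellNormal i', -cellNormal i'],
      h ⬝ᵥ cellFst i ≤ 0 ∧ h ⬝ᵥ cellSnd i ≤ 0 ∧ h ⬝ᵥ cellFst i + h ⬝ᵥ cellSnd i < 0 := by
  decide +kernel

lemma posChamber_ne_negChamber : ∀ i, posChamber i ≠ negChamber i := by decide +kernel

lemma cell_gen_nonneg : ∀ i j, 0 ≤ chamberDual (posChamber i) j ⬝ᵥ cellFst i ∧
    0 ≤ chamberDual (posChamber i) j ⬝ᵥ cellSnd i ∧ 0 ≤ chamberDual (negChamber i) j ⬝ᵥ cellFst i ∧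
    0 ≤ chamberDual (negChamber i) j ⬝ᵥ cellSnd i := by decide +kernel

lemma exists_cellNormal_eq : ∀ i, (∃ j, chamberDual (posChamber i) j = cellNormal i) ∧
    ∃ j, chamberDual (negChamber i) j = -cellNormal i := by decide +kernel

lemma exists_facet : ∀ c j, ∃ i,
    (cellFst i = chamberGen c (j + 1) ∧ cellSnd i = chamberGen c (j + 2)) ∨
    (cellFst i = chamberGen c (j + 2) ∧ cellSnd i = chamberGen c (j + 1)) := by decide +kernel

/-- The two-dimensional cones that contain `-e₁-e₂`. -/
def diagCells : Finset (Fin 3 × Fin 5) := {(0, 2), (0, 3), (1, 3), (2, 3)}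

lemma exists_separating_diag : ∀ i, i ∉ diagCells →
    ∃ h ∈ [cellDualFst i, cellDualSnd i, cellNormal i, -cellNormal i],
      h ⬝ᵥ planeRay 3 < 0 := by decide +kernel

lemma exists_separating_diag_chamber : ∀ c : Fin 2 × Fin 5, c.2 ≠ 2 → c.2 ≠ 3 →
    ∃ j, chamberDual c j ⬝ᵥ planeRay 3 < 0 := by decide +kernel

lemma mem_cell_iff (i : Fin 3 × Fin 5) (x : MR) : x ∈ cell i ↔
    0 ≤ toReal (cellDualFst i) ⬝ᵥ x ∧ 0 ≤ toReal (cellDualSnd i) ⬝ᵥ x ∧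
      toReal (cellNormal i) ⬝ᵥ x = 0 := by
  constructor
  · rintro ⟨a, b, ha, hb, rfl⟩
    obtain ⟨h1, h2, h3, h4, h5, h6, -⟩ := cell_pairing i
    simp only [dotProduct_add, dotProduct_smul, toReal_dot, h1, h2, h3, h4, h5, h6]
    simpa using ⟨ha, hb⟩
  · rintro ⟨h1, h2, h3⟩
    refine ⟨_, _, h1, h2, ?_⟩
    conv_lhs => rw [eq_sum_of_dual (cell_dual_gen i) x]
    simp [Fin.sum_univ_three, h3]

lemma nonneg_of_mem_cell {i : Fin 3 × Fin 5} {x : MR} (hx : x ∈ cell i) {h : M}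
    (hh : h ∈ [cellDualFst i, cellDualSnd i, cellNormal i, -cellNormal i]) :
    0 ≤ toReal h ⬝ᵥ x := by
  obtain ⟨h1, h2, h3⟩ := (mem_cell_iff i x).1 hx
  simp only [List.mem_cons, List.not_mem_nil, or_false] at hh
  rcases hh with rfl | rfl | rfl | rfl
  · exact h1
  · exact h2
  · exact h3.ge
  · rw [toReal_neg, neg_dotProduct, h3, neg_zero]

lemma zero_mem_cell (i : Fin 3 × Fin 5) : (0 : MR) ∈ cell i := ⟨0, 0, le_rfl, le_rfl, by simp⟩

lemma cellFst_mem_cell (i : Fin 3 × Fin 5) : toReal (cellFst i) ∈ cell i :=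
  ⟨1, 0, zero_le_one, le_rfl, by simp⟩

lemma cellSnd_mem_cell (i : Fin 3 × Fin 5) : toReal (cellSnd i) ∈ cell i :=
  ⟨0, 1, le_rfl, zero_le_one, by simp⟩

lemma direction_cell (i : Fin 3 × Fin 5) : (affineSpan ℝ (cell i)).direction =
    LinearMap.ker (dotProductBilin ℝ ℝ (toReal (cellNormal i))) := by
  refine le_antisymm (direction_le_ker fun x hx y hy => ?_) fun u hu => ?_
  · rw [((mem_cell_iff i x).1 hx).2.2, ((mem_cell_iff i y).1 hy).2.2]
  · have hu' : toReal (cellNormal i) ⬝ᵥ u = 0 := hu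
    have h1 : toReal (cellFst i) ∈ (affineSpan ℝ (cell i)).direction :=
      mem_direction_of_add_mem one_ne_zero (zero_mem_cell i) (by simpa using cellFst_mem_cell i)
    have h2 : toReal (cellSnd i) ∈ (affineSpan ℝ (cell i)).direction :=
      mem_direction_of_add_mem one_ne_zero (zero_mem_cell i) (by simpa using cellSnd_mem_cell i)
    rw [eq_sum_of_dual (cell_dual_gen i) u]
    simp only [Fin.sum_univ_three, Matrix.cons_val_zero, Matrix.cons_val_one, Matrix.cons_val,
      hu', zero_smul, add_zero]
    exact add_mem (Submodule.smul_mem _ _ h1) (Submodule.smul_mem _ _ h2)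

lemma cellNormal_ne_zero (i : Fin 3 × Fin 5) : cellNormal i ≠ 0 := fun h => by
  have := (cell_pairing i).2.2.2.2.2.2
  rw [h, zero_dotProduct] at this
  exact zero_ne_one this

lemma dim_cell (i : Fin 3 × Fin 5) : dim (cell i) = 2 := by
  rw [dim, direction_cell, finrank_ker_dot (toReal_ne_zero (cellNormal_ne_zero i))]

lemma isNormal_cell (i : Fin 3 × Fin 5) : IsNormal (cell i) (cellNormal i) :=
  isNormal_of_direction (cell_pairing i).2.2.2.2.2.2 fun u => by rw [direction_cell, mem_ker_dot]

lemma mem_tangentLattice_cell (i : Fin 3 × Fin 5) (m : M) :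
    m ∈ tangentLattice (cell i) ↔ cellNormal i ⬝ᵥ m = 0 := by
  change toReal m ∈ (affineSpan ℝ (cell i)).direction ↔ _
  rw [direction_cell, mem_ker_dot, toReal_dot, Int.cast_eq_zero]

lemma isRationalPolyhedron_cell (i : Fin 3 × Fin 5) : IsRationalPolyhedron (cell i) := by
  classical
  refine ⟨{(cellDualFst i, 0), (cellDualSnd i, 0), (cellNormal i, 0), (-cellNormal i, 0)}, ?_⟩
  ext x
  rw [mem_cell_iff]
  simp only [Finset.mem_insert, Finset.mem_singleton, Set.mem_ofPred_eq, forall_eq_or_imp,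
    forall_eq, Int.cast_zero, toReal_neg, neg_dotProduct]
  constructor
  · rintro ⟨h1, h2, h3⟩
    exact ⟨h1, h2, h3.ge, by rw [h3, neg_zero]⟩
  · rintro ⟨h1, h2, h3, h4⟩
    exact ⟨h1, h2, by linarith⟩

lemma isWall_of_carrier_eq {d : Wall K} {i : Fin 3 × Fin 5} (hc : d.carrier = cell i)
    (hs : SupportedOn d.func {p | cellNormal i ⬝ᵥ p.1 = 0}) (h1 : trunc 1 d.func = 1) :
    IsWall d where
  polyhedron := hc ▸ isRationalPolyhedron_cell i
  codim_one := hc ▸ dim_cell i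
  tangent := by
    simpa only [hc, mem_tangentLattice_cell] using hs
  func_one := h1

/-- From a point where a dual coordinate vanishes, a small move against the corresponding generator
stays in the plane but makes that coordinate negative, leaving the cone. -/
lemma mem_frontier_cell {d : Wall K} (hd : IsWall d) {i : Fin 3 × Fin 5} (hc : d.carrier = cell i)
    {x : MR} (hx : x ∈ cell i)
    (h0 : toReal (cellDualFst i) ⬝ᵥ x = 0 ∨ toReal (cellDualSnd i) ⬝ᵥ x = 0) :
    x ∈ intrinsicFrontier ℝ d.carrier := by
  by_contra hf
  have h := (hd.notMem_frontier_iff (hc ▸ isNormal_cell i) (hc ▸ hx)).1 hf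
  obtain ⟨p1, p2, p3, p4, p5, p6, -⟩ := cell_pairing i
  have key : ∀ v w : M, toReal v ⬝ᵥ x = 0 → v ⬝ᵥ w = 1 → cellNormal i ⬝ᵥ w = 0 →
      (∀ y ∈ cell i, 0 ≤ toReal v ⬝ᵥ y) → False := by
    intro v w hv hvw hnw hpos
    obtain ⟨δ, hδ, hall⟩ := exists_pos_of_eventually_add (u := -toReal w) h
    have h2 := hall (δ / 2) (by rw [abs_of_pos (by positivity)]; linarith) (by
      rw [dotProduct_add, dotProduct_smul, dotProduct_neg, toReal_dot, hnw]; simp)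
    rw [hc] at h2
    have h3 := hpos _ h2
    rw [dotProduct_add, dotProduct_smul, dotProduct_neg, toReal_dot, hvw, hv] at h3
    simp at h3
    linarith
  rcases h0 with h0 | h0
  · exact key _ _ h0 p1 p5 fun y hy => ((mem_cell_iff i y).1 hy).1
  · exact key _ _ h0 p4 p6 fun y hy => ((mem_cell_iff i y).1 hy).2.1

lemma exists_mem_chamber (x : MR) : ∃ c, x ∈ chamber c := by
  have key : ∀ c : Fin 2 × Fin 5, x ∈ chamber c ↔ 0 ≤ toReal (chamberDual c 0) ⬝ᵥ x ∧
    0 ≤ toReal (chamberDual c 1) ⬝ᵥ x ∧ 0 ≤ toReal (chamberDual c 2) ⬝ᵥ x := fun c => by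
    simp [chamber, Fin.forall_fin_succ]
  simp only [key]
  simp only [Prod.exists, Fin.exists_fin_succ, chamberDual, toReal, dotProduct, Fin.sum_univ_three]
  simp
  -- The sign of x 2 selects e₃ or e₄. In the second case removal of the e₄-component replaces x 0
  -- and x 1 by x 0 - x 2 and x 1 - x 2. The comparison of x 0 with x 1 is needed only to place the
  -- ray -e₁-e₂.
  rcases le_total 0 (x 2) with hz | hz
  · rcases le_total 0 (x 0) with h0 | h0 <;> rcases le_total 0 (x 1) with h1 | h1 <;>
      rcases le_total (x 0) (x 1) with h01 | h01 <;> grind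
  · rcases le_total (x 2) (x 0) with h0 | h0 <;> rcases le_total (x 2) (x 1) with h1 | h1 <;>
      rcases le_total (x 0) (x 1) with h01 | h01 <;> grind

lemma eventually_mem_chamber (x : MR) : ∀ᶠ y in 𝓝 x, ∀ c, y ∈ chamber c → x ∈ chamber c := by
  refine eventually_all.2 fun c => ?_
  by_cases hx : x ∈ chamber c
  · exact Eventually.of_forall fun _ _ => hx
  · have hcl : IsClosed (chamber c) := by
      have : chamber c = ⋂ j, {x | 0 ≤ toReal (chamberDual c j) ⬝ᵥ x} := by
        ext; simp [chamber]
      rw [this]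
      exact isClosed_iInter fun j => isClosed_le continuous_const (continuous_dot _)
    filter_upwards [hcl.isOpen_compl.mem_nhds hx] with y hy h
    exact absurd h hy

lemma cell_subset_chamber (i : Fin 3 × Fin 5) :
    cell i ⊆ chamber (posChamber i) ∧ cell i ⊆ chamber (negChamber i) := by
  constructor
  all_goals
    rintro _ ⟨a, b, ha, hb, rfl⟩ j
    obtain ⟨h1, h2, h3, h4⟩ := cell_gen_nonneg i j
    rw [dotProduct_add, dotProduct_smul, dotProduct_smul, toReal_dot, toReal_dot]
    have h1' := Int.cast_nonneg (R := ℝ) h1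
    have h2' := Int.cast_nonneg (R := ℝ) h2
    have h3' := Int.cast_nonneg (R := ℝ) h3
    have h4' := Int.cast_nonneg (R := ℝ) h4
    simp only [smul_eq_mul]
    positivity

/-! ### Consistency of wall structures on the fan -/

open Classical in
/-- A finite set of walls supported on the two-dimensional cones of the fan, whose functions
multiply up to those of the final wall structure. -/
structure IsModel (D : Finset (Wall K)) (n : ℕ) : Prop where
  isWall : ∀ d ∈ D, IsWall d
  carrier : ∀ d ∈ D, ∃ i, d.carrier = cell i ∧ (i ∈ diagCells → cellFun K n i ≠ 1)
  prod : ∀ i, ∏ d ∈ D with d.carrier = cell i, truncUnit n d.func = cellFun K n i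

/-- A maximal cone of the fan containing the point. -/
noncomputable def chamberOf (x : MR) : Fin 2 × Fin 5 := (exists_mem_chamber x).choose

lemma mem_chamberOf (x : MR) : x ∈ chamber (chamberOf x) := (exists_mem_chamber x).choose_spec

variable (K) in
/-- The potential of the wall crossings of the final wall structure. -/
noncomputable def potential (n : ℕ) (x : MR) : KPmod K n →ₐ[K] KPmod K n :=
  diag n (chamberUnits K n (chamberOf x))

lemma eventually_chamberOf_mem (x : MR) : ∀ᶠ y in 𝓝 x, x ∈ chamber (chamberOf y) := by
  filter_upwards [eventually_mem_chamber x] with y hy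
  exact hy _ (mem_chamberOf y)

lemma dot_combination (h u v : M) (a b : ℝ) : toReal h ⬝ᵥ (a • toReal u + b • toReal v) =
    a * ((h ⬝ᵥ u : ℤ) : ℝ) + b * ((h ⬝ᵥ v : ℤ) : ℝ) := by
  rw [dotProduct_add, dotProduct_smul, dotProduct_smul, toReal_dot, toReal_dot]; rfl

lemma dot_combination_neg {h u v : M} {a b : ℝ} (ha : 0 < a) (hb : 0 < b) (h1 : h ⬝ᵥ u ≤ 0)
    (h2 : h ⬝ᵥ v ≤ 0) (h3 : h ⬝ᵥ u + h ⬝ᵥ v < 0) :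
    toReal h ⬝ᵥ (a • toReal u + b • toReal v) < 0 := by
  rw [dot_combination]
  have h1' : ((h ⬝ᵥ u : ℤ) : ℝ) ≤ 0 := by exact_mod_cast h1
  have h2' : ((h ⬝ᵥ v : ℤ) : ℝ) ≤ 0 := by exact_mod_cast h2
  rcases h1.lt_or_eq with h4 | h4
  · have : ((h ⬝ᵥ u : ℤ) : ℝ) < 0 := by exact_mod_cast h4
    nlinarith
  · have : ((h ⬝ᵥ v : ℤ) : ℝ) < 0 := by
      have : h ⬝ᵥ v < 0 := by omega
      exact_mod_cast this
    nlinarith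

namespace IsModel

variable {D : Finset (Wall K)} {n : ℕ}

lemma mem_carrier_iff (hD : IsModel D n) {i : Fin 3 × Fin 5} {a b : ℝ} (ha : 0 < a) (hb : 0 < b)
    {d : Wall K} (hd : d ∈ D) :
    a • toReal (cellFst i) + b • toReal (cellSnd i) ∈ d.carrier ↔ d.carrier = cell i := by
  constructor
  · intro hx
    obtain ⟨i', hi', -⟩ := hD.carrier d hd
    rw [hi'] at hx ⊢
    by_contra hne
    obtain ⟨h, hh, h1, h2, h3⟩ := exists_separating_cell i i' (fun h => hne (h ▸ rfl))
    exact absurd (nonneg_of_mem_cell hx hh) (not_le.2 (dot_combination_neg ha hb h1 h2 h3))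
  · intro h
    rw [h]
    exact ⟨a, b, ha.le, hb.le, rfl⟩

lemma isPotentialAt_cell (hD : IsModel D n) (i : Fin 3 × Fin 5) {a b : ℝ} (ha : 0 < a)
    (hb : 0 < b) :
    IsPotentialAt D n (potential K n) (a • toReal (cellFst i) + b • toReal (cellSnd i)) := by
  classical
  set x := a • toReal (cellFst i) + b • toReal (cellSnd i) with hx
  have hprod : prodAt D n x = cellFun K n i := by
    rw [← hD.prod i, prodAt]
    exact Finset.prod_congr (Finset.filter_congr fun d hd => hD.mem_carrier_iff ha hb hd)
      fun _ _ => rfl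
  have hev : ∀ᶠ y in 𝓝 x, chamberOf y = posChamber i ∨ chamberOf y = negChamber i := by
    filter_upwards [eventually_chamberOf_mem x] with y hy
    by_contra! hne
    obtain ⟨j, h1, h2, h3⟩ := exists_separating_cell_chamber i _ hne.1 hne.2
    exact absurd (hy j) (not_le.2 (dot_combination_neg ha hb h1 h2 h3))
  have hx0 : toReal (cellNormal i) ⬝ᵥ x = 0 :=
    ((mem_cell_iff i x).1 ⟨a, b, ha.le, hb.le, rfl⟩).2.2
  constructor
  · intro hno
    -- If the cone carries no wall at this order, its function is 1 and the potential takes the same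
    -- value on both sides.
    have hF : cellFun K n i = 1 := by rw [← hprod, prodAt_eq_one hno]
    have heq : diag n (chamberUnits K n (posChamber i)) =
        diag n (chamberUnits K n (negChamber i)) := by
      rw [← chamberUnits_crossing, hF, cross_one, AlgHom.id_comp]
    have hall : ∀ᶠ y in 𝓝 x, potential K n y = diag n (chamberUnits K n (posChamber i)) := by
      filter_upwards [hev] with y hy
      rcases hy with hy | hy
      · rw [potential, hy]
      · rw [potential, hy, heq]
    filter_upwards [hall] with y hy
    rw [hy, hall.self_of_nhds]
  · rintro ⟨d, hd, hxd⟩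
    have hc := (hD.mem_carrier_iff ha hb hd).1 hxd
    refine ⟨d, hd, hxd, cellNormal i, hc ▸ isNormal_cell i,
      diag n (chamberUnits K n (posChamber i)), diag n (chamberUnits K n (negChamber i)), ?_, ?_⟩
    · rw [hprod, chamberUnits_crossing]
    · obtain ⟨⟨j, hj⟩, j', hj'⟩ := exists_cellNormal_eq i
      filter_upwards [hev] with y hy
      rw [hx0]
      have hy' := mem_chamberOf y
      rcases hy with hy | hy
      · rw [hy] at hy'
        refine ⟨fun _ => by rw [potential, hy], fun h => ?_⟩
        have := hy' j
        rw [hj] at this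
        exact absurd h this.not_gt
      · rw [hy] at hy'
        refine ⟨fun h => ?_, fun _ => by rw [potential, hy]⟩
        have := hy' j'
        rw [hj', toReal_neg, neg_dotProduct] at this
        linarith

lemma isPotentialAt_chamber (hD : IsModel D n) {x : MR} {c : Fin 2 × Fin 5}
    (hx : ∀ j, 0 < toReal (chamberDual c j) ⬝ᵥ x) : IsPotentialAt D n (potential K n) x := by
  have huniq : ∀ c', x ∈ chamber c' → c' = c := by
    intro c' hc'
    by_contra hne
    obtain ⟨j, h1, k, h2⟩ := exists_separating_chamber c c' hne
    have h3 := hc' j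
    rw [eq_sum_of_dual (chamber_dual_gen c) x, dotProduct_sum] at h3
    refine absurd h3 (not_le.2 (Finset.sum_neg' (fun l _ => ?_) ⟨k, Finset.mem_univ _, ?_⟩))
    · rw [dotProduct_smul, toReal_dot, smul_eq_mul]
      exact mul_nonpos_of_nonneg_of_nonpos (hx l).le (by exact_mod_cast h1 l)
    · rw [dotProduct_smul, toReal_dot, smul_eq_mul]
      exact mul_neg_of_pos_of_neg (hx k) (by exact_mod_cast h2)
  constructor
  · intro _
    filter_upwards [eventually_chamberOf_mem x] with y hy
    rw [potential, potential, huniq _ hy, huniq _ (mem_chamberOf x)]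
  · rintro ⟨d, hd, hxd⟩
    obtain ⟨i, hi, -⟩ := hD.carrier d hd
    rw [hi] at hxd
    exact absurd ((huniq _ ((cell_subset_chamber i).1 hxd)).trans
      (huniq _ ((cell_subset_chamber i).2 hxd)).symm) (posChamber_ne_negChamber i)

lemma exists_wall (hD : IsModel D n) {i : Fin 3 × Fin 5} (hi : cellFun K n i ≠ 1) :
    ∃ d ∈ D, d.carrier = cell i := by
  classical
  by_contra! h
  refine hi ?_
  rw [← hD.prod i, Finset.filter_false_of_mem h, Finset.prod_empty]

lemma mem_sing (hD : IsModel D n) {i : Fin 3 × Fin 5} (hi : cellFun K n i ≠ 1) {x : MR}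
    (hx : x ∈ cell i)
    (h0 : toReal (cellDualFst i) ⬝ᵥ x = 0 ∨ toReal (cellDualSnd i) ⬝ᵥ x = 0) :
    x ∈ Sing (D : Set (Wall K)) := by
  obtain ⟨d, hd, hc⟩ := hD.exists_wall hi
  exact Or.inl ⟨d, hd, mem_frontier_cell (hD.isWall d hd) hc hx h0⟩

lemma smul_cellFst_mem_sing (hD : IsModel D n) {i : Fin 3 × Fin 5} (hi : cellFun K n i ≠ 1) {r : ℝ}
    (hr : 0 ≤ r) : r • toReal (cellFst i) ∈ Sing (D : Set (Wall K)) :=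
  hD.mem_sing hi ⟨r, 0, hr, le_rfl, by simp⟩
    (Or.inr (by rw [dotProduct_smul, toReal_dot, (cell_pairing i).2.2.1]; simp))

lemma smul_cellSnd_mem_sing (hD : IsModel D n) {i : Fin 3 × Fin 5} (hi : cellFun K n i ≠ 1) {r : ℝ}
    (hr : 0 ≤ r) : r • toReal (cellSnd i) ∈ Sing (D : Set (Wall K)) :=
  hD.mem_sing hi ⟨0, r, le_rfl, hr, by simp⟩
    (Or.inl (by rw [dotProduct_smul, toReal_dot, (cell_pairing i).2.1]; simp))

/-- When t₁t₂xy vanishes, the four walls containing -e₁-e₂ are trivial and this ray need not be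
singular, so a loop may pass through it. The potential is then constant on the four maximal cones
around the ray. -/
lemma isPotentialAt_diag (hD : IsModel D n) (hXY : varX K n * varY K n = 0) {r : ℝ} (hr : 0 < r) :
    IsPotentialAt D n (potential K n) (r • toReal (planeRay 3)) := by
  have h1 : uXY K n = 1 := by ext; simp [uXY, hXY]
  have h2 : uXXY K n = uX K n := by ext; simp [uXXY, uX, hXY]
  have h3 : uYXY K n = uY K n := by ext; simp [uYXY, uY, hXY]
  have hall : ∀ᶠ y in 𝓝 (r • toReal (planeRay 3)),
      potential K n y = diag n (chamberUnits K n (0, 2)) := by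
    filter_upwards [eventually_chamberOf_mem (r • toReal (planeRay 3))] with y hy
    rw [potential]
    generalize chamberOf y = c at hy
    congr 1
    by_cases hc : c.2 = 2 ∨ c.2 = 3
    · obtain ⟨k, s⟩ := c
      ext j
      fin_cases k <;> rcases hc with rfl | rfl <;> fin_cases j <;>
        simp [chamberUnits, cellFun, h1, h2, h3]
    · push Not at hc
      obtain ⟨j, hj⟩ := exists_separating_diag_chamber c hc.1 hc.2
      have := hy j
      rw [dotProduct_smul, toReal_dot, smul_eq_mul] at this
      exact absurd this (not_le.2 (mul_neg_of_pos_of_neg hr (by exact_mod_cast hj)))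
  constructor
  · intro _
    filter_upwards [hall] with y hy
    rw [hy, hall.self_of_nhds]
  · rintro ⟨d, hd, hxd⟩
    obtain ⟨i, hi, hi'⟩ := hD.carrier d hd
    rw [hi] at hxd
    by_cases hid : i ∈ diagCells
    · refine absurd ?_ (hi' hid)
      simp only [diagCells, Finset.mem_insert, Finset.mem_singleton] at hid
      rcases hid with rfl | rfl | rfl | rfl <;> simp [cellFun, h1]
    · obtain ⟨h, hh, hneg⟩ := exists_separating_diag i hid
      have := nonneg_of_mem_cell hxd hh
      rw [dotProduct_smul, toReal_dot, smul_eq_mul] at this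
      exact absurd this (not_le.2 (mul_neg_of_pos_of_neg hr (by exact_mod_cast hneg)))

/-- Once n ≥ 2, the rays of ±e₁, ±e₂, e₃ and e₄ bound nontrivial walls and so are singular. What
remains are interiors of maximal and of two-dimensional cones, and possibly the ray of -e₁-e₂. -/
lemma isPotentialAt (hD : IsModel D n) (hn : 2 ≤ n) {x : MR} (hx : x ∉ Sing (D : Set (Wall K))) :
    IsPotentialAt D n (potential K n) x := by
  have huX : uX K n ≠ 1 := oneAdd_ne_one (mono_ne_zero (by rw [deg_expX]; omega))
  have huY : uY K n ≠ 1 := oneAdd_ne_one (mono_ne_zero (by rw [deg_expY]; omega))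
  have hapex : ∀ k, ∀ r : ℝ, 0 ≤ r → x ≠ r • toReal (apex k) := by
    rintro k r hr rfl
    fin_cases k
    · exact hx (hD.smul_cellSnd_mem_sing (i := (1, 0)) huX hr)
    · exact hx (hD.smul_cellSnd_mem_sing (i := (2, 0)) huX hr)
  have hray : ∀ s, ∀ r : ℝ, 0 ≤ r → x = r • toReal (planeRay s) →
      IsPotentialAt D n (potential K n) x := by
    rintro s r hr hxr
    have key : cellFun K n (1, s) = 1 := by
      by_contra hne
      exact hx (hxr ▸ hD.smul_cellFst_mem_sing (i := (1, s)) hne hr)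
    have hr0 : r ≠ 0 := by
      rintro rfl
      exact hapex 0 0 le_rfl (by rw [hxr]; simp)
    fin_cases s
    · exact absurd key huX
    · exact absurd key huY
    · exact absurd key huX
    · rw [hxr]
      refine hD.isPotentialAt_diag ?_ (lt_of_le_of_ne hr hr0.symm)
      have := congrArg Units.val (show uXY K n = 1 from key)
      simpa [uXY] using this
    · exact absurd key huY
  obtain ⟨c, hc⟩ := exists_mem_chamber x
  have hsum := eq_sum_of_dual (chamber_dual_gen c) x
  by_cases hpos : ∀ j, 0 < toReal (chamberDual c j) ⬝ᵥ x
  · exact hD.isPotentialAt_chamber hpos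
  push Not at hpos
  obtain ⟨j, hj⟩ := hpos
  have hj0 : toReal (chamberDual c j) ⬝ᵥ x = 0 := le_antisymm hj (hc j)
  have hsum' : x = (toReal (chamberDual c (j + 1)) ⬝ᵥ x) • toReal (chamberGen c (j + 1)) +
      (toReal (chamberDual c (j + 2)) ⬝ᵥ x) • toReal (chamberGen c (j + 2)) := by
    rw [Fin.sum_univ_three] at hsum
    conv_lhs => rw [hsum]
    fin_cases j
    · simp only [Fin.zero_eta] at hj0 ⊢
      rw [hj0, zero_smul, zero_add]; rfl
    · simp only [Fin.mk_one] at hj0 ⊢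
      rw [hj0, zero_smul, add_zero, add_comm]; rfl
    · simp only [Fin.reduceFinMk] at hj0 ⊢
      rw [hj0, zero_smul, add_zero]; rfl
  have hgen : ∀ k, ∀ r : ℝ, 0 ≤ r → x = r • toReal (chamberGen c k) →
      IsPotentialAt D n (potential K n) x := by
    intro k r hr hxr
    fin_cases k
    · exact hray c.2 r hr hxr
    · exact hray (c.2 + 1) r hr hxr
    · exact absurd hxr (hapex _ r hr)
  rcases (hc (j + 1)).eq_or_lt with h1 | h1
  · rw [← h1, zero_smul, zero_add] at hsum'
    exact hgen _ _ (hc (j + 2)) hsum'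
  rcases (hc (j + 2)).eq_or_lt with h2 | h2
  · rw [← h2, zero_smul, add_zero] at hsum'
    exact hgen _ _ (hc (j + 1)) hsum'
  obtain ⟨i, ⟨e1, e2⟩ | ⟨e1, e2⟩⟩ := exists_facet c j
  · rw [hsum', ← e1, ← e2]
    exact hD.isPotentialAt_cell i h1 h2
  · rw [hsum', ← e1, ← e2, add_comm]
    exact hD.isPotentialAt_cell i h2 h1

end IsModel

/-! ### Surjectivity of the potential and global consistency -/

lemma mono_mem_suppSub (n : ℕ) {S : Set P} {p : P} (h : p ∈ S) : mono K n p ∈ suppSub K n S :=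
  Submodule.subset_span ⟨p, h, rfl⟩

lemma cellFun_mem (n : ℕ) (i : Fin 3 × Fin 5) :
    (cellFun K n i : KPmod K n) ∈ suppSub K n {p | cellNormal i ⬝ᵥ p.1 = 0} := by
  have h1 : ∀ ν : M, (1 : KPmod K n) ∈ suppSub K n {p | ν ⬝ᵥ p.1 = 0} := fun ν =>
    one_mem_suppSub n (dotProduct_zero ν)
  have hX : ∀ ν : M, ν ⬝ᵥ expX.1 = 0 → varX K n ∈ suppSub K n {p | ν ⬝ᵥ p.1 = 0} := fun ν h =>
    mono_mem_suppSub n h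
  have hY : ∀ ν : M, ν ⬝ᵥ expY.1 = 0 → varY K n ∈ suppSub K n {p | ν ⬝ᵥ p.1 = 0} := fun ν h =>
    mono_mem_suppSub n h
  have hXY : ∀ ν : M, ν ⬝ᵥ (expX + expY).1 = 0 →
      varX K n * varY K n ∈ suppSub K n {p | ν ⬝ᵥ p.1 = 0} := fun ν h => by
    rw [varX, varY, ← mono_add]
    exact mono_mem_suppSub n h
  have hmul : ∀ (ν : M) {a b : KPmod K n}, a ∈ suppSub K n {p | ν ⬝ᵥ p.1 = 0} →
      b ∈ suppSub K n {p | ν ⬝ᵥ p.1 = 0} → a * b ∈ suppSub K n {p | ν ⬝ᵥ p.1 = 0} :=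
    fun ν _ _ => mul_mem_suppSub fun p hp q hq => by
      rw [Set.mem_ofPred_eq, Prod.fst_add, dotProduct_add, hp, hq, add_zero]
  have uXm : ∀ ν : M, ν ⬝ᵥ expX.1 = 0 →
      (uX K n : KPmod K n) ∈ suppSub K n {p | ν ⬝ᵥ p.1 = 0} := fun ν h => by
    rw [uX, val_oneAdd]
    exact add_mem (h1 ν) (hX ν h)
  have uYm : ∀ ν : M, ν ⬝ᵥ expY.1 = 0 →
      (uY K n : KPmod K n) ∈ suppSub K n {p | ν ⬝ᵥ p.1 = 0} := fun ν h => by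
    rw [uY, val_oneAdd]
    exact add_mem (h1 ν) (hY ν h)
  have uXYm : ∀ ν : M, ν ⬝ᵥ (expX + expY).1 = 0 →
      (uXY K n : KPmod K n) ∈ suppSub K n {p | ν ⬝ᵥ p.1 = 0} := fun ν h => by
    rw [uXY, val_oneAdd]
    exact add_mem (h1 ν) (hXY ν h)
  have uXXYm : ∀ ν : M, ν ⬝ᵥ expX.1 = 0 → ν ⬝ᵥ (expX + expY).1 = 0 →
      (uXXY K n : KPmod K n) ∈ suppSub K n {p | ν ⬝ᵥ p.1 = 0} := fun ν h h' => by
    rw [uXXY, val_oneAdd]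
    exact add_mem (h1 ν) (add_mem (hX ν h) (hXY ν h'))
  have uYXYm : ∀ ν : M, ν ⬝ᵥ expY.1 = 0 → ν ⬝ᵥ (expX + expY).1 = 0 →
      (uYXY K n : KPmod K n) ∈ suppSub K n {p | ν ⬝ᵥ p.1 = 0} := fun ν h h' => by
    rw [uYXY, val_oneAdd]
    exact add_mem (h1 ν) (add_mem (hY ν h) (hXY ν h'))
  obtain ⟨i, s⟩ := i
  fin_cases i <;> fin_cases s
  · exact hmul _ (uXm _ (by decide)) (uYm _ (by decide))
  · exact uXXYm _ (by decide) (by decide)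
  · exact uXYm _ (by decide)
  · exact uXYm _ (by decide)
  · exact uYXYm _ (by decide) (by decide)
  all_goals first
    | exact uXm _ (by decide)
    | exact uYm _ (by decide)
    | exact uXYm _ (by decide)

/-- The potential is the identity on one maximal cone, and all the others are reached by crossings,
which are bijective. -/
lemma potential_surjective (n : ℕ) (x : MR) : Function.Surjective (potential K n x) := by
  have hneg : ∀ i : Fin 3 × Fin 5,
      Function.Surjective (diag n (chamberUnits K n (posChamber i))) →
      Function.Surjective (diag n (chamberUnits K n (negChamber i))) := by
    intro i hi
    rw [← chamberUnits_crossing, AlgHom.coe_comp]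
    exact (cross_bijective _ (cellFun_mem n i)).2.comp hi
  have h0 : Function.Surjective (diag n (chamberUnits K n (0, 0))) := by
    have : chamberUnits K n (0, 0) = 1 := by
      ext j; fin_cases j <;> simp [chamberUnits]
    rw [this, diag_one]
    exact Function.surjective_id
  have h4 : Function.Surjective (diag n (chamberUnits K n (0, 4))) := hneg (1, 0) h0
  have h3 : Function.Surjective (diag n (chamberUnits K n (0, 3))) := hneg (1, 4) h4
  have h2 : Function.Surjective (diag n (chamberUnits K n (0, 2))) := hneg (1, 3) h3
  have h1 : Function.Surjective (diag n (chamberUnits K n (0, 1))) := hneg (1, 2) h2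
  rw [potential]
  generalize chamberOf x = c
  obtain ⟨k, s⟩ := c
  have hup : Function.Surjective (diag n (chamberUnits K n (0, s))) := by
    fin_cases s
    exacts [h0, h1, h2, h3, h4]
  fin_cases k
  · exact hup
  · exact hneg (0, s) hup

/-- A wall structure that is to every order a model of the final one is consistent. -/
theorem isConsistent_of_isModel {D : Set (Wall K)} (h : ∀ n ≤ 1, atOrder D n = ∅)
    (h' : ∀ n, 2 ≤ n → ∃ Dn : Finset (Wall K), (Dn : Set (Wall K)) = atOrder D n ∧ IsModel Dn n) :
    IsConsistent D := by
  intro n j _ x _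
  -- The potential is global, so loops need not be small. At orders up to 1 no walls are left and
  -- there is nothing to cross.
  refine ⟨Set.univ, univ_mem, fun γ hγ hloop _ θ hθ => ?_⟩
  rcases Nat.lt_or_ge n 2 with hn | hn
  · obtain ⟨L, -, -, hL, rfl⟩ := hθ
    have : L = [] := List.eq_nil_iff_forall_not_mem.2 fun c hc => by
      have := ((hL c).1 hc).2.1
      rw [h n (by omega)] at this
      exact this
    rw [this, List.foldl_nil]
  · obtain ⟨Dn, hDn, hmod⟩ := h' n hn
    rw [← hDn] at hγ hθ
    exact eq_id_of_potential Dn hmod.isWall hγ hloop hθ (potential K n)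
      (fun t ht => hmod.isPotentialAt hn (hγ.avoids t ht)) (potential_surjective n _)

/-! ### Wall structures on the fan given by sets of functions -/

/-- The walls on the two-dimensional cones of the fan with functions from the given sets. -/
def wallsOf (f : Fin 3 × Fin 5 → Set (KPhat K)) : Set (Wall K) :=
  {d | ∃ i, d.carrier = cell i ∧ d.func ∈ f i}

lemma cell_injective : Function.Injective cell := by
  intro i i' h
  by_contra hne
  obtain ⟨g, hg, h1, h2, h3⟩ := exists_separating_cell i i' (Ne.symm hne)
  have hm : (1 : ℝ) • toReal (cellFst i) + (1 : ℝ) • toReal (cellSnd i) ∈ cell i' := by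
    rw [← h]
    exact ⟨1, 1, zero_le_one, zero_le_one, rfl⟩
  exact absurd (nonneg_of_mem_cell hm hg)
    (not_le.2 (dot_combination_neg one_pos one_pos h1 h2 h3))

lemma truncUnit_eq_one {n : ℕ} {f : KPhat K} (h1 : trunc 1 f = 1) (h : trunc n f = 1) :
    truncUnit n f = 1 := by
  ext
  rw [val_truncUnit h1, h, Units.val_one]

lemma trunc_eq_one {n : ℕ} (hn : n ≤ 1) {f : KPhat K} (h1 : trunc 1 f = 1) : trunc n f = 1 := by
  rw [trunc_of_le hn, h1, map_one]

/-- Functions on the two-dimensional cones of the fan that multiply up to those of the final wall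
structure. -/
structure IsFunctionModel (f : Fin 3 × Fin 5 → Set (KPhat K)) : Prop where
  func_one : ∀ i, ∀ g ∈ f i, trunc 1 g = 1
  tangent : ∀ i, ∀ g ∈ f i, SupportedOn g {p | cellNormal i ⬝ᵥ p.1 = 0}
  prod : ∀ i n, ∃ S : Finset (KPhat K), (∀ g, g ∈ S ↔ g ∈ f i ∧ trunc n g ≠ 1) ∧
    ∏ g ∈ S, truncUnit n g = cellFun K n i
  diag : ∀ i ∈ diagCells, (f i).Subsingleton

namespace IsFunctionModel

variable {f : Fin 3 × Fin 5 → Set (KPhat K)}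

lemma isWall (hf : IsFunctionModel f) : ∀ d ∈ wallsOf f, IsWall d := by
  rintro d ⟨i, hc, hd⟩
  exact isWall_of_carrier_eq hc (hf.tangent i _ hd) (hf.func_one i _ hd)

lemma finite_atOrder (hf : IsFunctionModel f) (n : ℕ) : (atOrder (wallsOf f) n).Finite := by
  classical
  choose S hS _ using fun i => hf.prod i n
  refine ((Finset.univ : Finset (Fin 3 × Fin 5)).biUnion fun i =>
    (S i).image fun g => (⟨cell i, g⟩ : Wall K)).finite_toSet.subset ?_
  rintro d ⟨⟨i, hc, hd⟩, hn⟩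
  simp only [Finset.coe_biUnion, Set.mem_iUnion, Finset.coe_image, Set.mem_image]
  exact ⟨i, Finset.mem_univ _, d.func, (hS i _).2 ⟨hd, hn⟩, Wall.ext hc.symm rfl⟩

lemma isWallStructure (hf : IsFunctionModel f) : IsWallStructure (wallsOf f) :=
  ⟨hf.isWall, hf.finite_atOrder⟩

lemma isModel (hf : IsFunctionModel f) {n : ℕ} {D : Finset (Wall K)}
    (hD : (D : Set (Wall K)) = atOrder (wallsOf f) n) : IsModel D n where
  isWall d hd := hf.isWall d (hD.subset hd).1
  carrier d hd := by
    obtain ⟨⟨i, hc, hdf⟩, hn⟩ := hD.subset hd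
    refine ⟨i, hc, fun hi h1 => hn ?_⟩
    obtain ⟨S, hS, hprod⟩ := hf.prod i n
    -- A cone containing -e₁-e₂ carries only one function, so triviality of the product would make
    -- this wall trivial and remove it at order n.
    have : S = {d.func} := by
      ext g
      rw [hS, Finset.mem_singleton]
      exact ⟨fun h => hf.diag i hi h.1 hdf, fun h => h ▸ ⟨hdf, hn⟩⟩
    rw [this, Finset.prod_singleton, h1] at hprod
    rw [← val_truncUnit (hf.func_one i _ hdf), hprod, Units.val_one]
  prod i := by
    classical
    obtain ⟨S, hS, hprod⟩ := hf.prod i n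
    rw [← hprod]
    refine Finset.prod_bij (fun d _ => d.func) ?_ ?_ ?_ fun _ _ => rfl
    · intro d hd
      obtain ⟨hd, hc⟩ := Finset.mem_filter.1 hd
      obtain ⟨⟨i', hc', hdf⟩, hn⟩ := hD.subset hd
      obtain rfl := cell_injective (hc'.symm.trans hc)
      exact (hS _).2 ⟨hdf, hn⟩
    · intro d hd d' hd' h
      exact Wall.ext ((Finset.mem_filter.1 hd).2.trans (Finset.mem_filter.1 hd').2.symm) h
    · intro g hg
      obtain ⟨h1, h2⟩ := (hS g).1 hg
      refine ⟨⟨cell i, g⟩, Finset.mem_filter.2 ⟨?_, rfl⟩, rfl⟩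
      exact hD.superset ⟨⟨i, rfl, h1⟩, h2⟩

lemma isConsistent (hf : IsFunctionModel f) : IsConsistent (wallsOf f) := by
  refine isConsistent_of_isModel (fun n hn => ?_) fun n _ => ?_
  · refine Set.eq_empty_of_forall_notMem ?_
    rintro d ⟨⟨i, -, hd⟩, h⟩
    exact h (trunc_eq_one hn (hf.func_one i _ hd))
  · exact ⟨(hf.finite_atOrder n).toFinset, by simp, hf.isModel (by simp)⟩

end IsFunctionModel

/-- Finite products of functions do not see the functions that are trivial to the given order. -/
lemma exists_finset_prod {T : Finset (KPhat K)} (hT : ∀ g ∈ T, trunc 1 g = 1) (n : ℕ) :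
    ∃ S : Finset (KPhat K), (∀ g, g ∈ S ↔ g ∈ (T : Set (KPhat K)) ∧ trunc n g ≠ 1) ∧
      ∏ g ∈ S, truncUnit n g = ∏ g ∈ T, truncUnit n g := by
  classical
  refine ⟨T.filter fun g => trunc n g ≠ 1, fun g => by simp, ?_⟩
  refine Finset.prod_filter_of_ne fun g hg h h' => h (truncUnit_eq_one (hT g hg) h')

/-! ### Functions `1 + ∑ c_p z^p` -/

/-- The function `1 + ∑ c_p z^p`. -/
noncomputable def onePlus (s : Finset P) (c : P → K) : KPhat K :=
  algebraMap (KP K) (KPhat K) (1 + ∑ p ∈ s, AddMonoidAlgebra.single p (c p))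

lemma toMod_single (n : ℕ) (p : P) (c : K) :
    toMod K n (AddMonoidAlgebra.single p c) = c • mono K n p := by
  rw [mono, ← toMod_smul, AddMonoidAlgebra.smul_single, smul_eq_mul, mul_one]

lemma trunc_onePlus (n : ℕ) (s : Finset P) (c : P → K) :
    trunc n (onePlus s c) = 1 + ∑ p ∈ s, c p • mono K n p := by
  rw [onePlus, trunc_algebraMap, map_add, map_one, map_sum]
  simp only [toMod_single]

lemma trunc_one_onePlus {s : Finset P} (hs : ∀ p ∈ s, 1 ≤ deg p) (c : P → K) :
    trunc 1 (onePlus s c) = 1 := by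
  rw [trunc_onePlus, Finset.sum_eq_zero, add_zero]
  intro p hp
  rw [mono_eq_zero (hs p hp), smul_zero]

lemma val_truncUnit_onePlus (n : ℕ) {s : Finset P} (hs : ∀ p ∈ s, 1 ≤ deg p) (c : P → K) :
    (truncUnit n (onePlus s c) : KPmod K n) = 1 + ∑ p ∈ s, c p • mono K n p := by
  rw [val_truncUnit (trunc_one_onePlus hs c), trunc_onePlus]

lemma supportedOn_onePlus {s : Finset P} (c : P → K) {S : Set P} (h0 : 0 ∈ S)
    (hs : ∀ p ∈ s, p ∈ S) : SupportedOn (onePlus s c) S := by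
  classical
  intro n
  refine ⟨1 + ∑ p ∈ s, AddMonoidAlgebra.single p (c p), fun p hp => ?_, trunc_algebraMap n _⟩
  rw [Finsupp.mem_support_iff] at hp
  by_contra hpS
  refine hp ?_
  have h1 : ∀ q ∈ S, ∀ a : K, (AddMonoidAlgebra.single q a : KP K).coeff p = 0 := fun q hq a =>
    Finsupp.single_eq_of_ne (by rintro rfl; exact hpS hq)
  rw [AddMonoidAlgebra.one_def, AddMonoidAlgebra.coeff_add, Finsupp.add_apply, h1 0 h0, zero_add,
    AddMonoidAlgebra.coeff_sum, Finsupp.finsetSum_apply]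
  exact Finset.sum_eq_zero fun q hq => h1 q (hs q hq) _

lemma hasDirection_onePlus_singleton {d : Wall K} {p : P} {c : P → K}
    (hf : d.func = onePlus {p} c) (hp : p.1 ≠ 0) (ht : -p.1 ∈ tangentLattice d.carrier) :
    HasDirection d (-p.1) := by
  refine ⟨neg_ne_zero.2 hp, ht, ?_⟩
  rw [hf]
  refine supportedOn_onePlus c (Or.inl rfl) fun q hq => ?_
  rw [Finset.mem_singleton.1 hq]
  exact Or.inr ⟨1, one_pos, by simp⟩

/-- The cone contains 0, so an incoming wall with direction -p̄ would contain 0 + p̄. -/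
lemma isNonIncoming_of_notMem {d : Wall K} {i : Fin 3 × Fin 5} (hc : d.carrier = cell i) {p : P}
    {c : P → K} (hf : d.func = onePlus {p} c) (hp : toReal p.1 ∉ cell i)
    (ht : cellNormal i ⬝ᵥ p.1 = 0) : IsNonIncoming d := by
  refine ⟨-p.1, hasDirection_onePlus_singleton hf ?_ ?_, ?_⟩
  · intro h
    rw [h] at hp
    exact hp (by simpa using zero_mem_cell i)
  · rw [hc, mem_tangentLattice_cell, dotProduct_neg, ht, neg_zero]
  · intro h
    refine hp ?_
    rw [← hc, h]
    refine ⟨0, hc ▸ zero_mem_cell i, 1, zero_le_one, ?_⟩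
    rw [toReal_neg]; simp

/-! ### Factorization into functions with one monomial -/

/-- The elements of `K[P]` with exponents in `S`. -/
def HasExponentsIn (S : Set P) (g : KP K) : Prop := ∀ p, g.coeff p ≠ 0 → p ∈ S

namespace HasExponentsIn

variable {S : Set P} {g h : KP K}

lemma add (hg : HasExponentsIn S g) (hh : HasExponentsIn S h) : HasExponentsIn S (g + h) := by
  intro p hp
  rw [AddMonoidAlgebra.coeff_add, Finsupp.add_apply] at hp
  by_cases h0 : g.coeff p = 0
  · exact hh p (by simpa [h0] using hp)
  · exact hg p h0

lemma single {p : P} (hp : p ∈ S) (c : K) : HasExponentsIn S (AddMonoidAlgebra.single p c) := by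
  intro q hq
  rw [AddMonoidAlgebra.coeff_single, Finsupp.single_apply] at hq
  by_cases hpq : p = q
  · exact hpq ▸ hp
  · simp [hpq] at hq

lemma one (h0 : (0 : P) ∈ S) : HasExponentsIn S (1 : KP K) := by
  rw [AddMonoidAlgebra.one_def]
  exact single h0 1

lemma mul (hS : ∀ p ∈ S, ∀ q ∈ S, p + q ∈ S) (hg : HasExponentsIn S g) (hh : HasExponentsIn S h) :
    HasExponentsIn S (g * h) := by
  classical
  intro p hp
  have h := AddMonoidAlgebra.support_coeff_mul_subset g h (Finsupp.mem_support_iff.2 hp)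
  obtain ⟨q, hq, r, hr, rfl⟩ := Finset.mem_add.1 h
  exact hS _ (hg q (Finsupp.mem_support_iff.1 hq)) _ (hh r (Finsupp.mem_support_iff.1 hr))

lemma prod (hS : ∀ p ∈ S, ∀ q ∈ S, p + q ∈ S) (h0 : (0 : P) ∈ S) {ι : Type*} (s : Finset ι)
    (f : ι → KP K) (hf : ∀ i ∈ s, HasExponentsIn S (f i)) : HasExponentsIn S (∏ i ∈ s, f i) :=
  Finset.prod_induction f (HasExponentsIn S) (fun _ _ => mul hS) (one h0) hf

end HasExponentsIn

section Factorization

variable (S : ℕ → Finset P) (f : KP K)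

/-- Partial products `∏ (1 + c_p z^p)` approximating `f`; the factors at stage `n` have exponents
in `S n`. -/
noncomputable def partialProd : ℕ → KP K
  | 0 => 1
  | n + 1 => partialProd n *
      ∏ p ∈ S n, (1 + AddMonoidAlgebra.single p ((f - partialProd n).coeff p))

/-- The coefficients of the factorization of `f`. -/
noncomputable def factorCoeff (p : P) : K := (f - partialProd S f (deg p)).coeff p

variable {S f}

lemma partialProd_eq (hS : ∀ n, ∀ p ∈ S n, deg p = n) (n : ℕ) :
    partialProd S f n = ∏ m ∈ Finset.range n,
      ∏ p ∈ S m, (1 + AddMonoidAlgebra.single p (factorCoeff S f p)) := by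
  induction n with
  | zero => rfl
  | succ n ih =>
    rw [Finset.prod_range_succ, ← ih, partialProd]
    congr 1
    refine Finset.prod_congr rfl fun p hp => ?_
    rw [factorCoeff, hS n p hp]

lemma degIdeal_anti {m n : ℕ} (h : m ≤ n) : degIdeal K n ≤ degIdeal K m := fun _ hg p hp =>
  h.trans (hg p hp)

lemma mul_mem_degIdeal {m n : ℕ} {g h : KP K} (hg : g ∈ degIdeal K m) (hh : h ∈ degIdeal K n) :
    g * h ∈ degIdeal K (m + n) := degIdeal_mul_le m n (Ideal.mul_mem_mul hg hh)

/-- Mixed terms contain at least two monomials of degree n ≥ 1 and so have degree above n. -/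
lemma prod_one_add_single_sub_mem {n : ℕ} (hn : 1 ≤ n) (s : Finset P) (hs : ∀ p ∈ s, deg p = n)
    (c : P → K) : ∏ p ∈ s, (1 + AddMonoidAlgebra.single p (c p)) - 1 -
      ∑ p ∈ s, AddMonoidAlgebra.single p (c p) ∈ degIdeal K (n + 1) := by
  classical
  induction s using Finset.induction_on with
  | empty => simp
  | insert p s hp ih =>
    rw [Finset.prod_insert hp, Finset.sum_insert hp]
    have ih' := ih fun q hq => hs q (Finset.mem_insert_of_mem hq)
    have h1 : AddMonoidAlgebra.single p (c p) ∈ degIdeal K n :=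
      single_mem_degIdeal _ (hs p (Finset.mem_insert_self _ _)).ge
    have h2 : ∑ q ∈ s, AddMonoidAlgebra.single q (c q) ∈ degIdeal K n :=
      Ideal.sum_mem _ fun q hq =>
        single_mem_degIdeal _ (hs q (Finset.mem_insert_of_mem hq)).ge
    have h3 := degIdeal_anti (K := K) (show n + 1 ≤ n + n by omega) (mul_mem_degIdeal h1 h2)
    have h4 := Ideal.mul_mem_left (degIdeal K (n + 1))
      (1 + AddMonoidAlgebra.single p (c p)) ih'
    convert add_mem h4 h3 using 1
    ring

/-- At stage n + 1 the error f - g begins in degree n + 1. Multiplication by the factors 1 + c_p z^p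
built from its leading coefficients removes that degree, because g is 1 modulo the ideal. The set T
is closed under addition, so no new exponents appear. -/
lemma partialProd_spec {T : Set P} (hS : ∀ n, ∀ p ∈ S n, deg p = n ∧ p ∈ T) (hS0 : S 0 = ∅)
    (hT0 : 0 ∈ T) (hT : ∀ p ∈ T, ∀ q ∈ T, p + q ∈ T) (hTS : ∀ p ∈ T, 1 ≤ deg p → p ∈ S (deg p))
    (hf : HasExponentsIn T f) (hf1 : f - 1 ∈ degIdeal K 1) (n : ℕ) :
    HasExponentsIn T (partialProd S f (n + 1)) ∧ partialProd S f (n + 1) - 1 ∈ degIdeal K 1 ∧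
      f - partialProd S f (n + 1) ∈ degIdeal K (n + 1) := by
  induction n with
  | zero =>
    have : partialProd S f (0 + 1) = 1 := by simp [partialProd, hS0]
    rw [this, sub_self]
    exact ⟨HasExponentsIn.one hT0, zero_mem _, hf1⟩
  | succ n ih =>
    obtain ⟨h1, h2, h3⟩ := ih
    set g := partialProd S f (n + 1) with hg
    set c : P → K := fun p => (f - g).coeff p with hc
    set Q := ∏ p ∈ S (n + 1), (1 + AddMonoidAlgebra.single p (c p)) with hQ
    have hstep : partialProd S f (n + 1 + 1) = g * Q := rfl
    rw [hstep]
    have hlin := prod_one_add_single_sub_mem (by omega) (S (n + 1))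
      (fun p hp => (hS _ p hp).1) c
    have hsum : ∑ p ∈ S (n + 1), AddMonoidAlgebra.single p (c p) ∈ degIdeal K (n + 1) :=
      Ideal.sum_mem _ fun p hp => single_mem_degIdeal _ (hS _ p hp).1.ge
    have hQ1 : Q - 1 ∈ degIdeal K (n + 1) := by
      have := add_mem (degIdeal_anti (show n + 1 ≤ n + 1 + 1 by omega) hlin) hsum
      rwa [sub_add_cancel] at this
    have hfg : f - g - ∑ p ∈ S (n + 1), AddMonoidAlgebra.single p (c p) ∈
        degIdeal K (n + 1 + 1) := by
      classical
      intro p hp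
      by_contra hlt
      have hd : n + 1 ≤ deg p := (sub_mem h3 hsum) p hp
      have hd' : deg p = n + 1 := by omega
      refine hp ?_
      have hcoef : (∑ q ∈ S (n + 1), AddMonoidAlgebra.single q (c q) : KP K).coeff p =
          if p ∈ S (n + 1) then c p else 0 := by
        rw [AddMonoidAlgebra.coeff_sum, Finsupp.finsetSum_apply]
        simp [AddMonoidAlgebra.coeff_single, Finsupp.single_apply]
      rw [AddMonoidAlgebra.coeff_sub, Finsupp.sub_apply, hcoef]
      split_ifs with hpS
      · exact sub_self _
      · rw [sub_zero]
        by_contra h0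
        refine hpS (hd' ▸ hTS p ?_ (by omega))
        rw [AddMonoidAlgebra.coeff_sub, Finsupp.sub_apply] at h0
        by_cases hf0 : f.coeff p = 0
        · exact h1 p fun h => h0 (by rw [hf0, h, sub_zero])
        · exact hf p hf0
    refine ⟨HasExponentsIn.mul hT h1 ?_, ?_, ?_⟩
    · exact HasExponentsIn.prod hT hT0 _ _ fun p hp =>
        (HasExponentsIn.one hT0).add (HasExponentsIn.single (hS _ p hp).2 _)
    · have : g * Q - 1 = (g - 1) * Q + (Q - 1) := by ring
      rw [this]
      exact add_mem (Ideal.mul_mem_right _ _ h2) (degIdeal_anti (by omega) hQ1)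
    · have h5 := mul_mem_degIdeal h2 hQ1
      rw [add_comm 1] at h5
      have : f - g * Q = (f - g - ∑ p ∈ S (n + 1), AddMonoidAlgebra.single p (c p)) -
          (Q - 1 - ∑ p ∈ S (n + 1), AddMonoidAlgebra.single p (c p)) - (g - 1) * (Q - 1) := by
        ring
      rw [this]
      exact sub_mem (sub_mem hfg hlin) h5

end Factorization

lemma onePlus_singleton_injective {p q : P} {c : P → K} (hcp : c p ≠ 0)
    (h : onePlus {p} c = onePlus {q} c) : p = q := by
  have h1 := congrArg (trunc (deg p + 1)) h
  rw [trunc_onePlus, trunc_onePlus, Finset.sum_singleton, Finset.sum_singleton,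
    add_right_inj] at h1
  have h2 := congrArg (coeffLin K p (Nat.lt_succ_self _)) h1
  rw [map_smul, map_smul] at h2
  change c p • coeffMod p (mono K _ p) = c q • coeffMod p (mono K _ q) at h2
  rw [coeffMod_mono (Nat.lt_succ_self _), coeffMod_mono (Nat.lt_succ_self _), if_pos rfl] at h2
  by_contra hne
  rw [if_neg (Ne.symm hne)] at h2
  simp at h2
  exact hcp h2

/-- The factors of `f`, to order `n`. -/
lemma exists_finset_factors {S : ℕ → Finset P} {f : KP K} {T : Set P}
    (hS : ∀ n, ∀ p ∈ S n, deg p = n ∧ p ∈ T) (hS0 : S 0 = ∅)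
    (hT0 : 0 ∈ T) (hT : ∀ p ∈ T, ∀ q ∈ T, p + q ∈ T) (hTS : ∀ p ∈ T, 1 ≤ deg p → p ∈ S (deg p))
    (hf : HasExponentsIn T f) (hf1 : f - 1 ∈ degIdeal K 1) (n : ℕ) :
    ∃ F : Finset (KPhat K),
      (∀ g, g ∈ F ↔ (∃ p ∈ T, 1 ≤ deg p ∧ factorCoeff S f p ≠ 0 ∧
        g = onePlus {p} (factorCoeff S f)) ∧ trunc n g ≠ 1) ∧
      ((∏ g ∈ F, truncUnit n g : (KPmod K n)ˣ) : KPmod K n) = toMod K n f := by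
  classical
  set c := factorCoeff S f with hc
  set E : Finset P := (Finset.range n).biUnion S with hE
  have hE1 : ∀ p ∈ E, 1 ≤ deg p := fun p hp => by
    obtain ⟨m, -, hm⟩ := Finset.mem_biUnion.1 hp
    rw [(hS m p hm).1]
    by_contra! h
    obtain rfl : m = 0 := by omega
    rw [hS0] at hm
    simp at hm
  -- A factor is visible at order n exactly when its coefficient is nonzero and its degree is below
  -- n, so only finitely many factors matter.
  have htriv : ∀ p, 1 ≤ deg p → (trunc n (onePlus {p} c) ≠ 1 ↔ c p ≠ 0 ∧ deg p < n) := by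
    intro p hp
    rw [trunc_onePlus, Finset.sum_singleton, Ne, add_eq_left]
    constructor
    · intro h
      refine ⟨fun h0 => h (by rw [h0, zero_smul]), ?_⟩
      by_contra! h0
      exact h (by rw [mono_eq_zero h0, smul_zero])
    · rintro ⟨h1, h2⟩ h3
      exact (smul_ne_zero h1 (mono_ne_zero h2)) h3
  refine ⟨(E.filter fun p => c p ≠ 0).image fun p => onePlus {p} c, fun g => ?_, ?_⟩
  · rw [Finset.mem_image]
    constructor
    · rintro ⟨p, hp, rfl⟩
      obtain ⟨hpE, hcp⟩ := Finset.mem_filter.1 hp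
      obtain ⟨m, hm, hmS⟩ := Finset.mem_biUnion.1 hpE
      refine ⟨⟨p, (hS m p hmS).2, hE1 p hpE, hcp, rfl⟩, (htriv p (hE1 p hpE)).2 ⟨hcp, ?_⟩⟩
      rw [(hS m p hmS).1]
      exact Finset.mem_range.1 hm
    · rintro ⟨⟨p, hpT, hp1, hcp, rfl⟩, hg⟩
      refine ⟨p, Finset.mem_filter.2 ⟨Finset.mem_biUnion.2 ⟨deg p, ?_, hTS p hpT hp1⟩, hcp⟩, rfl⟩
      exact Finset.mem_range.2 ((htriv p hp1).1 hg).2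
  · rw [Finset.prod_image, Finset.prod_filter_of_ne, Units.coe_prod]
    · have h1 : ∀ p ∈ E, (truncUnit n (onePlus {p} c) : KPmod K n) =
          toMod K n (1 + AddMonoidAlgebra.single p (c p)) := fun p hp => by
        rw [val_truncUnit_onePlus n (by simpa using hE1 p hp), Finset.sum_singleton, map_add,
          map_one, toMod_single]
      rw [Finset.prod_congr rfl h1, ← map_prod, hE, Finset.prod_biUnion,
        ← partialProd_eq fun n p hp => (hS n p hp).1]
      · rcases n with - | n
        · have : Subsingleton (KPmod K 0) := by
            rw [KPmod, pow_zero, Ideal.one_eq_top]; exact Ideal.Quotient.subsingleton_iff.2 rfl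
          exact Subsingleton.elim _ _
        · refine (Ideal.Quotient.eq.2 ?_).symm
          rw [mP_pow_eq]
          exact (partialProd_spec hS hS0 hT0 hT hTS hf hf1 n).2.2
      · intro a _ b _ hab
        refine Finset.disjoint_left.2 fun p hpa hpb => hab ?_
        rw [← (hS a p hpa).1, (hS b p hpb).1]
    · intro p hp hne h0
      refine hne (truncUnit_eq_one (trunc_one_onePlus (by simpa using hE1 p hp) c) ?_)
      rw [trunc_onePlus, Finset.sum_singleton, h0, zero_smul, add_zero]
    · intro p hp q _ h
      have hp' := Finset.mem_filter.1 (Finset.mem_coe.1 hp)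
      exact onePlus_singleton_injective hp'.2 h

/-! ### The final wall structure -/

section Functions

variable (K)

/-- `1 + t₁x`. -/
noncomputable def funX : KPhat K := onePlus {expX} 1

/-- `1 + t₂y`. -/
noncomputable def funY : KPhat K := onePlus {expY} 1

/-- `1 + t₁t₂xy`. -/
noncomputable def funXY : KPhat K := onePlus {expX + expY} 1

/-- `1 + t₁x + t₁t₂xy`. -/
noncomputable def funXXY : KPhat K := onePlus {expX, expX + expY} 1

/-- `1 + t₂y + t₁t₂xy`. -/
noncomputable def funYXY : KPhat K := onePlus {expY, expX + expY} 1

end Functions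

lemma deg_expX_add_expY : deg (expX + expY) = 2 := by rw [deg_add, deg_expX, deg_expY]

lemma expX_ne : expX ≠ expX + expY := fun h => by
  have := congrArg deg h
  rw [deg_expX_add_expY, deg_expX] at this
  omega

lemma expY_ne : expY ≠ expX + expY := fun h => by
  have := congrArg deg h
  rw [deg_expX_add_expY, deg_expY] at this
  omega

lemma algebraMap_X : algebraMap (KP K) (KPhat K) (1 + t 0 * z (ray 0)) = funX K := by
  rw [funX, onePlus, Finset.sum_singleton, tx_eq]; rfl

lemma algebraMap_Y : algebraMap (KP K) (KPhat K) (1 + t 1 * z (ray 1)) = funY K := by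
  rw [funY, onePlus, Finset.sum_singleton, ty_eq]; rfl

lemma tx_mul_ty : (t 0 * z (ray 0) * (t 1 * z (ray 1)) : KP K) =
    AddMonoidAlgebra.single (expX + expY) 1 := by
  rw [tx_eq, ty_eq, AddMonoidAlgebra.single_mul_single, mul_one]

lemma algebraMap_XY : algebraMap (KP K) (KPhat K) (1 + t 0 * z (ray 0) * (t 1 * z (ray 1))) =
    funXY K := by
  rw [funXY, onePlus, Finset.sum_singleton, tx_mul_ty]; rfl

lemma algebraMap_XXY : algebraMap (KP K) (KPhat K)
    (1 + t 0 * z (ray 0) + t 0 * z (ray 0) * (t 1 * z (ray 1))) = funXXY K := by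
  rw [funXXY, onePlus, Finset.sum_pair expX_ne, tx_mul_ty, tx_eq, add_assoc]; rfl

lemma algebraMap_YXY : algebraMap (KP K) (KPhat K)
    (1 + t 1 * z (ray 1) + t 0 * z (ray 0) * (t 1 * z (ray 1))) = funYXY K := by
  rw [funYXY, onePlus, Finset.sum_pair expY_ne, tx_mul_ty, ty_eq, add_assoc]; rfl

lemma truncUnit_funX (n : ℕ) : truncUnit n (funX K) = uX K n := by
  ext
  rw [funX, val_truncUnit_onePlus n (by simp [deg_expX]), uX, val_oneAdd, Finset.sum_singleton]
  simp [varX]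

lemma truncUnit_funY (n : ℕ) : truncUnit n (funY K) = uY K n := by
  ext
  rw [funY, val_truncUnit_onePlus n (by simp [deg_expY]), uY, val_oneAdd, Finset.sum_singleton]
  simp [varY]

lemma truncUnit_funXY (n : ℕ) : truncUnit n (funXY K) = uXY K n := by
  ext
  rw [funXY, val_truncUnit_onePlus n (by simp [deg_expX]), uXY, val_oneAdd,
    Finset.sum_singleton, mono_add]
  simp [varX, varY]

lemma truncUnit_funXXY (n : ℕ) : truncUnit n (funXXY K) = uXXY K n := by
  ext
  rw [funXXY, val_truncUnit_onePlus n (by simp [deg_expX]), uXXY, val_oneAdd,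
    Finset.sum_pair expX_ne, mono_add]
  simp [varX, varY]

lemma truncUnit_funYXY (n : ℕ) : truncUnit n (funYXY K) = uYXY K n := by
  ext
  rw [funYXY, val_truncUnit_onePlus n (by simp [deg_expY]), uYXY, val_oneAdd,
    Finset.sum_pair expY_ne, mono_add]
  simp [varX, varY]

open Classical in
variable (K) in
/-- The functions of the final wall structure on the two-dimensional cones of the fan. -/
noncomputable def finalFuncs (i : Fin 3 × Fin 5) : Finset (KPhat K) :=
  ![![{funX K, funY K}, {funXXY K}, {funXY K}, {funXY K}, {funYXY K}] i.2,
    ![{funX K}, {funY K}, {funX K}, {funXY K}, {funY K}] i.2,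
    ![{funX K}, {funY K}, {funX K}, {funXY K}, {funY K}] i.2] i.1

lemma coneWall_carrier {u v : M} {g : KP K} (i : Fin 3 × Fin 5)
    (h : cellFst i = u ∧ cellSnd i = v ∨ cellFst i = v ∧ cellSnd i = u) :
    (coneWall u v g).carrier = cell i := by
  rcases h with ⟨rfl, rfl⟩ | ⟨rfl, rfl⟩
  · rfl
  · ext x
    constructor
    all_goals
      rintro ⟨a, b, ha, hb, rfl⟩
      exact ⟨b, a, hb, ha, add_comm _ _⟩

lemma eq_coneWall {d : Wall K} {u v : M} {g : KP K} {i : Fin 3 × Fin 5} (hc : d.carrier = cell i)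
    (hf : d.func = algebraMap (KP K) (KPhat K) g)
    (h : cellFst i = u ∧ cellSnd i = v ∨ cellFst i = v ∧ cellSnd i = u) : d = coneWall u v g :=
  Wall.ext (hc.trans (coneWall_carrier i h).symm) hf

/-- The sixteen listed walls lie on fifteen cones; only ⟨e₁, e₂⟩ carries two of them. -/
lemma finalWalls_eq : finalWalls K = wallsOf fun i => (finalFuncs K i : Set (KPhat K)) := by
  classical
  ext d
  constructor
  · intro hd
    simp only [finalWalls, Set.mem_insert_iff, Set.mem_singleton_iff] at hd
    rcases hd with rfl | rfl | rfl | rfl | rfl | rfl | rfl | rfl | rfl | rfl | rfl | rfl | rfl |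
      rfl | rfl | rfl
    · exact ⟨(0, 0), coneWall_carrier _ (by decide), by simp [coneWall, algebraMap_X, finalFuncs]⟩
    · exact ⟨(1, 0), coneWall_carrier _ (by decide), by simp [coneWall, algebraMap_X, finalFuncs]⟩
    · exact ⟨(2, 0), coneWall_carrier _ (by decide), by simp [coneWall, algebraMap_X, finalFuncs]⟩
    · exact ⟨(0, 0), coneWall_carrier _ (by decide), by simp [coneWall, algebraMap_Y, finalFuncs]⟩
    · exact ⟨(1, 1), coneWall_carrier _ (by decide), by simp [coneWall, algebraMap_Y, finalFuncs]⟩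
    · exact ⟨(2, 1), coneWall_carrier _ (by decide), by simp [coneWall, algebraMap_Y, finalFuncs]⟩
    · exact ⟨(1, 2), coneWall_carrier _ (by decide), by simp [coneWall, algebraMap_X, finalFuncs]⟩
    · exact ⟨(2, 2), coneWall_carrier _ (by decide), by simp [coneWall, algebraMap_X, finalFuncs]⟩
    · exact ⟨(1, 4), coneWall_carrier _ (by decide), by simp [coneWall, algebraMap_Y, finalFuncs]⟩
    · exact ⟨(2, 4), coneWall_carrier _ (by decide), by simp [coneWall, algebraMap_Y, finalFuncs]⟩
    · exact ⟨(0, 3), coneWall_carrier _ (by decide), by simp [coneWall, algebraMap_XY, finalFuncs]⟩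
    · exact ⟨(0, 2), coneWall_carrier _ (by decide), by simp [coneWall, algebraMap_XY, finalFuncs]⟩
    · exact ⟨(1, 3), coneWall_carrier _ (by decide), by simp [coneWall, algebraMap_XY, finalFuncs]⟩
    · exact ⟨(2, 3), coneWall_carrier _ (by decide), by simp [coneWall, algebraMap_XY, finalFuncs]⟩
    · exact ⟨(0, 4), coneWall_carrier _ (by decide), by simp [coneWall, algebraMap_YXY, finalFuncs]⟩
    · exact ⟨(0, 1), coneWall_carrier _ (by decide), by simp [coneWall, algebraMap_XXY, finalFuncs]⟩
  · rintro ⟨⟨i, s⟩, hc, hf⟩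
    simp only [finalWalls, Set.mem_insert_iff, Set.mem_singleton_iff]
    fin_cases i <;> fin_cases s <;> simp [finalFuncs] at hf
    · rcases hf with hf | hf
      · exact Or.inl (eq_coneWall hc (hf.trans algebraMap_X.symm) (by decide))
      · iterate 3 right
        exact Or.inl (eq_coneWall hc (hf.trans algebraMap_Y.symm) (by decide))
    · iterate 15 right
      exact eq_coneWall hc (hf.trans algebraMap_XXY.symm) (by decide)
    · iterate 11 right
      exact Or.inl (eq_coneWall hc (hf.trans algebraMap_XY.symm) (by decide))
    · iterate 10 right
      exact Or.inl (eq_coneWall hc (hf.trans algebraMap_XY.symm) (by decide))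
    · iterate 14 right
      exact Or.inl (eq_coneWall hc (hf.trans algebraMap_YXY.symm) (by decide))
    · iterate 1 right
      exact Or.inl (eq_coneWall hc (hf.trans algebraMap_X.symm) (by decide))
    · iterate 4 right
      exact Or.inl (eq_coneWall hc (hf.trans algebraMap_Y.symm) (by decide))
    · iterate 6 right
      exact Or.inl (eq_coneWall hc (hf.trans algebraMap_X.symm) (by decide))
    · iterate 12 right
      exact Or.inl (eq_coneWall hc (hf.trans algebraMap_XY.symm) (by decide))
    · iterate 8 right
      exact Or.inl (eq_coneWall hc (hf.trans algebraMap_Y.symm) (by decide))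
    · iterate 2 right
      exact Or.inl (eq_coneWall hc (hf.trans algebraMap_X.symm) (by decide))
    · iterate 5 right
      exact Or.inl (eq_coneWall hc (hf.trans algebraMap_Y.symm) (by decide))
    · iterate 7 right
      exact Or.inl (eq_coneWall hc (hf.trans algebraMap_X.symm) (by decide))
    · iterate 13 right
      exact Or.inl (eq_coneWall hc (hf.trans algebraMap_XY.symm) (by decide))
    · iterate 9 right
      exact Or.inl (eq_coneWall hc (hf.trans algebraMap_Y.symm) (by decide))

lemma finalFuncs_spec (i : Fin 3 × Fin 5) (g : KPhat K) (hg : g ∈ finalFuncs K i) :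
    trunc 1 g = 1 ∧ SupportedOn g {p | cellNormal i ⬝ᵥ p.1 = 0} := by
  classical
  have key : ∀ s : Finset P, (∀ p ∈ s, 1 ≤ deg p ∧ cellNormal i ⬝ᵥ p.1 = 0) → g = onePlus s 1 →
      trunc 1 g = 1 ∧ SupportedOn g {p | cellNormal i ⬝ᵥ p.1 = 0} := by
    rintro s hs rfl
    exact ⟨trunc_one_onePlus (fun p hp => (hs p hp).1) _,
      supportedOn_onePlus _ (dotProduct_zero _) fun p hp => (hs p hp).2⟩
  have hX : cellNormal i ⬝ᵥ expX.1 = 0 → g = funX K → _ := fun h h' => key {expX}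
    (by simp [h, deg_expX]) h'
  have hY : cellNormal i ⬝ᵥ expY.1 = 0 → g = funY K → _ := fun h h' => key {expY}
    (by simp [h, deg_expY]) h'
  have hXY : cellNormal i ⬝ᵥ (expX + expY).1 = 0 → g = funXY K → _ := fun h h' =>
    key {expX + expY} (by simpa [deg_expX] using h) h'
  have hXXY : cellNormal i ⬝ᵥ expX.1 = 0 → cellNormal i ⬝ᵥ (expX + expY).1 = 0 →
      g = funXXY K → _ := fun h1 h h' =>
    key {expX, expX + expY} (by simpa [deg_expX, h1] using h) h'
  have hYXY : cellNormal i ⬝ᵥ expY.1 = 0 → cellNormal i ⬝ᵥ (expX + expY).1 = 0 →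
      g = funYXY K → _ := fun h1 h h' =>
    key {expY, expX + expY} (by simpa [deg_expY, h1] using h) h'
  clear key
  obtain ⟨i, s⟩ := i
  fin_cases i <;> fin_cases s <;> simp [finalFuncs] at hg
  · rcases hg with hg | hg
    · exact hX (by decide) hg
    · exact hY (by decide) hg
  · exact hXXY (by decide) (by decide) hg
  · exact hXY (by decide) hg
  · exact hXY (by decide) hg
  · exact hYXY (by decide) (by decide) hg
  all_goals first
    | exact hX (by decide) hg
    | exact hY (by decide) hg
    | exact hXY (by decide) hg

lemma prod_finalFuncs (n : ℕ) (i : Fin 3 × Fin 5) :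
    ∏ g ∈ finalFuncs K i, truncUnit n g = cellFun K n i := by
  classical
  -- On ⟨e₁, e₂⟩ both factors must be counted, and in a set equal functions would merge. The
  -- coefficient of t₁x at order 2 separates them.
  have hne : funX K ≠ funY K := fun h => by
    have h1 := congrArg (truncUnit 2) h
    rw [truncUnit_funX, truncUnit_funY] at h1
    have h2 := congrArg (fun u : (KPmod K 2)ˣ => coeffMod expX ((u : KPmod K 2) - 1)) h1
    simp only [uX, uY, val_oneAdd, add_sub_cancel_left, varX, varY] at h2
    rw [coeffMod_mono (by rw [deg_expX]; omega), coeffMod_mono (by rw [deg_expX]; omega),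
      if_pos rfl, if_neg (by decide)] at h2
    exact one_ne_zero h2
  obtain ⟨i, s⟩ := i
  fin_cases i <;> fin_cases s <;>
    simp [finalFuncs, cellFun, Finset.prod_pair hne, truncUnit_funX, truncUnit_funY,
      truncUnit_funXY, truncUnit_funXXY, truncUnit_funYXY]

lemma subsingleton_finalFuncs (i : Fin 3 × Fin 5) (hi : i ∈ diagCells) :
    (finalFuncs K i : Set (KPhat K)).Subsingleton := by
  simp only [diagCells, Finset.mem_insert, Finset.mem_singleton] at hi
  rcases hi with rfl | rfl | rfl | rfl <;> simp [finalFuncs]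

lemma isFunctionModel_finalFuncs :
    IsFunctionModel fun i => (finalFuncs K i : Set (KPhat K)) where
  func_one i g hg := (finalFuncs_spec i g hg).1
  tangent i g hg := (finalFuncs_spec i g hg).2
  prod i n := by
    rw [← prod_finalFuncs]
    exact exists_finset_prod (fun g hg => (finalFuncs_spec i g hg).1) n
  diag i hi := subsingleton_finalFuncs i hi

/-! ### A consistent completion of the initial wall structure -/

/-- The exponents of monomials in `t₁x` and `t₂y` that involve the variable `j`, and `0`. -/
def factorExps (j : Fin 2) : Set P :=
  {p | p = 0 ∨ ∃ a : Fin 2 → ℕ, p = a 0 • expX + a 1 • expY ∧ 1 ≤ a j}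

lemma deg_nsmul (a : ℕ) (p : P) : deg (a • p) = a * deg p := by
  simp only [deg, Prod.smul_snd, Pi.smul_apply, smul_eq_mul]; ring

lemma deg_factorExp (a : Fin 2 → ℕ) : deg (a 0 • expX + a 1 • expY) = a 0 + a 1 := by
  rw [deg_add, deg_nsmul, deg_nsmul, deg_expX, deg_expY, mul_one, mul_one]

/-- The exponents of `factorExps j` of degree `n > 0`. -/
def factorExpsDeg (j : Fin 2) (n : ℕ) : Finset P :=
  ((Finset.HasAntidiagonal.antidiagonal n).filter fun a => 1 ≤ (![a.1, a.2] : Fin 2 → ℕ) j).image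
    fun a => a.1 • expX + a.2 • expY

lemma mem_factorExpsDeg {j : Fin 2} {n : ℕ} {p : P} : p ∈ factorExpsDeg j n ↔
    ∃ a : Fin 2 → ℕ, a 0 + a 1 = n ∧ 1 ≤ a j ∧ p = a 0 • expX + a 1 • expY := by
  simp only [factorExpsDeg, Finset.mem_image, Finset.mem_filter,
    Finset.HasAntidiagonal.mem_antidiagonal]
  constructor
  · rintro ⟨a, ⟨h1, h2⟩, rfl⟩
    exact ⟨![a.1, a.2], h1, h2, rfl⟩
  · rintro ⟨a, h1, h2, rfl⟩
    refine ⟨(a 0, a 1), ⟨h1, ?_⟩, rfl⟩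
    fin_cases j <;> exact h2

lemma factorExps_add (j : Fin 2) : ∀ p ∈ factorExps j, ∀ q ∈ factorExps j,
    p + q ∈ factorExps j := by
  rintro p (rfl | ⟨a, rfl, ha⟩) q (rfl | ⟨b, rfl, hb⟩)
  · exact Or.inl (add_zero 0)
  · exact Or.inr ⟨b, zero_add _, hb⟩
  · exact Or.inr ⟨a, add_zero _, ha⟩
  · refine Or.inr ⟨a + b, ?_, ?_⟩
    · simp only [Pi.add_apply, add_smul]; abel
    · exact ha.trans (Nat.le_add_right _ _)

variable (K) in
/-- The functions `1 + t₁x + t₁t₂xy` and `1 + t₂y + t₁t₂xy`. -/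
noncomputable def factored (j : Fin 2) : KP K :=
  1 + AddMonoidAlgebra.single (![expX, expY] j) 1 + AddMonoidAlgebra.single (expX + expY) 1

lemma single_exp_mem (j : Fin 2) : ![expX, expY] j ∈ factorExps j := by
  fin_cases j
  · exact Or.inr ⟨![1, 0], by simp, by simp⟩
  · exact Or.inr ⟨![0, 1], by simp, by simp⟩

lemma hasExponentsIn_factored (j : Fin 2) : HasExponentsIn (factorExps j) (factored K j) := by
  refine ((HasExponentsIn.one (Or.inl rfl)).add (HasExponentsIn.single (single_exp_mem j) 1)).add
    (HasExponentsIn.single (Or.inr ⟨![1, 1], by simp, ?_⟩) 1)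
  fin_cases j <;> simp

lemma factored_sub_one_mem (j : Fin 2) : factored K j - 1 ∈ degIdeal K 1 := by
  rw [factored, add_assoc, add_sub_cancel_left]
  refine add_mem (single_mem_degIdeal _ ?_) (single_mem_degIdeal _ ?_)
  · fin_cases j
    · exact deg_expX.ge
    · exact deg_expY.ge
  · rw [deg_expX_add_expY]; omega

variable (K) in
/-- The coefficients of the factors of `1 + t₁x + t₁t₂xy` and `1 + t₂y + t₁t₂xy`. -/
noncomputable def splitCoeff (j : Fin 2) : P → K := factorCoeff (factorExpsDeg j) (factored K j)

variable (K) in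
/-- The factors of `1 + t₁x + t₁t₂xy` and `1 + t₂y + t₁t₂xy`. -/
def splitFactors (j : Fin 2) : Set (KPhat K) :=
  {g | ∃ p ∈ factorExps j, 1 ≤ deg p ∧ splitCoeff K j p ≠ 0 ∧ g = onePlus {p} (splitCoeff K j)}

lemma exists_finset_splitFactors (j : Fin 2) (n : ℕ) :
    ∃ F : Finset (KPhat K), (∀ g, g ∈ F ↔ g ∈ splitFactors K j ∧ trunc n g ≠ 1) ∧
      ((∏ g ∈ F, truncUnit n g : (KPmod K n)ˣ) : KPmod K n) = toMod K n (factored K j) := by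
  refine exists_finset_factors (S := factorExpsDeg j) (f := factored K j) (T := factorExps j)
    ?_ ?_ (Or.inl rfl) (factorExps_add j) ?_ (hasExponentsIn_factored j) (factored_sub_one_mem j) n
  · intro n p hp
    obtain ⟨a, h1, h2, rfl⟩ := mem_factorExpsDeg.1 hp
    exact ⟨by rw [deg_factorExp, h1], Or.inr ⟨a, rfl, h2⟩⟩
  · refine Finset.eq_empty_of_forall_notMem fun p hp => ?_
    obtain ⟨a, h1, h2, -⟩ := mem_factorExpsDeg.1 hp
    fin_cases j
    · change 1 ≤ a 0 at h2
      omega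
    · change 1 ≤ a 1 at h2
      omega
  · rintro p (rfl | ⟨a, rfl, ha⟩) hp
    · simp at hp
    · exact mem_factorExpsDeg.2 ⟨a, (deg_factorExp a).symm, ha, rfl⟩

variable (K) in
/-- The functions of the final wall structure, with those on `⟨e₂, -e₁⟩` and `⟨e₁, -e₂⟩` split into
factors that have a direction. -/
def splitFuncs (i : Fin 3 × Fin 5) : Set (KPhat K) :=
  if i = (0, 1) then splitFactors K 0 else if i = (0, 4) then splitFactors K 1
  else (finalFuncs K i : Set (KPhat K))

lemma dot_factorExp (ν : M) (a : Fin 2 → ℕ) :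
    ν ⬝ᵥ (a 0 • expX + a 1 • expY).1 = a 0 * ν 0 + a 1 * ν 1 := by
  simp [expX, expY, ray, dotProduct, Fin.sum_univ_three]
  ring

lemma dot_eq_zero_of_mem_factorExps {ν : M} (h0 : ν 0 = 0) (h1 : ν 1 = 0) {j : Fin 2} {p : P}
    (hp : p ∈ factorExps j) : ν ⬝ᵥ p.1 = 0 := by
  rcases hp with rfl | ⟨a, rfl, -⟩
  · exact dotProduct_zero _
  · rw [dot_factorExp, h0, h1, mul_zero, mul_zero, add_zero]

lemma splitFactors_spec {i : Fin 3 × Fin 5} (hi : i.1 = 0) {j : Fin 2} {g : KPhat K}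
    (hg : g ∈ splitFactors K j) :
    trunc 1 g = 1 ∧ SupportedOn g {p | cellNormal i ⬝ᵥ p.1 = 0} := by
  obtain ⟨p, hp, hp1, -, rfl⟩ := hg
  refine ⟨trunc_one_onePlus (by simpa using hp1) _, supportedOn_onePlus _ (dotProduct_zero _) ?_⟩
  intro q hq
  obtain rfl := Finset.mem_singleton.1 hq
  obtain ⟨i, s⟩ := i
  obtain rfl : i = 0 := hi
  exact dot_eq_zero_of_mem_factorExps rfl rfl hp

lemma splitFuncs_cases {i : Fin 3 × Fin 5} {g : KPhat K} (hg : g ∈ splitFuncs K i) :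
    (i = (0, 1) ∧ g ∈ splitFactors K 0) ∨ (i = (0, 4) ∧ g ∈ splitFactors K 1) ∨
      (i ≠ (0, 1) ∧ i ≠ (0, 4) ∧ g ∈ finalFuncs K i) := by
  rw [splitFuncs] at hg
  split_ifs at hg with h1 h2
  · exact Or.inl ⟨h1, hg⟩
  · exact Or.inr (Or.inl ⟨h2, hg⟩)
  · exact Or.inr (Or.inr ⟨h1, h2, hg⟩)

lemma splitFuncs_spec (i : Fin 3 × Fin 5) (g : KPhat K) (hg : g ∈ splitFuncs K i) :
    trunc 1 g = 1 ∧ SupportedOn g {p | cellNormal i ⬝ᵥ p.1 = 0} := by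
  rcases splitFuncs_cases hg with ⟨rfl, h⟩ | ⟨rfl, h⟩ | ⟨-, -, h⟩
  · exact splitFactors_spec rfl h
  · exact splitFactors_spec rfl h
  · exact finalFuncs_spec i g h

lemma isFunctionModel_splitFuncs : IsFunctionModel (splitFuncs K) where
  func_one i g hg := (splitFuncs_spec i g hg).1
  tangent i g hg := (splitFuncs_spec i g hg).2
  prod i n := by
    rw [splitFuncs]
    split_ifs with h1 h2
    · obtain ⟨F, hF, hprod⟩ := exists_finset_splitFactors (K := K) 0 n
      refine ⟨F, hF, Units.ext (hprod.trans ?_)⟩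
      rw [h1, factored, map_add, map_add, map_one, toMod_single, toMod_single, mono_add]
      simp [cellFun, uXXY, varX, varY, add_assoc]
    · obtain ⟨F, hF, hprod⟩ := exists_finset_splitFactors (K := K) 1 n
      refine ⟨F, hF, Units.ext (hprod.trans ?_)⟩
      rw [h2, factored, map_add, map_add, map_one, toMod_single, toMod_single, mono_add]
      simp [cellFun, uYXY, varX, varY, add_assoc]
    · exact isFunctionModel_finalFuncs.prod i n
  diag i hi := by
    have h1 : i ≠ (0, 1) := by rintro rfl; exact absurd hi (by decide)
    have h2 : i ≠ (0, 4) := by rintro rfl; exact absurd hi (by decide)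
    rw [splitFuncs, if_neg h1, if_neg h2]
    exact subsingleton_finalFuncs i hi

/-! ### The split walls complete the initial ones -/

lemma notMem_cell {i : Fin 3 × Fin 5} {m h : M}
    (hh : h ∈ [cellDualFst i, cellDualSnd i, cellNormal i, -cellNormal i]) (hneg : h ⬝ᵥ m < 0) :
    toReal m ∉ cell i := fun hm => by
  have := nonneg_of_mem_cell hm hh
  rw [toReal_dot] at this
  exact absurd (Int.cast_nonneg_iff.1 this) (not_le.2 hneg)

/-- Every exponent of a factor involves the variable j at least once, so one linear form that is
nonnegative on the cone is negative on all of them at the same time. -/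
lemma isNonIncoming_split {d : Wall K} {i : Fin 3 × Fin 5} {j : Fin 2} {h : M}
    (hi : (i.1 = 0)) (hc : d.carrier = cell i) (hd : d.func ∈ splitFactors K j)
    (hh : h ∈ [cellDualFst i, cellDualSnd i, cellNormal i, -cellNormal i])
    (hneg : ∀ a : Fin 2 → ℕ, 1 ≤ a j → (a 0 * h 0 + a 1 * h 1 : ℤ) < 0) : IsNonIncoming d := by
  obtain ⟨p, hp, hp1, -, hf⟩ := hd
  have ht : cellNormal i ⬝ᵥ p.1 = 0 := by
    obtain ⟨i, s⟩ := i
    obtain rfl : i = 0 := hi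
    exact dot_eq_zero_of_mem_factorExps rfl rfl hp
  refine isNonIncoming_of_notMem hc hf (notMem_cell hh ?_) ht
  rcases hp with rfl | ⟨a, rfl, ha⟩
  · simp at hp1
  · rw [dot_factorExp]
    exact hneg a ha

lemma initialWalls_subset : initialWalls K ⊆ wallsOf (splitFuncs K) := by
  classical
  rintro d (⟨j, hj, rfl⟩ | ⟨j, hj, rfl⟩)
  · have hf : (coneWall (ray 0) (ray j) ((1 + t 0 * z (ray 0)) ^ 1) : Wall K).func = funX K := by
      rw [pow_one]; exact algebraMap_X
    fin_cases j
    · exact absurd rfl hj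
    · exact ⟨(0, 0), coneWall_carrier _ (by decide), by rw [hf]; simp [splitFuncs, finalFuncs]⟩
    · exact ⟨(1, 0), coneWall_carrier _ (by decide), by rw [hf]; simp [splitFuncs, finalFuncs]⟩
    · exact ⟨(2, 0), coneWall_carrier _ (by decide), by rw [hf]; simp [splitFuncs, finalFuncs]⟩
  · have hf : (coneWall (ray 1) (ray j) ((1 + t 1 * z (ray 1)) ^ 1) : Wall K).func = funY K := by
      rw [pow_one]; exact algebraMap_Y
    fin_cases j
    · exact ⟨(0, 0), coneWall_carrier _ (by decide), by rw [hf]; simp [splitFuncs, finalFuncs]⟩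
    · exact absurd rfl hj
    · exact ⟨(1, 1), coneWall_carrier _ (by decide), by rw [hf]; simp [splitFuncs, finalFuncs]⟩
    · exact ⟨(2, 1), coneWall_carrier _ (by decide), by rw [hf]; simp [splitFuncs, finalFuncs]⟩

lemma isNonIncoming_of_mem_split {d : Wall K} (hd : d ∈ wallsOf (splitFuncs K) \ initialWalls K) :
    IsNonIncoming d := by
  classical
  obtain ⟨⟨i, hc, hf⟩, hnot⟩ := hd
  rcases splitFuncs_cases hf with ⟨rfl, h⟩ | ⟨rfl, h⟩ | ⟨h1, h2, h⟩
  -- On ⟨e₂, -e₁⟩ the form is minus the first coordinate, which is negative as t₁x occurs. Below, on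
  -- ⟨e₁, -e₂⟩, it is minus the second coordinate.
  · refine isNonIncoming_split rfl hc h (h := cellDualSnd (0, 1)) (by simp) fun a ha => ?_
    have e0 : cellDualSnd (0, 1) 0 = -1 := by decide
    have e1 : cellDualSnd (0, 1) 1 = 0 := by decide
    rw [e0, e1]; omega
  · refine isNonIncoming_split rfl hc h (h := cellDualFst (0, 4)) (by simp) fun a ha => ?_
    have e0 : cellDualFst (0, 4) 0 = 0 := by decide
    have e1 : cellDualFst (0, 4) 1 = -1 := by decide
    rw [e0, e1]; omega
  have hX : ∀ k, k ≠ 0 → d = coneWall (ray 0) (ray k) (1 + t 0 * z (ray 0)) → False :=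
    fun k hk hd => hnot (Or.inl ⟨k, hk, by rw [hd, pow_one]⟩)
  have hY : ∀ k, k ≠ 1 → d = coneWall (ray 1) (ray k) (1 + t 1 * z (ray 1)) → False :=
    fun k hk hd => hnot (Or.inr ⟨k, hk, by rw [hd, pow_one]⟩)
  have key : ∀ p : P, d.func = onePlus {p} 1 →
      (∃ h ∈ [cellDualFst i, cellDualSnd i, cellNormal i, -cellNormal i], h ⬝ᵥ p.1 < 0) →
      cellNormal i ⬝ᵥ p.1 = 0 → IsNonIncoming d := by
    rintro p hf ⟨h, hh, hneg⟩ ht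
    exact isNonIncoming_of_notMem hc hf (notMem_cell hh hneg) ht
  clear hf
  obtain ⟨i, s⟩ := i
  fin_cases i <;> fin_cases s <;> simp [finalFuncs] at h
  · rcases h with h | h
    · exact (hX 1 (by decide) (eq_coneWall hc (h.trans algebraMap_X.symm) (by decide))).elim
    · exact (hY 0 (by decide) (eq_coneWall hc (h.trans algebraMap_Y.symm) (by decide))).elim
  · exact absurd rfl h1
  · exact key _ h (by decide) (by decide)
  · exact key _ h (by decide) (by decide)
  · exact absurd rfl h2
  · exact (hX 2 (by decide) (eq_coneWall hc (h.trans algebraMap_X.symm) (by decide))).elim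
  · exact (hY 2 (by decide) (eq_coneWall hc (h.trans algebraMap_Y.symm) (by decide))).elim
  · exact key _ h (by decide) (by decide)
  · exact key _ h (by decide) (by decide)
  · exact key _ h (by decide) (by decide)
  · exact (hX 3 (by decide) (eq_coneWall hc (h.trans algebraMap_X.symm) (by decide))).elim
  · exact (hY 3 (by decide) (eq_coneWall hc (h.trans algebraMap_Y.symm) (by decide))).elim
  · exact key _ h (by decide) (by decide)
  · exact key _ h (by decide) (by decide)
  · exact key _ h (by decide) (by decide)

theorem isConsistentCompletion_split :
    IsConsistentCompletion (initialWalls K) (wallsOf (splitFuncs K)) where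
  wallStructure := isFunctionModel_splitFuncs.isWallStructure
  contains := initialWalls_subset
  nonIncoming _ hd := isNonIncoming_of_mem_split hd
  consistent := isFunctionModel_splitFuncs.isConsistent

/-! ### Uniqueness up to equivalence -/

/-- Exponents are positive multiples of -v, so r is the primitive vector in the direction of -v: the
vector in which non-incoming walls come to an end. -/
lemma HasDirection.exists_hasRay {d : Wall K} (hd : IsWall d) {v : M} (hv : HasDirection d v) :
    ∃ (r : M) (g : ℤ), 0 < g ∧ -v = g • r ∧ ∀ n, HasRay n d r := by
  obtain ⟨hv0, hvt, hvs⟩ := hv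
  obtain ⟨r, a, g, hg, hvr, ha⟩ := exists_primitive (neg_ne_zero.2 hv0)
  refine ⟨r, g, hg, hvr, fun n => ⟨⟨a, ha⟩, ?_, ?_⟩⟩
  · have h1 : toReal (-v) ∈ (affineSpan ℝ d.carrier).direction := by
      rw [toReal_neg]; exact neg_mem hvt
    rw [hvr, toReal_zsmul] at h1
    exact (Submodule.smul_mem_iff _ (by exact_mod_cast hg.ne')).1 h1
  · rw [val_truncUnit hd.func_one]
    refine suppSub_mono n ?_ (trunc_mem_suppSub hvs n)
    rintro p (rfl | ⟨k, hk, hp⟩)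
    · exact Or.inl rfl
    · refine Or.inr ⟨k * g.toNat, Nat.mul_pos hk (by omega), ?_⟩
      rw [hp, ← smul_neg, hvr, ← natCast_zsmul, ← natCast_zsmul, smul_smul]
      congr 1
      push_cast
      rw [Int.toNat_of_nonneg hg.le]

/-- If no defining inequality decreased along r, the wall would be stable under adding r and hence
incoming. An inequality that does decrease is eventually violated on every line parallel to r. -/
lemma eventually_notMem_of_not_isIncoming {d : Wall K} (hd : IsWall d) {v r : M} {g : ℤ}
    (hg : 0 < g) (hvr : -v = g • r) (hv : ¬ IsIncoming d v) (x : MR) :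
    ∀ᶠ s : ℝ in atTop, x + s • toReal r ∉ d.carrier := by
  obtain ⟨H, hH⟩ := (isRationalPolyhedron_iff _).1 hd.polyhedron
  by_cases hr : ∀ h ∈ H, 0 ≤ toReal h.1 ⬝ᵥ toReal r
  · refine absurd ?_ hv
    ext y
    constructor
    · intro hy
      exact ⟨y, hy, 0, le_rfl, by simp⟩
    · rintro ⟨x, hx, s, hs, rfl⟩
      have hvr' : toReal v = -((g : ℝ) • toReal r) := by
        rw [← toReal_zsmul, ← hvr, toReal_neg, neg_neg]
      rw [hH] at hx ⊢
      intro h hh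
      have hg' : (0 : ℝ) < g := by exact_mod_cast hg
      have := hx h hh
      have h2 := hr h hh
      rw [sub_eq_add_neg, ev_add, ← smul_neg, hvr', neg_neg, dotProduct_smul, dotProduct_smul,
        smul_eq_mul, smul_eq_mul]
      positivity
  · push Not at hr
    obtain ⟨h, hh, hneg⟩ := hr
    filter_upwards [eventually_gt_atTop (ev h x / -(toReal h.1 ⬝ᵥ toReal r))] with s hs hmem
    rw [hH] at hmem
    have h1 := hmem h hh
    rw [ev_add, dotProduct_smul, smul_eq_mul] at h1
    rw [div_lt_iff₀ (by linarith)] at hs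
    linarith

lemma hasDirection_of_mem_initialWalls {d : Wall K} (hd : d ∈ initialWalls K) :
    ∃ v, HasDirection d v := by
  have ht : ∀ u v : M, -u ∈ tangentLattice (cone u v) := fun u v => by
    have h1 : toReal u ∈ (affineSpan ℝ (cone u v)).direction :=
      mem_direction_of_add_mem (x := 0) one_ne_zero ⟨0, 0, le_rfl, le_rfl, by simp⟩
        ⟨1, 0, zero_le_one, le_rfl, by simp⟩
    have h2 := neg_mem h1
    rwa [← toReal_neg] at h2
  rcases hd with ⟨j, -, rfl⟩ | ⟨j, -, rfl⟩
  · refine ⟨-expX.1, hasDirection_onePlus_singleton (c := 1) ?_ (by decide) (ht _ _)⟩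
    rw [pow_one]; exact algebraMap_X
  · refine ⟨-expY.1, hasDirection_onePlus_singleton (c := 1) ?_ (by decide) (ht _ _)⟩
    rw [pow_one]; exact algebraMap_Y

/-- Completions of the initial walls agree at generic points. -/
theorem prodAt_eq_of_isConsistentCompletion {D D' : Set (Wall K)}
    (hD : IsConsistentCompletion (initialWalls K) D)
    (hD' : IsConsistentCompletion (initialWalls K) D') {n : ℕ} {E E' : Finset (Wall K)}
    (hE : (E : Set (Wall K)) = atOrder D n) (hE' : (E' : Set (Wall K)) = atOrder D' n) :
    ∃ A, ∀ x, Gen A x → prodAt E n x = prodAt E' n x := by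
  classical
  have hW : ∀ d ∈ E, IsWall d := fun d hd => hD.wallStructure.1 d (hE.subset hd).1
  have hW' : ∀ d ∈ E', IsWall d := fun d hd => hD'.wallStructure.1 d (hE'.subset hd).1
  have hWW : ∀ d ∈ E ∪ E', IsWall d := fun d hd => (Finset.mem_union.1 hd).elim (hW d) (hW' d)
  -- Initial walls may persist to infinity along their ray but belong to both completions; every
  -- other wall has to end. The ray is chosen from the wall alone, so the choice is the same for
  -- both structures.
  let Q : Wall K → M → Prop := fun d r => (∀ n, HasRay n d r) ∧
    (d ∈ initialWalls K ∨ ∀ x, ∀ᶠ s : ℝ in atTop, x + s • toReal r ∉ d.carrier)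
  have hex : ∀ d ∈ E ∪ E', ∃ r, Q d r := by
    intro d hd
    by_cases hi : d ∈ initialWalls K
    · obtain ⟨v, hv⟩ := hasDirection_of_mem_initialWalls hi
      obtain ⟨r, g, -, -, hr⟩ := hv.exists_hasRay (hWW d hd)
      exact ⟨r, hr, Or.inl hi⟩
    · obtain ⟨v, hv, hinc⟩ : IsNonIncoming d := by
        rcases Finset.mem_union.1 hd with h | h
        · exact hD.nonIncoming d ⟨(hE.subset h).1, hi⟩
        · exact hD'.nonIncoming d ⟨(hE'.subset h).1, hi⟩
      obtain ⟨r, g, hg, hvr, hr⟩ := hv.exists_hasRay (hWW d hd)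
      exact ⟨r, hr, Or.inr (eventually_notMem_of_not_isIncoming (hWW d hd) hg hvr hinc)⟩
  let ρ : Wall K → M := fun d => if h : ∃ r, Q d r then h.choose else 0
  have hρ : ∀ d ∈ E ∪ E', Q d (ρ d) := fun d hd => by
    simp only [ρ, dif_pos (hex d hd)]
    exact (hex d hd).choose_spec
  obtain ⟨A, hA⟩ := exists_presentedBy (E ∪ E') hWW
  have hAE := hA.mono Finset.subset_union_left
  have hAE' := hA.mono Finset.subset_union_right
  refine ⟨A, fun x hx => prodAt_eq_of_loopTrivial (ray := ρ) hW hW'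
    (fun d hd => (hρ d (Finset.mem_union_left _ hd)).1 n)
    (fun d hd => (hρ d (Finset.mem_union_right _ hd)).1 n) hAE hAE'
    (fun y w hw hyw => ⟨hD.consistent.loopTrivialAt hD.wallStructure.1 hE hAE hw hyw,
      hD'.consistent.loopTrivialAt hD'.wallStructure.1 hE' hAE' hw hyw⟩) (fun x r => ?_) hx⟩
  have hev : ∀ᶠ s : ℝ in atTop, ∀ d ∈ E ∪ E', ρ d = r →
      x + s • toReal r ∈ d.carrier → d ∈ initialWalls K := by
    refine (Finset.eventually_all _).2 fun d hd => ?_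
    rcases (hρ d hd).2 with h | h
    · exact Eventually.of_forall fun _ _ _ => h
    · filter_upwards [h x] with s hs hdr hmem
      exact absurd hmem (hdr ▸ hs)
  obtain ⟨S, hS⟩ := eventually_atTop.1 hev
  refine ⟨max S 0, le_max_right _ _, fun s hs d hdr hmem => ?_⟩
  have hinit : ∀ d' ∈ E ∪ E', d' = d → d ∈ initialWalls K := by
    rintro d' hd' rfl
    exact hS s ((le_max_left _ _).trans hs) d' hd' hdr hmem
  constructor
  · intro hd
    have hi := hinit d (Finset.mem_union_left _ hd) rfl
    exact hE'.superset ⟨hD'.contains hi, (hE.subset hd).2⟩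
  · intro hd
    have hi := hinit d (Finset.mem_union_right _ hd) rfl
    exact hE.superset ⟨hD.contains hi, (hE'.subset hd).2⟩

open Classical in
-- Any two models have equal products at every point, since only the product over each cone enters;
-- this identifies the split and the final structures.
lemma IsModel.prodAt_eq {D : Finset (Wall K)} {n : ℕ} (hD : IsModel D n) (x : MR) :
    prodAt D n x = ∏ i with x ∈ cell i, cellFun K n i := by
  rw [Finset.prod_filter, prodAt,
    ← Finset.prod_fiberwise_of_maps_to (g := fun d => d.carrier)
      (t := (Finset.univ : Finset (Fin 3 × Fin 5)).image cell)]
  · rw [Finset.prod_image fun i _ i' _ h => cell_injective h]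
    refine Finset.prod_congr rfl fun i _ => ?_
    rw [Finset.filter_filter]
    split_ifs with hx
    · rw [← hD.prod i]
      refine Finset.prod_congr (Finset.filter_congr fun d _ => ?_) fun _ _ => rfl
      exact ⟨fun h => h.2, fun h => ⟨h ▸ hx, h⟩⟩
    · refine Finset.prod_eq_one fun d hd => ?_
      obtain ⟨-, h1, h2⟩ := Finset.mem_filter.1 hd
      exact absurd (h2 ▸ h1) hx
  · intro d hd
    obtain ⟨i, hi, -⟩ := hD.carrier d (Finset.mem_filter.1 hd).1
    exact Finset.mem_image.2 ⟨i, Finset.mem_univ _, hi.symm⟩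

/-! ### From generic points to path-ordered products -/

/-- A small step along ν ⨯₃ u stays in the plane of ν. For generic u it changes every function of A
that vanishes at x and is not parallel to ν, and also c when it is not parallel to ν. -/
lemma exists_gen_near (A : Finset (M × ℤ)) {ν : MR} (hν : ν ≠ 0) (c x : MR) {V : Set MR}
    (hV : V ∈ 𝓝 x) : ∃ y ∈ V, ν ⬝ᵥ y = ν ⬝ᵥ x ∧ Gen A y ∧
      (c ⨯₃ ν ≠ 0 → c ⬝ᵥ y ≠ c ⬝ᵥ x) := by
  classical
  obtain ⟨u, hu⟩ := exists_generic_vector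
    (((insert c (A.image fun h => toReal h.1)).image fun h => h ⨯₃ ν).filter fun h => h ≠ 0)
    fun h hh => (Finset.mem_filter.1 hh).2
  have hu' : ∀ h ∈ insert c (A.image fun h => toReal h.1), h ⨯₃ ν ≠ 0 → h ⬝ᵥ (ν ⨯₃ u) ≠ 0 := by
    intro h hh h0
    rw [triple_product_permutation, triple_product_permutation, dotProduct_comm]
    exact hu _ (Finset.mem_filter.2 ⟨Finset.mem_image_of_mem _ hh, h0⟩)
  have hνv : ν ⬝ᵥ (ν ⨯₃ u) = 0 := dot_self_cross _ _
  set v := ν ⨯₃ u with hv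
  obtain ⟨δ, hδ, hall⟩ := exists_pos_of_eventually_add (u := v)
    (p := fun y => y ∈ V ∧ ∀ h ∈ A, (0 < ev h x → 0 < ev h y) ∧ (ev h x < 0 → ev h y < 0))
    (Filter.Eventually.and hV (eventually_sign A x))
  have hε : (0 : ℝ) < δ / 2 := by positivity
  obtain ⟨h1, h2⟩ := hall (δ / 2) (by rw [abs_of_pos hε]; linarith)
  generalize δ / 2 = ε at hε h1 h2
  refine ⟨x + ε • v, h1, by rw [dotProduct_add, dotProduct_smul, hνv, smul_zero, add_zero],
    ⟨ν, fun h hA h0 => ?_⟩, fun hc h0 => ?_⟩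
  · have hx0 : ev h x = 0 := by
      rcases lt_trichotomy (ev h x) 0 with h3 | h3 | h3
      · linarith [(h2 h hA).2 h3]
      · exact h3
      · linarith [(h2 h hA).1 h3]
    rw [ev_add, hx0, zero_add, dotProduct_smul, smul_eq_mul] at h0
    refine exists_smul_of_cross_eq_zero hν ?_
    by_contra hne
    exact hu' _ (Finset.mem_insert_of_mem (Finset.mem_image_of_mem _ hA)) hne
      ((mul_eq_zero.1 h0).resolve_left hε.ne')
  · rw [dotProduct_add, add_eq_left, dotProduct_smul, smul_eq_mul] at h0
    exact hu' c (Finset.mem_insert_self _ _) hc ((mul_eq_zero.1 h0).resolve_left hε.ne')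

/-- The product at x equals the product at a nearby generic point of the same plane, where D and F
agree. If the walls of F fill a transversal plane, that point can be taken off it, and the common
value there is 1. -/
lemma LocPlanar.prodAt_compare {D F : Finset (Wall K)} (hD : ∀ d ∈ D, IsWall d)
    (hF : ∀ d ∈ F, IsWall d) {n : ℕ} {A : Finset (M × ℤ)}
    (hgen : ∀ y, Gen A y → prodAt D n y = prodAt F n y) {x : MR} {ν ν' : M} (hν : ν ≠ 0)
    (hp : LocPlanar (D : Set (Wall K)) x ν) (hp' : LocPlanar (F : Set (Wall K)) x ν') :
    (toReal ν' ⨯₃ toReal ν = 0 → prodAt D n x = prodAt F n x) ∧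
      (toReal ν' ⨯₃ toReal ν ≠ 0 → prodAt D n x = 1) := by
  obtain ⟨y, ⟨hy1, hy2⟩, hyν, hyA, hyν'⟩ := exists_gen_near A (toReal_ne_zero hν) (toReal ν') x
    (Filter.Eventually.and (hp.eventually_mem_iff hD) (hp'.eventually_mem_iff hF))
  have h1 : prodAt D n y = prodAt D n x := prodAt_congr fun d hd => by
    rw [hy1 d hd, and_iff_left hyν]
  constructor
  · intro h0
    obtain ⟨r, hr⟩ := exists_smul_of_cross_eq_zero (toReal_ne_zero hν) h0
    rw [← h1, hgen y hyA]
    refine prodAt_congr fun d hd => ?_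
    rw [hy2 d hd, and_iff_left]
    rw [hr, smul_dotProduct, smul_dotProduct, hyν]
  · intro h0
    rw [← h1, hgen y hyA]
    exact prodAt_eq_one fun d hd hyd => hyν' h0 ((hy2 d hd).1 hyd).2

lemma crossAt_eq_id {D F : Finset (Wall K)} (hD : ∀ d ∈ D, IsWall d) (hF : ∀ d ∈ F, IsWall d)
    {n : ℕ} {A : Finset (M × ℤ)} (hgen : ∀ y, Gen A y → prodAt D n y = prodAt F n y) {γ : ℝ → MR}
    (hγ : IsAdmissible (D : Set (Wall K)) γ) {t : ℝ} (ht : t ∈ Set.Icc (0 : ℝ) 1)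
    (h : ∀ d ∈ F, γ t ∉ d.carrier) : crossAt D n γ t = AlgHom.id K _ := by
  by_cases h1 : ∃ d ∈ D, γ t ∈ d.carrier
  · obtain ⟨d, hd, hx⟩ := h1
    obtain ⟨κ, hp⟩ := exists_locPlanar hD (hγ.avoids t ht)
    obtain ⟨μ, hμ⟩ := hγ.transversal t ht d hd hx
    have hκ0 := (hD d hd).normal_ne_zero (hp d hd hx).1
    have heq := (hp.prodAt_compare hD hF hgen hκ0 (ν' := κ)
      fun d hd hx => absurd hx (h d hd)).1 (cross_self _)
    rw [crossAt_of_crossesAt hD hp hd hμ, heq, prodAt_eq_one h, cross_one]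
  · push Not at h1
    exact crossAt_of_notMem h1

/-- Wall crossings only depend on the products of wall functions at generic points. -/
lemma crossAt_eq_crossAt {D F : Finset (Wall K)} (hD : ∀ d ∈ D, IsWall d)
    (hF : ∀ d ∈ F, IsWall d) {n : ℕ} {A : Finset (M × ℤ)}
    (hgen : ∀ y, Gen A y → prodAt D n y = prodAt F n y) {γ : ℝ → MR}
    (hγ : IsAdmissible (D : Set (Wall K)) γ) (hγ' : IsAdmissible (F : Set (Wall K)) γ) {t : ℝ}
    (ht : t ∈ Set.Icc (0 : ℝ) 1) : crossAt D n γ t = crossAt F n γ t := by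
  have hgen' : ∀ y, Gen A y → prodAt F n y = prodAt D n y := fun y hy => (hgen y hy).symm
  by_cases h1 : ∃ d ∈ D, γ t ∈ d.carrier
  swap
  · push Not at h1
    rw [crossAt_of_notMem h1, crossAt_eq_id hF hD hgen' hγ' ht h1]
  by_cases h2 : ∃ d ∈ F, γ t ∈ d.carrier
  swap
  · push Not at h2
    rw [crossAt_of_notMem h2, crossAt_eq_id hD hF hgen hγ ht h2]
  obtain ⟨d, hd, hx⟩ := h1
  obtain ⟨d', hd', hx'⟩ := h2
  obtain ⟨κ, hp⟩ := exists_locPlanar hD (hγ.avoids t ht)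
  obtain ⟨κ', hp'⟩ := exists_locPlanar hF (hγ'.avoids t ht)
  obtain ⟨μ, hμ⟩ := hγ.transversal t ht d hd hx
  obtain ⟨μ', hμ'⟩ := hγ'.transversal t ht d' hd' hx'
  have hκ := (hp d hd hx).1
  have hκ' := (hp' d' hd' hx').1
  have hκ0 := (hD d hd).normal_ne_zero hκ
  have hκ0' := (hF d' hd').normal_ne_zero hκ'
  rw [crossAt_of_crossesAt hD hp hd hμ, crossAt_of_crossesAt hF hp' hd' hμ']
  -- With parallel normals both structures cross the same plane with the same function and
  -- orientation. With transversal planes both products are 1 and neither crossing does anything.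
  by_cases h0 : toReal κ' ⨯₃ toReal κ = 0
  · rw [(hp.prodAt_compare hD hF hgen hκ0 hp').1 h0]
    congr 1
    obtain ⟨r, hr⟩ := exists_smul_of_cross_eq_zero (toReal_ne_zero hκ0) h0
    have hr0 : r ≠ 0 := by
      rintro rfl
      rw [zero_smul] at hr
      exact toReal_ne_zero hκ0' hr
    obtain ⟨⟨a, ha⟩, -⟩ := (hD d hd).normal_spec hκ
    have hN : IsNormal d'.carrier κ := isNormal_of_direction ha fun u => by
      rw [((hF d' hd').normal_spec hκ').2, hr, smul_dotProduct, smul_eq_mul, mul_eq_zero,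
        or_iff_right hr0]
    refine (hμ.eq_of_eq_or_neg hμ' ?_).symm
    rcases hκ.eq_or_neg ha hμ.2.1 with rfl | rfl <;>
      rcases hN.eq_or_neg ha hμ'.2.1 with rfl | rfl <;> simp
  · have h0' : toReal κ ⨯₃ toReal κ' ≠ 0 := by
      rw [← cross_anticomm]; exact neg_ne_zero.2 h0
    rw [(hp.prodAt_compare hD hF hgen hκ0 hp').2 h0,
      (hp'.prodAt_compare hF hD hgen' hκ0' hp).2 h0', cross_one, cross_one]

/-- Finite sets of walls with the same products at generic points have the same path-ordered
products. -/
theorem IsPathOrderedProduct.eq_of_prodAt_eq {D F : Finset (Wall K)} (hD : ∀ d ∈ D, IsWall d)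
    (hF : ∀ d ∈ F, IsWall d) {n : ℕ} {A : Finset (M × ℤ)}
    (hgen : ∀ y, Gen A y → prodAt D n y = prodAt F n y) {γ : ℝ → MR}
    (hγ : IsAdmissible (D : Set (Wall K)) γ) (hγ' : IsAdmissible (F : Set (Wall K)) γ)
    {θ θ' : KPmod K n →ₐ[K] KPmod K n} (hθ : IsPathOrderedProduct (D : Set (Wall K)) n γ θ)
    (hθ' : IsPathOrderedProduct (F : Set (Wall K)) n γ θ') : θ = θ' := by
  classical
  have hfin := hθ.finite_times hγ
  have hfin' := hθ'.finite_times hγ'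
  set T := (hfin.toFinset ∪ hfin'.toFinset).sort (· ≤ ·) with hT
  have hlt : T.Pairwise (· < ·) := (Finset.sortedLT_sort _).pairwise
  have hTI : ∀ t ∈ T, t ∈ Set.Icc (0 : ℝ) 1 := fun t ht => by
    rw [hT, Finset.mem_sort, Finset.mem_union, Set.Finite.mem_toFinset,
      Set.Finite.mem_toFinset] at ht
    exact ht.elim (fun h => h.1) fun h => h.1
  rw [eq_compose_crossAt D hD hγ hθ hlt hTI fun t ht d hd hx => ?_,
    eq_compose_crossAt F hF hγ' hθ' hlt hTI fun t ht d hd hx => ?_]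
  · exact compose_congr fun t ht => crossAt_eq_crossAt hD hF hgen hγ hγ' (hTI t ht)
  · rw [hT, Finset.mem_sort]
    exact Finset.mem_union_right _ (hfin'.mem_toFinset.2 ⟨ht, d, hd, hx⟩)
  · rw [hT, Finset.mem_sort]
    exact Finset.mem_union_left _ (hfin.mem_toFinset.2 ⟨ht, d, hd, hx⟩)

/-- The uniqueness theorem cannot be applied to the final list directly, as two of its walls have no
direction. It is applied to the split structure, whose products coincide with those of the final
list. -/
theorem equivalent_finalWalls {D : Set (Wall K)}
    (hD : IsConsistentCompletion (initialWalls K) D) : Equivalent D (finalWalls K) := by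
  intro n γ hγ hγ' θ θ' hθ hθ'
  have hfin := hD.wallStructure.2 n
  have hfs := isFunctionModel_splitFuncs (K := K) |>.finite_atOrder n
  have hff := isFunctionModel_finalFuncs (K := K) |>.finite_atOrder n
  rw [finalWalls_eq, ← hff.coe_toFinset] at hγ' hθ'
  rw [← hfin.coe_toFinset] at hγ hθ
  have hms := isFunctionModel_splitFuncs.isModel hfs.coe_toFinset
  have hmf := isFunctionModel_finalFuncs.isModel hff.coe_toFinset
  obtain ⟨A, hA⟩ := prodAt_eq_of_isConsistentCompletion hD isConsistentCompletion_split
    hfin.coe_toFinset hfs.coe_toFinset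
  refine IsPathOrderedProduct.eq_of_prodAt_eq
    (fun d hd => hD.wallStructure.1 d (hfin.coe_toFinset.subset hd).1) hmf.isWall (A := A)
    (fun y hy => ?_) hγ hγ' hθ hθ'
  rw [hA y hy, hms.prodAt_eq, hmf.prodAt_eq]

end WallStructures

theorem proposition5p1 (K : Type*) [Field K] :
    WallStructures.IsWallStructure (WallStructures.finalWalls K) ∧
    WallStructures.IsConsistent (WallStructures.finalWalls K) ∧
    (∃ D : Set (WallStructures.Wall K),
      WallStructures.IsConsistentCompletion (WallStructures.initialWalls K) D) ∧
    (∀ D : Set (WallStructures.Wall K),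
      WallStructures.IsConsistentCompletion (WallStructures.initialWalls K) D →
        WallStructures.Equivalent D (WallStructures.finalWalls K)) := by
  refine ⟨?_, ?_, ⟨_, WallStructures.isConsistentCompletion_split⟩,
    fun D hD => WallStructures.equivalent_finalWalls hD⟩
  · rw [WallStructures.finalWalls_eq]
    exact WallStructures.isFunctionModel_finalFuncs.isWallStructure
  · rw [WallStructures.finalWalls_eq]
    exact WallStructures.isFunctionModel_finalFuncs.isConsistent
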